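/- **Setting.** Let $N^n(C)$ be an $n$-dimensional Riemannian manifold of constant sectional curvature $C\in\mathbb R$, with Levi-Civita connection $\nabla$. Let $J\subseteq\mathbb R$ be a nonempty open interval, $\gamma:J\to N^n(C)$ a smooth curve parametrized by arclength, and $f:J\to(0,+\infty)$ a smooth function. For a smooth curve $\beta$ let $\tau(\beta)=\nabla_{\beta'}\beta'$ be its tension field. The curve $\gamma$ is *$f$-biharmonic* if, for every compact interval $\Omega\subset J$, it is a critical point of $E_{2,f}(\beta)=\int_\Omega f\,|\tau(\beta)|^2\,ds$ with respect to smooth variations of $\gamma$ supported in $\Omega$; it is *biharmonic* if it is in the same sense a critical point of $\frac12\int_\Omega|\tau(\beta)|^2\,ds$; it is *proper $f$-biharmonic* if it is $f$-biharmonic and not biharmonic. Let $\kappa_1,\kappa_2,\kappa_3,\dots\ge 0$ be the Frenet curvatures of $\gamma$: with $F_1=\gamma'$, $\kappa_0=0$, $F_0=0$, they are given by $\kappa_j=|\nabla_{\gamma'}F_j+\kappa_{j-1}F_{j-1}|$ and $\nabla_{\gamma'}F_j=-\kappa_{j-1}F_{j-1}+\kappa_jF_{j+1}$ (where $\kappa_j=0$,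 one puts $F_{j+1}=0$). For real $c$ and $C$, say that $y$ is *of the form $\chi(s,c,C)$* if * for $C<0$: $$y(s)=\frac{1}{C_1e^{2\sqrt{-C}\,s}+C_2e^{-2\sqrt{-C}\,s}\pm\sqrt{4C_1C_2+\frac{1+c^2}{C}}}$$ for some constants $C_1,C_2>0$ with $4C_1C_2+\frac{1+c^2}{C}\ge 0$ and some choice of the sign $\pm$; * for $C=0$: $$y(s)=\frac{4C_3}{16(1+c^2)+C_3^2(s+C_4)^2}$$ for some constants $C_3>0$ and $C_4\in\mathbb R$; * for $C>0$: $$y(s)=\frac{1}{C_4\cos(2\sqrt C\,s)+C_5\sin(2\sqrt C\,s)+\sqrt{\frac{1+c^2}{C}+C_4^2+C_5^2}}$$ for some real constants $C_4,C_5$ with $C_4^2+C_5^2\ne0$. **Theorem.** The curve $\gamma$ is proper $f$-biharmonic if and only if one of the following cases happens: 1. there is a constant $c_1>0$ such that on $J$: $\kappa_2=0$, $\kappa_1$ is of the form $\chi(s,0,C)$, and $f=c_1\kappa_1^{-3/2}$; or 2. there are constants $c_1>0$ and $c_3\neq0$ such that on $J$: $\kappa_3=0$, $\kappa_2/\kappa_1=c_3$,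 $\kappa_1$ is of the form $\chi(s,c_3,C)$, and $f=c_1\kappa_1^{-3/2}$. -/

import Mathlib

open Bundle Set FiberBundle VectorField
open scoped Manifold ContDiff Topology

set_option linter.unusedSectionVars false

noncomputable section

variable {E : Type*} [NormedAddCommGroup E] [NormedSpace ℝ E] [FiniteDimensional ℝ E]
  {H : Type*} [TopologicalSpace H] {I : ModelWithCorners ℝ E H}
  {M : Type*} [TopologicalSpace M] [ChartedSpace H M] [IsManifold I ∞ M]
  [RiemannianBundle (fun x : M => TangentSpace I x)]
  [IsContMDiffRiemannianBundle I ∞ E (fun x : M => TangentSpace I x)]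

/-! ### The Levi-Civita connection of a Riemannian manifold -/

theorem mdiffAt_inner {X Y : Π x : M, TangentSpace I x} {x : M}
    (hX : MDiffAt (T% X) x) (hY : MDiffAt (T% Y) x) :
    MDiffAt (fun y => (inner ℝ (X y) (Y y) : ℝ)) x :=
  MDifferentiableAt.inner_bundle (IB := I) (F := E) (E := fun x : M => TangentSpace I x)
    (b := fun y => y) hX hY

/-- The Koszul expression for `⟨∇_X Y, Z⟩` at `x`. -/
def koszul (Y X Z : Π x : M, TangentSpace I x) (x : M) : ℝ :=
  (d% (fun y => (inner ℝ (Y y) (Z y) : ℝ)) x (X x) + d% (fun y => (inner ℝ (X y) (Z y) : ℝ)) x (Y x)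
    - d% (fun y => (inner ℝ (X y) (Y y) : ℝ)) x (Z x)
    + inner ℝ (mlieBracket I X Y x) (Z x) - inner ℝ (mlieBracket I X Z x) (Y x)
    - inner ℝ (mlieBracket I Y Z x) (X x)) / 2

theorem koszul_tensorial_left {Y Z : Π x : M, TangentSpace I x} {x : M}
    (hY : MDiffAt (T% Y) x) (hZ : MDiffAt (T% Z) x) :
    TensorialAt I E (fun X => koszul Y X Z x) x where
  smul {f X} hf hX := by
    have h1 := mvfderiv_fun_mul hf (mdiffAt_inner hX hZ)
    have h2 := mvfderiv_fun_mul hf (mdiffAt_inner hX hY)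
    simp [koszul, real_inner_smul_left, real_inner_smul_right, h1, h2,
      mlieBracket_smul_left hf hX, inner_add_left]
    ring
  add {X X'} hX hX' := by
    have h1 := mvfderiv_fun_add (mdiffAt_inner hX hZ) (mdiffAt_inner hX' hZ)
    have h2 := mvfderiv_fun_add (mdiffAt_inner hX hY) (mdiffAt_inner hX' hY)
    simp [koszul, inner_add_left, inner_add_right, h1, h2, mlieBracket_add_left hX hX']
    ring

theorem koszul_tensorial_right {Y X : Π x : M, TangentSpace I x} {x : M}
    (hY : MDiffAt (T% Y) x) (hX : MDiffAt (T% X) x) :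
    TensorialAt I E (fun Z => koszul Y X Z x) x where
  smul {f Z} hf hZ := by
    have h1 := mvfderiv_fun_mul hf (mdiffAt_inner hX hZ)
    have h2 := mvfderiv_fun_mul hf (mdiffAt_inner hY hZ)
    simp [koszul, real_inner_smul_left, real_inner_smul_right, h1, h2,
      mlieBracket_smul_right hf hZ, inner_add_left]
    rw [real_inner_comm (Z x) (Y x), real_inner_comm (Z x) (X x)]
    ring
  add {Z Z'} hZ hZ' := by
    have h1 := mvfderiv_fun_add (mdiffAt_inner hX hZ) (mdiffAt_inner hX hZ')
    have h2 := mvfderiv_fun_add (mdiffAt_inner hY hZ) (mdiffAt_inner hY hZ')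
    simp [koszul, inner_add_left, inner_add_right, h1, h2, mlieBracket_add_right hZ hZ']
    ring

theorem koszul_add {Y Y' X Z : Π x : M, TangentSpace I x} {x : M}
    (hY : MDiffAt (T% Y) x) (hY' : MDiffAt (T% Y') x)
    (hX : MDiffAt (T% X) x) (hZ : MDiffAt (T% Z) x) :
    koszul (Y + Y') X Z x = koszul Y X Z x + koszul Y' X Z x := by
  have h1 := mvfderiv_fun_add (mdiffAt_inner hY hZ) (mdiffAt_inner hY' hZ)
  have h2 := mvfderiv_fun_add (mdiffAt_inner hX hY) (mdiffAt_inner hX hY')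
  simp [koszul, inner_add_left, inner_add_right, h1, h2, mlieBracket_add_right hY hY',
    mlieBracket_add_left hY hY']
  ring

theorem koszul_smul {Y X Z : Π x : M, TangentSpace I x} {f : M → ℝ} {x : M}
    (hf : MDiffAt f x) (hY : MDiffAt (T% Y) x)
    (hX : MDiffAt (T% X) x) (hZ : MDiffAt (T% Z) x) :
    koszul (f • Y) X Z x = f x * koszul Y X Z x + d% f x (X x) * inner ℝ (Y x) (Z x) := by
  have h1 := mvfderiv_fun_mul hf (mdiffAt_inner hY hZ)
  have h2 := mvfderiv_fun_mul hf (mdiffAt_inner hX hY)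
  simp [koszul, inner_add_left, real_inner_smul_left, real_inner_smul_right, h1, h2,
    mlieBracket_smul_left hf hY, mlieBracket_smul_right hf hY]
  rw [real_inner_comm (Y x) (X x)]
  ring

open Classical in
/-- The linear map `v ↦ ∇_v Y` on `T_x M`, obtained by Riesz duality from the Koszul formula (and `0`
by convention if `Y` is not differentiable at `x`). -/
def leviCivitaFun (Y : Π x : M, TangentSpace I x) (x : M) :
    TangentSpace I x →L[ℝ] TangentSpace I x :=
  if hY : MDiffAt (T% Y) x then
    haveI : FiniteDimensional ℝ (TangentSpace I x) := inferInstanceAs (FiniteDimensional ℝ E)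
    haveI : CompleteSpace (TangentSpace I x) := FiniteDimensional.complete ℝ _
    (InnerProductSpace.toDual ℝ
        (TangentSpace I x)).symm.toContinuousLinearEquiv.toContinuousLinearMap ∘L
      TensorialAt.mkHom₂ (fun X Z => koszul Y X Z x) x
        (fun _ hZ => koszul_tensorial_left hY hZ) (fun _ hX => koszul_tensorial_right hY hX)
  else 0

theorem inner_leviCivitaFun {Y X Z : Π x : M, TangentSpace I x} {x : M}
    (hY : MDiffAt (T% Y) x) (hX : MDiffAt (T% X) x) (hZ : MDiffAt (T% Z) x) :
    inner ℝ (leviCivitaFun Y x (X x)) (Z x) = koszul Y X Z x := by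
  rw [leviCivitaFun, dif_pos hY, ← TensorialAt.mkHom₂_apply (Φ := fun X Z => koszul Y X Z x)
    (fun _ hZ => koszul_tensorial_left hY hZ) (fun _ hX => koszul_tensorial_right hY hX) hX hZ]
  simp

theorem inner_leviCivitaFun_extend {Y : Π x : M, TangentSpace I x} {x : M}
    (hY : MDiffAt (T% Y) x) (v w : TangentSpace I x) :
    inner ℝ (leviCivitaFun Y x v) w = koszul Y (extend E v) (extend E w) x := by
  rw [← inner_leviCivitaFun hY (mdifferentiableAt_extend I E v) (mdifferentiableAt_extend I E w),
    extend_apply_self, extend_apply_self]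

variable (I M) in
/-- The Levi-Civita connection: `leviCivita I M Y x v` is `∇_v Y` at the point `x`. -/
def leviCivita : CovariantDerivative I E (fun x : M => TangentSpace I x) where
  toFun := leviCivitaFun
  isCovariantDerivativeOnUniv :=
    { add := by
        intro Y Y' x hY hY' _
        ext v : 1
        refine ext_inner_right ℝ fun u => ?_
        have hX := mdifferentiableAt_extend I E v
        have hZ := mdifferentiableAt_extend I E u
        rw [_root_.add_apply, inner_add_left, inner_leviCivitaFun_extend hY,
          inner_leviCivitaFun_extend hY',
          inner_leviCivitaFun_extend (mdifferentiableAt_add_section hY hY'),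
          koszul_add hY hY' hX hZ]
      leibniz := by
        intro Y f x hY hf _
        ext v : 1
        refine ext_inner_right ℝ fun u => ?_
        have hX := mdifferentiableAt_extend I E v
        have hZ := mdifferentiableAt_extend I E u
        rw [_root_.add_apply, inner_add_left, inner_leviCivitaFun_extend (hf.smul_section hY),
          koszul_smul hf hY hX hZ, _root_.smul_apply, real_inner_smul_left,
          inner_leviCivitaFun_extend hY, ContinuousLinearMap.smulRight_apply,
          real_inner_smul_left, extend_apply_self, extend_apply_self] }

theorem inner_leviCivita {Y X Z : Π x : M, TangentSpace I x} {x : M}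
    (hY : MDiffAt (T% Y) x) (hX : MDiffAt (T% X) x) (hZ : MDiffAt (T% Z) x) :
    inner ℝ (leviCivita I M Y x (X x)) (Z x) = koszul Y X Z x :=
  inner_leviCivitaFun hY hX hZ

/-- The Levi-Civita connection is compatible with the metric. -/
theorem leviCivita_metric {Y X Z : Π x : M, TangentSpace I x} {x : M}
    (hY : MDiffAt (T% Y) x) (hX : MDiffAt (T% X) x) (hZ : MDiffAt (T% Z) x) :
    d% (fun y => (inner ℝ (Y y) (Z y) : ℝ)) x (X x)
      = inner ℝ (leviCivita I M Y x (X x)) (Z x) + inner ℝ (Y x) (leviCivita I M Z x (X x)) := by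
  rw [real_inner_comm (leviCivita I M Z x (X x)) (Y x), inner_leviCivita hY hX hZ,
    inner_leviCivita hZ hX hY]
  have : (fun y => (inner ℝ (Z y) (Y y) : ℝ)) = fun y => inner ℝ (Y y) (Z y) := by
    ext y; exact real_inner_comm _ _
  simp only [koszul, this]
  rw [mlieBracket_swap_apply (V := Z) (W := Y), inner_neg_left]
  ring

/-- The Levi-Civita connection is torsion free. -/
theorem leviCivita_torsion : (leviCivita I M).torsion = 0 := by
  rw [CovariantDerivative.torsion_eq_zero_iff]
  intro X Y x hX hY
  refine ext_inner_right ℝ fun u => ?_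
  have hZ := mdifferentiableAt_extend I E u
  have hu : extend E u x = u := extend_apply_self E u
  rw [← hu, inner_sub_left, inner_leviCivita hY hX hZ, inner_leviCivita hX hY hZ]
  have : (fun y => (inner ℝ (Y y) (X y) : ℝ)) = fun y => inner ℝ (X y) (Y y) := by
    ext y; exact real_inner_comm _ _
  simp only [koszul, this]
  rw [mlieBracket_swap_apply (V := Y) (W := X), inner_neg_left]
  ring

/-! ### Curvature -/

/-- The curvature operator `R(X,Y)Z = ∇_X ∇_Y Z - ∇_Y ∇_X Z - ∇_[X,Y] Z` at `x`. -/
def riemannCurvature (X Y Z : Π x : M, TangentSpace I x) (x : M) : TangentSpace I x :=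
  leviCivita I M (fun y => leviCivita I M Z y (Y y)) x (X x)
    - leviCivita I M (fun y => leviCivita I M Z y (X y)) x (Y x)
    - leviCivita I M Z x (mlieBracket I X Y x)

variable (I M) in
/-- Every tangent plane has sectional curvature `C`, i.e.
`⟨R(X,Y)Y, X⟩ = C (|X|² |Y|² - ⟨X,Y⟩²)`. -/
def HasConstantSectionalCurvature (C : ℝ) : Prop :=
  ∀ (x : M) (X Y : Π x : M, TangentSpace I x), CMDiffAt ∞ (T% X) x → CMDiffAt ∞ (T% Y) x →
    inner ℝ (riemannCurvature X Y Y x) (X x)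
      = C * (inner ℝ (X x) (X x) * inner ℝ (Y x) (Y x) - inner ℝ (X x) (Y x) ^ 2)

/-! ### Curves -/

variable (I) in
/-- The velocity `γ'(s)`. -/
def velocity (γ : ℝ → M) (s : ℝ) : TangentSpace I (γ s) :=
  mfderiv 𝓘(ℝ, ℝ) I γ s (1 : ℝ)

variable (I) in
/-- The covariant derivative `∇_{γ'} V` at `s₀` of a vector field `V` along the curve `γ`. In the
frame `(e_i)` of the trivialization of the tangent bundle around `γ s₀`, and with
`V = ∑ V^i e_i`, this is `∑ (V^i)'(s₀) e_i + ∑ V^i(s₀) ∇_{γ'(s₀)} e_i`; the field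
`extend E (V s₀)` is `∑ V^i(s₀) e_i`. -/
def covDerivAlong (γ : ℝ → M) (V : Π s : ℝ, TangentSpace I (γ s)) (s₀ : ℝ) :
    TangentSpace I (γ s₀) :=
  (trivializationAt E (TangentSpace I : M → Type _) (γ s₀)).symm (γ s₀)
      (deriv (fun s => (trivializationAt E (TangentSpace I : M → Type _) (γ s₀)
        (⟨γ s, V s⟩ : TotalSpace E (TangentSpace I : M → Type _))).2) s₀)
    + leviCivita I M (extend E (V s₀)) (γ s₀) (velocity I γ s₀)

variable (I) in
/-- The tension field `τ(γ) = ∇_{γ'} γ'` of a curve, the domain carrying the metric `ds²`. -/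
def tension (γ : ℝ → M) (s : ℝ) : TangentSpace I (γ s) :=
  covDerivAlong I γ (velocity I γ) s

variable (I) in
/-- The triple `(κ_j, F_j, F_{j+1})` of Frenet curvatures and Frenet vectors of `γ`, determined by
`κ_0 = 0`, `F_0 = 0`, `F_1 = γ'` and `κ_{j+1} F_{j+2} = ∇_{γ'} F_{j+1} + κ_j F_j` with
`κ_{j+1} = |∇_{γ'} F_{j+1} + κ_j F_j|`; a vector `F_{j+2}` is `0` by convention where
`κ_{j+1} = 0`. -/
def frenetData (γ : ℝ → M) :
    ℕ → (ℝ → ℝ) × (Π s : ℝ, TangentSpace I (γ s)) × (Π s : ℝ, TangentSpace I (γ s))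
  | 0 => (fun _ => 0, fun _ => 0, velocity I γ)
  | j + 1 =>
    let κ := (frenetData γ j).1
    let P := (frenetData γ j).2.1
    let Q := (frenetData γ j).2.2
    let W : Π s : ℝ, TangentSpace I (γ s) := fun s => covDerivAlong I γ Q s + κ s • P s
    (fun s => ‖W s‖, Q, fun s => ‖W s‖⁻¹ • W s)

variable (I) in
/-- The Frenet curvature `κ_j` of `γ`, for `j = 1, 2, …`. -/
def frenetCurvature (γ : ℝ → M) (j : ℕ) : ℝ → ℝ :=
  (frenetData I γ j).1

/-! ### `f`-biharmonic curves -/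

variable (I) in
/-- `F t s` is a smooth variation, `|t| < ε`, of the curve `γ` on `J`, supported in `[c, d]`. -/
structure IsVariation (γ : ℝ → M) (J : Set ℝ) (c d ε : ℝ) (F : ℝ → ℝ → M) : Prop where
  smooth : ContMDiffOn 𝓘(ℝ, ℝ × ℝ) I ∞ (fun p : ℝ × ℝ => F p.1 p.2) (Ioo (-ε) ε ×ˢ J)
  zero : ∀ s ∈ J, F 0 s = γ s
  fixed : ∀ t ∈ Ioo (-ε) ε, ∀ s ∈ J \ Icc c d, F t s = γ s

variable (I) in
/-- The curve `γ` on the open interval `J` is a critical point of `∫ w |τ|² ds` over every compact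
interval in `J`, with respect to the variations supported in that interval. -/
def IsCriticalCurve (w : ℝ → ℝ) (J : Set ℝ) (γ : ℝ → M) : Prop :=
  ∀ c d : ℝ, c ≤ d → Icc c d ⊆ J → ∀ ε > 0, ∀ F : ℝ → ℝ → M, IsVariation I γ J c d ε F →
    HasDerivAt (fun t => ∫ s in c..d, w s * ‖tension I (F t) s‖ ^ 2) 0 0

variable (I) in
/-- `γ` is `f`-biharmonic on `J`. -/
def IsFBiharmonicCurve (f : ℝ → ℝ) (J : Set ℝ) (γ : ℝ → M) : Prop :=
  IsCriticalCurve I f J γ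

variable (I) in
/-- `γ` is biharmonic on `J`. -/
def IsBiharmonicCurve (J : Set ℝ) (γ : ℝ → M) : Prop :=
  IsCriticalCurve I (fun _ => 1 / 2) J γ

variable (I) in
/-- `γ` is properly `f`-biharmonic on `J`. -/
def IsProperFBiharmonicCurve (f : ℝ → ℝ) (J : Set ℝ) (γ : ℝ → M) : Prop :=
  IsFBiharmonicCurve I f J γ ∧ ¬ IsBiharmonicCurve I J γ

/-- `y` is one of the functions `χ(·, c, C)`; the sign of the root for `C < 0` is either one. -/
def IsChi (c C : ℝ) (y : ℝ → ℝ) : Prop :=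
  (C < 0 ∧ ∃ C₁ > 0, ∃ C₂ > 0, ∃ σ : ℝ, (σ = 1 ∨ σ = -1) ∧ 0 ≤ 4 * C₁ * C₂ + (1 + c ^ 2) / C ∧
    y = fun s => 1 / (C₁ * Real.exp (2 * √(-C) * s) + C₂ * Real.exp (-(2 * √(-C) * s))
      + σ * √(4 * C₁ * C₂ + (1 + c ^ 2) / C))) ∨
  (C = 0 ∧ ∃ C₃ > 0, ∃ C₄ : ℝ,
    y = fun s => 4 * C₃ / (16 * (1 + c ^ 2) + C₃ ^ 2 * (s + C₄) ^ 2)) ∨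
  (0 < C ∧ ∃ C₄ C₅ : ℝ, C₄ ^ 2 + C₅ ^ 2 ≠ 0 ∧
    y = fun s => 1 / (C₄ * Real.cos (2 * √C * s) + C₅ * Real.sin (2 * √C * s)
      + √((1 + c ^ 2) / C + (C₄ ^ 2 + C₅ ^ 2))))

end

/-! Write T = γ', τ = ∇_T T, κ = κ₁ = |τ|. For a variation with field V one has ∇_t τ = ∇_T∇_T V +
R(V,T)T. In constant curvature, with |T| = 1 and τ ⊥ T, the curvature term paired with τ is C⟨V,τ⟩.
Two integrations by parts show that γ is critical for ∫ w|τ|² iff W = wτ satisfies ∇_T∇_T W + C W =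
0 (`isCriticalCurve_iff`).

The tangential part of this equation makes |W|⁶/w² constant, so w²κ³ is constant
(`exists_const_of_eulerLagrange`). No frame is needed for this. Hence either τ vanishes identically,
and γ is biharmonic, or κ > 0 throughout and f = c₁κ^(-3/2). In the second case put N = τ/κ, B = ∇_T
N + κT = κ₂F₃ and g = fκ, so that g²κ = a is constant and the equation becomes g∇_T B + 2g'B + (g''
- gκ² + Cg)N = 0. Pairing with N gives g'' = g(κ² + |B|² - C). Pairing with B makes g⁴|B|² constant,
that is κ₂ = cκ₁. What is left is ∇_T B = (κ'/κ)B - (cκ)²N, which means κ₃ = 0 if c > 0 and is empty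
if c = 0 (`exists_isFrenetSolution`).

The scalar equation linearizes for v = 1/κ = g²/a: v'' = 4e - 4Cv, with first integral v'² = 4(2ev -
(1+c²) - Cv²). Its nonconstant positive solutions are the functions 1/χ
(`IsRadiusSolution.exists_isChi`, `IsChi.exists_isRadiusSolution`); constant ones occur only for C >
0 and are excluded by C₄² + C₅² ≠ 0.

Finally, biharmonicity is the case of constant weight and forces κ to be constant. Conversely, if κ
is constant so is f, and γ is biharmonic. Thus proper means that κ is not constant
(`isProperFBiharmonicCurve_iff`). -/

section

set_option linter.unusedSectionVars false
set_option maxSynthPendingDepth 3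

/-! ### Local Riemannian geometry in coordinates: curvature identities and the variation of
acceleration. -/

noncomputable section

namespace LocalMetric

/-! ### Metrics on open subsets of a vector space -/

variable {E : Type*} [NormedAddCommGroup E] [NormedSpace ℝ E] [FiniteDimensional ℝ E]

theorem two_le_smooth : (2 : ℕ∞ω) ≤ ∞ := WithTop.coe_le_coe.2 le_top

theorem _root_.HasFDerivAt.clm_apply_const {F F' : Type*} [NormedAddCommGroup F] [NormedSpace ℝ F]
    [NormedAddCommGroup F'] [NormedSpace ℝ F'] {f : E → F →L[ℝ] F'} {f' : E →L[ℝ] F →L[ℝ] F'}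
    {y : E} (h : HasFDerivAt f f' y) (u : F) : HasFDerivAt (fun z => f z u) (f'.flip u) y := by
  simpa using h.clm_apply (hasFDerivAt_const u y)

/-- `G` is a smooth Riemannian metric on the open subset `U` of the vector space `E`. -/
structure IsMetricOn (U : Set E) (G : E → E →L[ℝ] E →L[ℝ] ℝ) : Prop where
  isOpen : IsOpen U
  smooth : ContDiffOn ℝ ∞ G U
  symm : ∀ y ∈ U, ∀ u v, G y u v = G y v u
  pos : ∀ y ∈ U, ∀ u, u ≠ 0 → 0 < G y u u

/-- The linear operation turning the first derivative of a metric into its Koszul form. -/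
def koszulForm (D : E →L[ℝ] E →L[ℝ] E →L[ℝ] ℝ) : E →L[ℝ] E →L[ℝ] E →L[ℝ] ℝ :=
  (1 / 2 : ℝ) • (D + D.flip
    - ((ContinuousLinearMap.flipₗᵢ ℝ E E ℝ).toContinuousLinearEquiv :
        (E →L[ℝ] E →L[ℝ] ℝ) →L[ℝ] (E →L[ℝ] E →L[ℝ] ℝ)) ∘L D.flip)

theorem koszulForm_apply (D : E →L[ℝ] E →L[ℝ] E →L[ℝ] ℝ) (u v w : E) :
    koszulForm D u v w = (D u v w + D v u w - D w u v) / 2 := by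
  simp [koszulForm]
  ring

/-- The Christoffel symbols of the metric `G`. -/
def christoffel (G : E → E →L[ℝ] E →L[ℝ] ℝ) (y : E) : E →L[ℝ] E →L[ℝ] E :=
  ContinuousLinearMap.compL ℝ E (E →L[ℝ] ℝ) E (ContinuousLinearMap.inverse (G y)) ∘L
    koszulForm (fderiv ℝ G y)

/-- The curvature of the metric `G`. -/
def curv (G : E → E →L[ℝ] E →L[ℝ] ℝ) (y u v w : E) : E :=
  fderiv ℝ (christoffel G) y u v w - fderiv ℝ (christoffel G) y v u w
    + christoffel G y u (christoffel G y v w) - christoffel G y v (christoffel G y u w)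

theorem contDiffOn_koszulForm {U : Set E} {f : E → E →L[ℝ] E →L[ℝ] E →L[ℝ] ℝ}
    (hf : ContDiffOn ℝ ∞ f U) : ContDiffOn ℝ ∞ (fun y => koszulForm (f y)) U := by
  refine contDiffOn_clm_apply.2 fun u => contDiffOn_clm_apply.2 fun v =>
    contDiffOn_clm_apply.2 fun w => ?_
  simp only [koszulForm_apply]
  have h : ∀ a b c : E, ContDiffOn ℝ ∞ (fun y => f y a b c) U := fun a b c =>
    ((hf.clm_apply contDiffOn_const).clm_apply contDiffOn_const).clm_apply contDiffOn_const
  exact (((h u v w).add (h v u w)).sub (h w u v)).div_const 2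

namespace IsMetricOn

variable {U : Set E} {G : E → E →L[ℝ] E →L[ℝ] ℝ}

/-- Definiteness gives injectivity, and `E` has the dimension of its dual. Without invertibility
`ContinuousLinearMap.inverse`, and with it `christoffel`, would be the default value 0. -/
theorem isInvertible (h : IsMetricOn U G) {y : E} (hy : y ∈ U) : (G y).IsInvertible := by
  have hinj : Function.Injective (G y).toLinearMap := by
    rw [← LinearMap.ker_eq_bot, LinearMap.ker_eq_bot']
    intro u hu
    by_contra hne
    have := h.pos y hy u hne
    have h0 : G y u = 0 := hu
    simp [h0] at this
  have hfr : Module.finrank ℝ E = Module.finrank ℝ (E →L[ℝ] ℝ) := by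
    rw [(LinearMap.toContinuousLinearMap (𝕜 := ℝ) (E := E) (F' := ℝ)).symm.finrank_eq]
    exact (Subspace.dual_finrank_eq (K := ℝ) (V := E)).symm
  exact ⟨(LinearEquiv.ofInjectiveOfFinrankEq _ hinj hfr).toContinuousLinearEquiv, by ext; rfl⟩

theorem ext_of_apply (h : IsMetricOn U G) {y : E} (hy : y ∈ U) {u v : E}
    (huv : ∀ w, G y u w = G y v w) : u = v := by
  by_contra hne
  have := h.pos y hy (u - v) (sub_ne_zero.2 hne)
  have h0 : G y (u - v) (u - v) = 0 := by
    rw [map_sub (G y), _root_.sub_apply, huv, sub_self]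
  exact this.ne' h0

theorem apply_christoffel (h : IsMetricOn U G) {y : E} (hy : y ∈ U) (u v w : E) :
    G y (christoffel G y u v) w
      = (fderiv ℝ G y u v w + fderiv ℝ G y v u w - fderiv ℝ G y w u v) / 2 := by
  obtain ⟨e, he⟩ := h.isInvertible hy
  rw [← koszulForm_apply]
  have : christoffel G y u v = e.symm (koszulForm (fderiv ℝ G y) u v) := by
    simp [christoffel, ← he]
  rw [this, ← he]
  simp

theorem contDiffOn_christoffel (h : IsMetricOn U G) : ContDiffOn ℝ ∞ (christoffel G) U := by
  have hD : ContDiffOn ℝ ∞ (fderiv ℝ G) U := h.smooth.fderiv_of_isOpen h.isOpen (by simp)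
  have hinv : ContDiffOn ℝ ∞ (fun y => ContinuousLinearMap.inverse (G y)) U := fun y hy =>
    (h.isInvertible hy).contDiffAt_map_inverse.comp_contDiffWithinAt y (h.smooth y hy)
  exact ((ContinuousLinearMap.compL ℝ E (E →L[ℝ] ℝ) E).contDiff.comp_contDiffOn hinv).clm_comp
    (contDiffOn_koszulForm hD)

theorem differentiableAt (h : IsMetricOn U G) {y : E} (hy : y ∈ U) : DifferentiableAt ℝ G y :=
  (h.smooth.contDiffAt (h.isOpen.mem_nhds hy)).differentiableAt (by simp)

theorem differentiableAt_christoffel (h : IsMetricOn U G) {y : E} (hy : y ∈ U) :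
    DifferentiableAt ℝ (christoffel G) y :=
  (h.contDiffOn_christoffel.contDiffAt (h.isOpen.mem_nhds hy)).differentiableAt (by simp)

theorem fderiv_symm (h : IsMetricOn U G) {y : E} (hy : y ∈ U) (w u v : E) :
    fderiv ℝ G y w u v = fderiv ℝ G y w v u := by
  have h1 : HasFDerivAt (fun z => G z u v) (((fderiv ℝ G y).flip u).flip v) y :=
    ((h.differentiableAt hy).hasFDerivAt.clm_apply_const u).clm_apply_const v
  have h2 : HasFDerivAt (fun z => G z v u) (((fderiv ℝ G y).flip v).flip u) y :=
    ((h.differentiableAt hy).hasFDerivAt.clm_apply_const v).clm_apply_const u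
  have h3 : (fun z => G z u v) =ᶠ[𝓝 y] fun z => G z v u := by
    filter_upwards [h.isOpen.mem_nhds hy] with z hz using h.symm z hz u v
  have := (h1.congr_of_eventuallyEq h3.symm).unique h2
  exact congr($this w)

theorem christoffel_symm (h : IsMetricOn U G) {y : E} (hy : y ∈ U) (u v : E) :
    christoffel G y u v = christoffel G y v u := by
  refine h.ext_of_apply hy fun w => ?_
  rw [h.apply_christoffel hy, h.apply_christoffel hy, h.fderiv_symm hy w u v]
  ring

/-- Compatibility of the Christoffel symbols with the metric. -/
theorem fderiv_apply (h : IsMetricOn U G) {y : E} (hy : y ∈ U) (w u v : E) :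
    fderiv ℝ G y w u v = G y (christoffel G y w u) v + G y u (christoffel G y w v) := by
  rw [h.symm y hy u, h.apply_christoffel hy, h.apply_christoffel hy, h.fderiv_symm hy w v u,
    h.fderiv_symm hy v w u, h.fderiv_symm hy u w v]
  ring

theorem fderiv_christoffel_symm (h : IsMetricOn U G) {y : E} (hy : y ∈ U) (w u v : E) :
    fderiv ℝ (christoffel G) y w u v = fderiv ℝ (christoffel G) y w v u := by
  have key : ∀ a b : E, HasFDerivAt (fun z => christoffel G z a b)
      (((fderiv ℝ (christoffel G) y).flip a).flip b) y := fun a b =>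
    ((h.differentiableAt_christoffel hy).hasFDerivAt.clm_apply_const a).clm_apply_const b
  have h3 : (fun z => christoffel G z u v) =ᶠ[𝓝 y] fun z => christoffel G z v u := by
    filter_upwards [h.isOpen.mem_nhds hy] with z hz using h.christoffel_symm hz u v
  have := ((key u v).congr_of_eventuallyEq h3.symm).unique (key v u)
  exact congr($this w)

theorem curv_bianchi (h : IsMetricOn U G) {y : E} (hy : y ∈ U) (u v w : E) :
    curv G y u v w + curv G y v w u + curv G y w u v = 0 := by
  simp only [curv]
  rw [h.fderiv_christoffel_symm hy u v w, h.fderiv_christoffel_symm hy v w u,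
    h.fderiv_christoffel_symm hy w u v, h.christoffel_symm hy v w, h.christoffel_symm hy w u,
    h.christoffel_symm hy u v]
  abel

theorem curv_swap (u v w : E) (y : E) : curv G y u v w = - curv G y v u w := by
  simp only [curv]; abel

/-- The second derivative of z ↦ G_z(w,w) is symmetric, and by metric compatibility its
antisymmetrization in u, v is 2G(R(u,v)w, w). -/
theorem curv_skew_self (h : IsMetricOn U G) {y : E} (hy : y ∈ U) (u v w : E) :
    G y (curv G y u v w) w = 0 := by
  have hΓ := h.differentiableAt_christoffel hy
  have hG := h.differentiableAt hy
  have hsymm : IsSymmSndFDerivAt ℝ (fun z => G z w w) y := by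
    refine ContDiffAt.isSymmSndFDerivAt (n := ∞) ?_ (by simpa using two_le_smooth)
    exact ((h.smooth.contDiffAt (h.isOpen.mem_nhds hy)).clm_apply contDiffAt_const).clm_apply
      contDiffAt_const
  have hfirst : ∀ z ∈ U, ∀ a, fderiv ℝ (fun z => G z w w) z a
      = 2 * G z (christoffel G z a w) w := by
    intro z hz a
    rw [(((h.differentiableAt hz).hasFDerivAt.clm_apply_const w).clm_apply_const w).fderiv]
    simp [h.fderiv_apply hz, h.symm z hz w]
    ring
  have hsecond : ∀ a b, fderiv ℝ (fderiv ℝ (fun z => G z w w)) y b a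
      = 2 * (G y (christoffel G y b (christoffel G y a w)) w
        + G y (christoffel G y a w) (christoffel G y b w)
        + G y (fderiv ℝ (christoffel G) y b a w) w) := by
    intro a b
    have hd : DifferentiableAt ℝ (fderiv ℝ (fun z => G z w w)) y := by
      have hc : ContDiffAt ℝ ∞ (fun z => G z w w) y :=
        ((h.smooth.contDiffAt (h.isOpen.mem_nhds hy)).clm_apply contDiffAt_const).clm_apply
          contDiffAt_const
      exact (hc.fderiv_right (m := 1) (by norm_num; exact two_le_smooth)).differentiableAt
        (by simp)
    have h1 : HasFDerivAt (fun z => fderiv ℝ (fun z => G z w w) z a)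
        ((fderiv ℝ (fderiv ℝ (fun z => G z w w)) y).flip a) y :=
      hd.hasFDerivAt.clm_apply_const a
    have h2 : (fun z => fderiv ℝ (fun z => G z w w) z a)
        =ᶠ[𝓝 y] fun z => 2 * G z (christoffel G z a w) w := by
      filter_upwards [h.isOpen.mem_nhds hy] with z hz using hfirst z hz a
    have h3 := ((hG.hasFDerivAt.clm_apply ((hΓ.hasFDerivAt.clm_apply_const a).clm_apply_const
      w)).clm_apply_const w).const_mul (2 : ℝ)
    have h4 := (h1.congr_of_eventuallyEq h2.symm).unique h3
    have h5 := congr($h4 b)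
    simp only [ContinuousLinearMap.flip_apply] at h5
    rw [h5]
    simp [h.fderiv_apply hy]
    ring
  have := hsymm u v
  rw [hsecond, hsecond] at this
  simp only [curv, map_sub, map_add, _root_.sub_apply, _root_.add_apply]
  rw [h.symm y hy (christoffel G y u w)] at this
  linarith

theorem curv_skew (h : IsMetricOn U G) {y : E} (hy : y ∈ U) (u v w x : E) :
    G y (curv G y u v w) x = - G y (curv G y u v x) w := by
  have h1 := h.curv_skew_self hy u v (w + x)
  have h2 := h.curv_skew_self hy u v w
  have h3 := h.curv_skew_self hy u v x
  have h4 : curv G y u v (w + x) = curv G y u v w + curv G y u v x := by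
    simp only [curv, map_add]; abel
  rw [h4] at h1
  simp only [map_add, _root_.add_apply] at h1
  linarith

/-- The octahedron argument: in a combination of the four Bianchi identities on a, b, c, d the two
skew-symmetries cancel all terms but the two wanted. -/
theorem curv_pair (h : IsMetricOn U G) {y : E} (hy : y ∈ U) (a b c d : E) :
    G y (curv G y a b c) d = G y (curv G y c d a) b := by
  have B : ∀ u v w x, G y (curv G y u v w) x + G y (curv G y v w u) x
      + G y (curv G y w u v) x = 0 := fun u v w x => by
    have := congr(G y $(h.curv_bianchi hy u v w) x)
    simpa using this
  have S : ∀ u v w x, G y (curv G y u v w) x = - G y (curv G y v u w) x := fun u v w x => by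
    rw [curv_swap u v w y]; simp
  have K := h.curv_skew hy
  linarith [B a b c d, B b c d a, B c d a b, B d a b c, S a b c d, S b c a d, S c a b d,
    S b c d a, S c d b a, S d b c a, S c d a b, S d a c b, S a c d b, S d a b c, S a b d c,
    S b d a c, K a b c d, K b c a d, K c a b d, K b c d a, K c d b a, K d b c a, K c d a b,
    K d a c b, K a c d b, K d a b c, K a b d c, K b d a c]

/-- The Jacobi operator of a metric of constant curvature. -/
theorem curv_apply_of_const (h : IsMetricOn U G) {y : E} (hy : y ∈ U) {C : ℝ}
    (hC : ∀ u v, G y (curv G y u v v) u = C * (G y u u * G y v v - G y u v ^ 2)) (u v w : E) :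
    G y (curv G y u v v) w = C * (G y u w * G y v v - G y u v * G y v w) := by
  have h1 := hC (u + w) v
  have h2 := hC u v
  have h3 := hC w v
  have h4 : curv G y (u + w) v v = curv G y u v v + curv G y w v v := by
    simp only [curv, map_add, _root_.add_apply]; abel
  -- By pair symmetry the Jacobi operator R(·,v)v is self-adjoint, so polarizing the sectional
  -- curvature in u recovers it entirely.
  have h5 : G y (curv G y w v v) u = G y (curv G y u v v) w := by
    rw [h.curv_pair hy w v v u, curv_swap v u w y, h.curv_skew hy u v v w]
    simp
  rw [h4] at h1
  simp only [map_add, _root_.add_apply] at h1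
  rw [h5, h.symm y hy w u, h2, h3, h.symm y hy w v] at h1
  linarith

end IsMetricOn

end LocalMetric

end

noncomputable section

namespace LocalMetric

variable {E : Type*} [NormedAddCommGroup E] [NormedSpace ℝ E] [FiniteDimensional ℝ E]

/-! ### Partial derivatives in the plane -/

section Partial

variable {F : Type*} [NormedAddCommGroup F] [NormedSpace ℝ F] {Ω : Set (ℝ × ℝ)} {f : ℝ × ℝ → F}

/-- The partial derivative with respect to the first variable. -/
def partialFst (f : ℝ × ℝ → F) (p : ℝ × ℝ) : F := fderiv ℝ f p (1, 0)

/-- The partial derivative with respect to the second variable. -/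
def partialSnd (f : ℝ × ℝ → F) (p : ℝ × ℝ) : F := fderiv ℝ f p (0, 1)

theorem contDiffOn_partialFst (hΩ : IsOpen Ω) (hf : ContDiffOn ℝ ∞ f Ω) :
    ContDiffOn ℝ ∞ (partialFst f) Ω :=
  (hf.fderiv_of_isOpen hΩ (by simp)).clm_apply contDiffOn_const

theorem contDiffOn_partialSnd (hΩ : IsOpen Ω) (hf : ContDiffOn ℝ ∞ f Ω) :
    ContDiffOn ℝ ∞ (partialSnd f) Ω :=
  (hf.fderiv_of_isOpen hΩ (by simp)).clm_apply contDiffOn_const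

theorem differentiableAt_of_contDiffOn (hΩ : IsOpen Ω) (hf : ContDiffOn ℝ ∞ f Ω) {p : ℝ × ℝ}
    (hp : p ∈ Ω) : DifferentiableAt ℝ f p :=
  (hf.contDiffAt (hΩ.mem_nhds hp)).differentiableAt (by simp)

theorem hasDerivAt_partialFst (hΩ : IsOpen Ω) (hf : ContDiffOn ℝ ∞ f Ω) {t s : ℝ}
    (hp : (t, s) ∈ Ω) : HasDerivAt (fun t => f (t, s)) (partialFst f (t, s)) t :=
  (differentiableAt_of_contDiffOn hΩ hf hp).hasFDerivAt.comp_hasDerivAt t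
    ((hasDerivAt_id t).prodMk (hasDerivAt_const t s))

theorem hasDerivAt_partialSnd (hΩ : IsOpen Ω) (hf : ContDiffOn ℝ ∞ f Ω) {t s : ℝ}
    (hp : (t, s) ∈ Ω) : HasDerivAt (fun s => f (t, s)) (partialSnd f (t, s)) s :=
  (differentiableAt_of_contDiffOn hΩ hf hp).hasFDerivAt.comp_hasDerivAt s
    ((hasDerivAt_const s t).prodMk (hasDerivAt_id s))

theorem partialFst_partialSnd (hΩ : IsOpen Ω) (hf : ContDiffOn ℝ ∞ f Ω) {p : ℝ × ℝ} (hp : p ∈ Ω) :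
    partialFst (partialSnd f) p = partialSnd (partialFst f) p := by
  have hc := hf.contDiffAt (hΩ.mem_nhds hp)
  have hsymm : IsSymmSndFDerivAt ℝ f p := hc.isSymmSndFDerivAt (by simpa using two_le_smooth)
  have hd : DifferentiableAt ℝ (fderiv ℝ f) p :=
    (hc.fderiv_right (m := 1) (by norm_num; exact two_le_smooth)).differentiableAt (by simp)
  have key : ∀ a b : ℝ × ℝ, fderiv ℝ (fun q => fderiv ℝ f q a) p b
      = fderiv ℝ (fderiv ℝ f) p b a := fun a b => by
    have h : HasFDerivAt (fun q => fderiv ℝ f q a) ((fderiv ℝ (fderiv ℝ f) p).flip a) p := by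
      simpa using hd.hasFDerivAt.clm_apply (hasFDerivAt_const a p)
    rw [h.fderiv]
    rfl
  change fderiv ℝ (fun q => fderiv ℝ f q (0, 1)) p (1, 0)
    = fderiv ℝ (fun q => fderiv ℝ f q (1, 0)) p (0, 1)
  rw [key, key]
  exact hsymm _ _

end Partial

/-! ### Covariant derivatives along curves -/

/-- The covariant derivative of `V` along the curve `c`. -/
def covD (G : E → E →L[ℝ] E →L[ℝ] ℝ) (c V : ℝ → E) (s : ℝ) : E :=
  deriv V s + christoffel G (c s) (deriv c s) (V s)

theorem covD_congr {G : E → E →L[ℝ] E →L[ℝ] ℝ} {c c' V V' : ℝ → E} {s : ℝ}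
    (hc : c =ᶠ[𝓝 s] c') (hV : V =ᶠ[𝓝 s] V') : covD G c V s = covD G c' V' s := by
  rw [covD, covD, hV.deriv_eq, hc.deriv_eq, hV.eq_of_nhds, hc.eq_of_nhds]

namespace IsMetricOn

variable {U : Set E} {G : E → E →L[ℝ] E →L[ℝ] ℝ}

theorem hasDerivAt_apply (h : IsMetricOn U G) {c V W : ℝ → E} {s : ℝ} (hs : c s ∈ U)
    (hc : DifferentiableAt ℝ c s) (hV : DifferentiableAt ℝ V s) (hW : DifferentiableAt ℝ W s) :
    HasDerivAt (fun s => G (c s) (V s) (W s))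
      (G (c s) (covD G c V s) (W s) + G (c s) (V s) (covD G c W s)) s := by
  have h1 := (((h.differentiableAt hs).hasFDerivAt.comp_hasDerivAt s hc.hasDerivAt).clm_apply
    hV.hasDerivAt).clm_apply hW.hasDerivAt
  refine HasDerivAt.congr_deriv h1 ?_
  simp only [covD, map_add, _root_.add_apply, Function.comp_apply,
    h.fderiv_apply hs]
  ring

variable {Ω : Set (ℝ × ℝ)} {c : ℝ × ℝ → E}

/-- The acceleration of the curves `c (t, ·)`. -/
def accel (G : E → E →L[ℝ] E →L[ℝ] ℝ) (c : ℝ × ℝ → E) (p : ℝ × ℝ) : E :=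
  partialSnd (partialSnd c) p + christoffel G (c p) (partialSnd c p) (partialSnd c p)

theorem contDiffOn_accel (h : IsMetricOn U G) (hΩ : IsOpen Ω) (hc : ContDiffOn ℝ ∞ c Ω)
    (hcU : ∀ p ∈ Ω, c p ∈ U) : ContDiffOn ℝ ∞ (accel G c) Ω := by
  have h1 := contDiffOn_partialSnd hΩ hc
  exact (contDiffOn_partialSnd hΩ h1).add
    (((h.contDiffOn_christoffel.comp hc hcU).clm_apply h1).clm_apply h1)

theorem contDiffOn_energy (h : IsMetricOn U G) (hΩ : IsOpen Ω) (hc : ContDiffOn ℝ ∞ c Ω)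
    (hcU : ∀ p ∈ Ω, c p ∈ U) : ContDiffOn ℝ ∞ (fun p => G (c p) (accel G c p) (accel G c p)) Ω :=
  ((h.smooth.comp hc hcU).clm_apply (h.contDiffOn_accel hΩ hc hcU)).clm_apply
    (h.contDiffOn_accel hΩ hc hcU)

/-- Covariant derivatives in the two directions commute up to curvature. -/
theorem covD_accel (h : IsMetricOn U G) (hΩ : IsOpen Ω) (hc : ContDiffOn ℝ ∞ c Ω)
    (hcU : ∀ p ∈ Ω, c p ∈ U) {t s : ℝ} (hp : (t, s) ∈ Ω) :
    covD G (fun t => c (t, s)) (fun t => accel G c (t, s)) t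
      = covD G (fun s => c (t, s))
          (fun s => covD G (fun s => c (t, s)) (fun s => partialFst c (t, s)) s) s
        + curv G (c (t, s)) (partialFst c (t, s)) (partialSnd c (t, s)) (partialSnd c (t, s)) := by
  have hS := contDiffOn_partialSnd hΩ hc
  have hT := contDiffOn_partialFst hΩ hc
  have hSS := contDiffOn_partialSnd hΩ hS
  have hST := contDiffOn_partialSnd hΩ hT
  have hΓ := h.differentiableAt_christoffel (hcU _ hp)
  have e1 : deriv (fun t => c (t, s)) t = partialFst c (t, s) :=
    (hasDerivAt_partialFst hΩ hc hp).deriv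
  have e2 : deriv (fun s => c (t, s)) s = partialSnd c (t, s) :=
    (hasDerivAt_partialSnd hΩ hc hp).deriv
  -- Moving ∂_t past two ∂_s needs the symmetry of second derivatives on a neighbourhood, as that
  -- identity is differentiated once more.
  have e3 : partialFst (partialSnd (partialSnd c)) (t, s)
      = partialSnd (partialSnd (partialFst c)) (t, s) := by
    rw [partialFst_partialSnd hΩ hS hp]
    have : partialFst (partialSnd c) =ᶠ[𝓝 (t, s)] partialSnd (partialFst c) := by
      filter_upwards [hΩ.mem_nhds hp] with q hq using partialFst_partialSnd hΩ hc hq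
    rw [partialSnd, this.fderiv_eq]
    rfl
  have e4 := partialFst_partialSnd hΩ hc hp
  have dA : deriv (fun t => accel G c (t, s)) t
      = partialFst (partialSnd (partialSnd c)) (t, s)
        + (fderiv ℝ (christoffel G) (c (t, s)) (partialFst c (t, s)) (partialSnd c (t, s))
              (partialSnd c (t, s))
          + christoffel G (c (t, s)) (partialFst (partialSnd c) (t, s)) (partialSnd c (t, s))
          + christoffel G (c (t, s)) (partialSnd c (t, s)) (partialFst (partialSnd c) (t, s))) := by
    have g1 := hΓ.hasFDerivAt.comp_hasDerivAt t (hasDerivAt_partialFst hΩ hc hp)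
    have g2 := (hasDerivAt_partialFst hΩ hSS hp).add
      ((g1.clm_apply (hasDerivAt_partialFst hΩ hS hp)).clm_apply (hasDerivAt_partialFst hΩ hS hp))
    refine (HasDerivAt.deriv g2).trans ?_
    simp
  have ev : (fun s => covD G (fun s => c (t, s)) (fun s => partialFst c (t, s)) s) =ᶠ[𝓝 s]
      fun s => partialSnd (partialFst c) (t, s)
        + christoffel G (c (t, s)) (partialSnd c (t, s)) (partialFst c (t, s)) := by
    have hcont : ContinuousAt (fun s : ℝ => (t, s)) s := by fun_prop
    filter_upwards [hcont.preimage_mem_nhds (hΩ.mem_nhds hp)] with s' hs'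
    rw [covD, (hasDerivAt_partialSnd hΩ hc hs').deriv, (hasDerivAt_partialSnd hΩ hT hs').deriv]
  have dB : deriv (fun s => covD G (fun s => c (t, s)) (fun s => partialFst c (t, s)) s) s
      = partialSnd (partialSnd (partialFst c)) (t, s)
        + (fderiv ℝ (christoffel G) (c (t, s)) (partialSnd c (t, s)) (partialSnd c (t, s))
              (partialFst c (t, s))
          + christoffel G (c (t, s)) (partialSnd (partialSnd c) (t, s)) (partialFst c (t, s))
          + christoffel G (c (t, s)) (partialSnd c (t, s)) (partialSnd (partialFst c) (t, s))) := by
    have g1 := hΓ.hasFDerivAt.comp_hasDerivAt s (hasDerivAt_partialSnd hΩ hc hp)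
    have g2 := (hasDerivAt_partialSnd hΩ hST hp).add
      ((g1.clm_apply (hasDerivAt_partialSnd hΩ hS hp)).clm_apply (hasDerivAt_partialSnd hΩ hT hp))
    refine ev.deriv_eq.trans ((HasDerivAt.deriv g2).trans ?_)
    simp
  rw [covD, covD, dA, dB, ev.eq_of_nhds, e1, e2, e3, e4]
  -- The third derivatives of c agree on both sides. Up to the symmetry of Γ, the remaining
  -- derivatives of Γ and products ΓΓ are those of the curvature.
  simp only [accel, curv, map_add]
  rw [h.fderiv_christoffel_symm (hcU _ hp) (partialSnd c (t, s)) (partialSnd c (t, s))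
      (partialFst c (t, s)),
    h.christoffel_symm (hcU _ hp) (partialSnd (partialFst c) (t, s)) (partialSnd c (t, s)),
    h.christoffel_symm (hcU _ hp) (partialSnd (partialSnd c) (t, s)) (partialFst c (t, s)),
    h.christoffel_symm (hcU _ hp) (partialSnd c (t, s)) (partialFst c (t, s))]
  abel

/-- The first variation of the pointwise bienergy. -/
theorem hasDerivAt_energy (h : IsMetricOn U G) (hΩ : IsOpen Ω) (hc : ContDiffOn ℝ ∞ c Ω)
    (hcU : ∀ p ∈ Ω, c p ∈ U) {t s : ℝ} (hp : (t, s) ∈ Ω) :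
    HasDerivAt (fun t => G (c (t, s)) (accel G c (t, s)) (accel G c (t, s)))
      (2 * G (c (t, s)) (covD G (fun s => c (t, s))
          (fun s => covD G (fun s => c (t, s)) (fun s => partialFst c (t, s)) s) s
        + curv G (c (t, s)) (partialFst c (t, s)) (partialSnd c (t, s)) (partialSnd c (t, s)))
        (accel G c (t, s))) t := by
  have hA := (hasDerivAt_partialFst hΩ (h.contDiffOn_accel hΩ hc hcU) hp).differentiableAt
  convert h.hasDerivAt_apply (c := fun t => c (t, s)) (hcU _ hp)
    (hasDerivAt_partialFst hΩ hc hp).differentiableAt hA hA using 1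
  rw [← h.covD_accel hΩ hc hcU hp, h.symm _ (hcU _ hp) (accel G c (t, s))]
  ring

end IsMetricOn

end LocalMetric

end

/-! ### Passage from the manifold to charts. -/

noncomputable section

namespace LocalMetric

variable {E : Type*} [NormedAddCommGroup E] [NormedSpace ℝ E] [FiniteDimensional ℝ E]
  {M : Type*} [TopologicalSpace M] [ChartedSpace E M] [IsManifold 𝓘(ℝ, E) ∞ M]

/-! ### The coordinate frames of the tangent bundle -/

/-- The coordinates of a tangent vector at `x` in the chart around `x₀`. -/
def coord (x₀ x : M) (v : TangentSpace 𝓘(ℝ, E) x) : E :=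
  (trivializationAt E (TangentSpace 𝓘(ℝ, E) : M → Type _) x₀
    (⟨x, v⟩ : TotalSpace E (TangentSpace 𝓘(ℝ, E) : M → Type _))).2

/-- The vector field with constant coordinates `u` in the chart around `x₀`. -/
def frame (x₀ : M) (u : E) (x : M) : TangentSpace 𝓘(ℝ, E) x :=
  (trivializationAt E (TangentSpace 𝓘(ℝ, E) : M → Type _) x₀).symm x u

variable {x₀ x : M}

theorem coord_eq (hx : x ∈ (chartAt E x₀).source) (v : TangentSpace 𝓘(ℝ, E) x) :
    coord x₀ x v = (trivializationAt E (TangentSpace 𝓘(ℝ, E) : M → Type _)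
      x₀).continuousLinearMapAt ℝ x v := by
  rw [Trivialization.continuousLinearMapAt_apply, Trivialization.coe_linearMapAt_of_mem _ hx]
  rfl

theorem coord_add (hx : x ∈ (chartAt E x₀).source) (v w : TangentSpace 𝓘(ℝ, E) x) :
    coord x₀ x (v + w) = coord x₀ x v + coord x₀ x w := by
  simp only [coord_eq hx, map_add]

theorem coord_smul (hx : x ∈ (chartAt E x₀).source) (a : ℝ) (v : TangentSpace 𝓘(ℝ, E) x) :
    coord x₀ x (a • v) = a • coord x₀ x v := by
  simp only [coord_eq hx, map_smul]

theorem coord_sum (hx : x ∈ (chartAt E x₀).source) {ι : Type*} (t : Finset ι)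
    (v : ι → TangentSpace 𝓘(ℝ, E) x) :
    coord x₀ x (∑ i ∈ t, v i) = ∑ i ∈ t, coord x₀ x (v i) := by
  simp only [coord_eq hx, map_sum]

theorem coord_frame (hx : x ∈ (chartAt E x₀).source) (u : E) :
    coord x₀ x (frame x₀ u x) = u := by
  rw [coord_eq hx, frame, ← Trivialization.symmL_apply (R := ℝ) _ hx]
  exact Trivialization.continuousLinearMapAt_symmL (R := ℝ)
    (trivializationAt E (TangentSpace 𝓘(ℝ, E) : M → Type _) x₀) hx u

theorem frame_coord (hx : x ∈ (chartAt E x₀).source) (v : TangentSpace 𝓘(ℝ, E) x) :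
    frame x₀ (coord x₀ x v) x = v := by
  rw [coord_eq hx, frame, ← Trivialization.symmL_apply (R := ℝ) _ hx]
  exact Trivialization.symmL_continuousLinearMapAt (R := ℝ)
    (trivializationAt E (TangentSpace 𝓘(ℝ, E) : M → Type _) x₀) hx v

theorem coord_injective (hx : x ∈ (chartAt E x₀).source) {v w : TangentSpace 𝓘(ℝ, E) x}
    (h : coord x₀ x v = coord x₀ x w) : v = w := by
  rw [← frame_coord hx v, h, frame_coord hx]

theorem contMDiffAt_section_iff_coord (hx : x ∈ (chartAt E x₀).source) {n : ℕ∞ω} (hn : n ≤ ∞)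
    {Y : Π x : M, TangentSpace 𝓘(ℝ, E) x} :
    CMDiffAt n (T% Y) x ↔ CMDiffAt n (fun y => coord x₀ y (Y y)) x := by
  have : ContMDiffVectorBundle n E (TangentSpace 𝓘(ℝ, E) : M → Type _) 𝓘(ℝ, E) :=
    ContMDiffVectorBundle.of_le hn
  exact Trivialization.contMDiffAt_section_iff (IB := 𝓘(ℝ, E))
    (trivializationAt E (TangentSpace 𝓘(ℝ, E) : M → Type _) x₀) hx

theorem contMDiffAt_frame (hx : x ∈ (chartAt E x₀).source) (u : E) :
    CMDiffAt ∞ (T% (frame x₀ u)) x := by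
  rw [contMDiffAt_section_iff_coord hx le_rfl]
  refine (contMDiffAt_const (c := u)).congr_of_eventuallyEq ?_
  filter_upwards [(chartAt E x₀).open_source.mem_nhds hx] with y hy using coord_frame hy u

theorem mdifferentiableAt_frame (hx : x ∈ (chartAt E x₀).source) (u : E) :
    MDiffAt (T% (frame x₀ u)) x :=
  (contMDiffAt_frame hx u).mdifferentiableAt (by simp)

theorem chart_symm_mem {y : E} (hy : y ∈ (extChartAt 𝓘(ℝ, E) x₀).target) :
    (extChartAt 𝓘(ℝ, E) x₀).symm y ∈ (chartAt E x₀).source := by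
  simpa using (extChartAt 𝓘(ℝ, E) x₀).map_target hy

theorem chart_mem (hx : x ∈ (chartAt E x₀).source) :
    extChartAt 𝓘(ℝ, E) x₀ x ∈ (extChartAt 𝓘(ℝ, E) x₀).target :=
  (extChartAt 𝓘(ℝ, E) x₀).map_source (by simpa using hx)

theorem chart_left_inv (hx : x ∈ (chartAt E x₀).source) :
    (extChartAt 𝓘(ℝ, E) x₀).symm (extChartAt 𝓘(ℝ, E) x₀ x) = x :=
  (extChartAt 𝓘(ℝ, E) x₀).left_inv (by simpa using hx)

theorem contMDiffAt_chart (hx : x ∈ (chartAt E x₀).source) :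
    ContMDiffAt 𝓘(ℝ, E) 𝓘(ℝ, E) ∞ (extChartAt 𝓘(ℝ, E) x₀) x :=
  contMDiffAt_extChartAt' hx

theorem contMDiffAt_chart_symm {y : E} (hy : y ∈ (extChartAt 𝓘(ℝ, E) x₀).target) :
    ContMDiffAt 𝓘(ℝ, E) 𝓘(ℝ, E) ∞ (extChartAt 𝓘(ℝ, E) x₀).symm y :=
  (contMDiffOn_extChartAt_symm x₀).contMDiffAt ((isOpen_extChartAt_target x₀).mem_nhds hy)

/-- The coordinates of the velocity of a curve. -/
theorem coord_velocity {γ : ℝ → M} {s : ℝ} (hγ : MDifferentiableAt 𝓘(ℝ, ℝ) 𝓘(ℝ, E) γ s)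
    (hx : γ s ∈ (chartAt E x₀).source) :
    HasDerivAt (fun s => extChartAt 𝓘(ℝ, E) x₀ (γ s)) (coord x₀ (γ s) (velocity 𝓘(ℝ, E) γ s)) s := by
  have h1 : HasMFDerivAt 𝓘(ℝ, ℝ) 𝓘(ℝ, E) ((extChartAt 𝓘(ℝ, E) x₀) ∘ γ) s _ :=
    HasMFDerivAt.comp s ((contMDiffAt_chart hx).mdifferentiableAt (by simp)).hasMFDerivAt
    hγ.hasMFDerivAt
  have h2 : HasFDerivAt (fun s => extChartAt 𝓘(ℝ, E) x₀ (γ s))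
    ((mfderiv% (extChartAt 𝓘(ℝ, E) x₀) (γ s) ∘L mfderiv 𝓘(ℝ, ℝ) 𝓘(ℝ, E) γ s : ℝ →L[ℝ] E)) s :=
    h1.hasFDerivAt
  refine h2.hasDerivAt.congr_deriv ?_
  rw [coord_eq hx, TangentBundle.continuousLinearMapAt_trivializationAt hx]
  rfl

/-- A constant vector field on a vector space. -/
def constField (w : E) (y : E) : TangentSpace 𝓘(ℝ, E) y := w

/-- The Lie bracket of two coordinate fields vanishes. -/
theorem mlieBracket_frame (hx : x ∈ (chartAt E x₀).source) (u v : E) :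
    mlieBracket 𝓘(ℝ, E) (frame x₀ u) (frame x₀ v) x = 0 := by
  have : IsManifold 𝓘(ℝ, E) (minSmoothness ℝ 2) M := by
    rw [minSmoothness_of_isRCLikeNormedField]; infer_instance
  -- A coordinate field is the pullback of a constant field under the chart, and pullback commutes
  -- with the Lie bracket.
  have hm : ∀ w : E, ∀ y ∈ (chartAt E x₀).source, frame x₀ w y =
      mpullback 𝓘(ℝ, E) 𝓘(ℝ, E) (extChartAt 𝓘(ℝ, E) x₀)
        (constField w) y := fun w y hy => by
    have hinv : (mfderiv% (extChartAt 𝓘(ℝ, E) x₀) y).IsInvertible :=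
      isInvertible_mfderiv_extChartAt (by simpa using hy)
    rw [mpullback_apply]
    obtain ⟨e, he⟩ := hinv
    rw [← he, ContinuousLinearMap.inverse_equiv]
    apply coord_injective hy
    rw [coord_frame hy, coord_eq hy, TangentBundle.continuousLinearMapAt_trivializationAt hy, ← he]
    exact (e.apply_symm_apply w).symm
  have key : ∀ w : E, frame x₀ w =ᶠ[𝓝 x]
      mpullback 𝓘(ℝ, E) 𝓘(ℝ, E) (extChartAt 𝓘(ℝ, E) x₀)
        (constField w) := fun w =>
    Filter.eventuallyEq_of_mem ((chartAt E x₀).open_source.mem_nhds hx) (hm w)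
  rw [(key u).mlieBracket_vectorField_eq (key v)]
  have hc : ∀ w : E, MDifferentiableAt 𝓘(ℝ, E) (𝓘(ℝ, E).prod 𝓘(ℝ, E)) 
    (T% (constField w)) (extChartAt 𝓘(ℝ, E) x₀ x) := fun w => by
      refine (contMDiffAt_vectorSpace_iff_contDiffAt (n := 1) (V := constField w)).2 ?_ |>.mdifferentiableAt (by simp)
      exact contDiffAt_const
  rw [← mpullback_mlieBracket (n := ∞) (hc u) (hc v) (contMDiffAt_chart hx) (by simpa using two_le_smooth), mpullback_apply]
  have : mlieBracket 𝓘(ℝ, E) (constField u)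
      (constField v) (extChartAt 𝓘(ℝ, E) x₀ x) = 0 := by
    rw [← mlieBracketWithin_univ, mlieBracketWithin_eq_lieBracketWithin]
    change lieBracketWithin ℝ (fun _ : E => u) (fun _ : E => v) univ _ = (0 : E)
    simp [lieBracketWithin]
  rw [this, map_zero]

end LocalMetric

end

noncomputable section

namespace LocalMetric

variable {E : Type*} [NormedAddCommGroup E] [NormedSpace ℝ E] [FiniteDimensional ℝ E]
  {M : Type*} [TopologicalSpace M] [ChartedSpace E M] [IsManifold 𝓘(ℝ, E) ∞ M]
  [RiemannianBundle (fun x : M => TangentSpace 𝓘(ℝ, E) x)]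
  [IsContMDiffRiemannianBundle 𝓘(ℝ, E) ∞ E (fun x : M => TangentSpace 𝓘(ℝ, E) x)]

/-! ### The metric and the Levi-Civita connection in coordinates -/

/-- The metric in the chart around `x₀`. -/
def metricIn (x₀ : M) (y : E) : E →L[ℝ] E →L[ℝ] ℝ :=
  let e := trivializationAt E (TangentSpace 𝓘(ℝ, E) : M → Type _) x₀
  let x := (extChartAt 𝓘(ℝ, E) x₀).symm y
  (innerSL ℝ (E := TangentSpace 𝓘(ℝ, E) x)).bilinearComp (e.symmL ℝ x) (e.symmL ℝ x)

variable {x₀ x : M}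

theorem metricIn_apply {y : E} (hy : y ∈ (extChartAt 𝓘(ℝ, E) x₀).target) (u v : E) :
    metricIn x₀ y u v = inner ℝ (frame x₀ u ((extChartAt 𝓘(ℝ, E) x₀).symm y))
      (frame x₀ v ((extChartAt 𝓘(ℝ, E) x₀).symm y)) := by
  have hx := chart_symm_mem hy
  rw [frame, frame, ← Trivialization.symmL_apply (R := ℝ) _ hx,
    ← Trivialization.symmL_apply (R := ℝ) _ hx]
  rfl

theorem metricIn_chart (hx : x ∈ (chartAt E x₀).source) (u v : E) :
    metricIn x₀ (extChartAt 𝓘(ℝ, E) x₀ x) u v = inner ℝ (frame x₀ u x) (frame x₀ v x) := by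
  rw [metricIn_apply (chart_mem hx), chart_left_inv hx]

theorem inner_eq_metricIn (hx : x ∈ (chartAt E x₀).source) (v w : TangentSpace 𝓘(ℝ, E) x) :
    inner ℝ v w = metricIn x₀ (extChartAt 𝓘(ℝ, E) x₀ x) (coord x₀ x v) (coord x₀ x w) := by
  rw [metricIn_chart hx, frame_coord hx, frame_coord hx]

theorem isMetricOn_metricIn (x₀ : M) :
    IsMetricOn (extChartAt 𝓘(ℝ, E) x₀).target (metricIn x₀) where
  isOpen := isOpen_extChartAt_target x₀
  smooth := by
    refine contDiffOn_clm_apply.2 fun u => contDiffOn_clm_apply.2 fun v y hy => ?_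
    have h1 : ContMDiffAt 𝓘(ℝ, E) 𝓘(ℝ, ℝ) ∞
        (fun z => (inner ℝ (frame x₀ u ((extChartAt 𝓘(ℝ, E) x₀).symm z))
          (frame x₀ v ((extChartAt 𝓘(ℝ, E) x₀).symm z)) : ℝ)) y :=
      ContMDiffAt.inner_bundle (IB := 𝓘(ℝ, E)) (F := E)
        (E := fun x : M => TangentSpace 𝓘(ℝ, E) x) (b := (extChartAt 𝓘(ℝ, E) x₀).symm)
        ((contMDiffAt_frame (chart_symm_mem hy) u).comp y (contMDiffAt_chart_symm hy))
        ((contMDiffAt_frame (chart_symm_mem hy) v).comp y (contMDiffAt_chart_symm hy))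
    refine (h1.contDiffAt.congr_of_eventuallyEq ?_).contDiffWithinAt
    filter_upwards [(isOpen_extChartAt_target x₀).mem_nhds hy] with z hz
      using metricIn_apply hz u v
  symm y hy u v := by
    rw [metricIn_apply hy, metricIn_apply hy, real_inner_comm]
  pos y hy u hu := by
    rw [metricIn_apply hy]
    refine real_inner_self_pos.2 fun h0 => hu ?_
    have := coord_frame (chart_symm_mem hy) u
    rw [h0, coord_eq (chart_symm_mem hy), map_zero] at this
    exact this.symm

theorem mvfderiv_comp_chart (hx : x ∈ (chartAt E x₀).source) {h : E → ℝ}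
    (hh : DifferentiableAt ℝ h (extChartAt 𝓘(ℝ, E) x₀ x)) (v : TangentSpace 𝓘(ℝ, E) x) :
    d% (fun y => h (extChartAt 𝓘(ℝ, E) x₀ y)) x v
      = fderiv ℝ h (extChartAt 𝓘(ℝ, E) x₀ x) (coord x₀ x v) := by
  have h1 := mvfderiv_comp_apply (I := 𝓘(ℝ, E)) (I' := 𝓘(ℝ, E)) x hh.mdifferentiableAt
    ((contMDiffAt_chart hx).mdifferentiableAt (by simp)) v
  rw [coord_eq hx, TangentBundle.continuousLinearMapAt_trivializationAt hx]
  refine h1.trans ?_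
  rw [mvfderiv, mfderiv_eq_fderiv]
  rfl

theorem mvfderiv_inner_frame (hx : x ∈ (chartAt E x₀).source) (u v : E)
    (w : TangentSpace 𝓘(ℝ, E) x) :
    d% (fun y => (inner ℝ (frame x₀ u y) (frame x₀ v y) : ℝ)) x w
      = fderiv ℝ (metricIn x₀) (extChartAt 𝓘(ℝ, E) x₀ x) (coord x₀ x w) u v := by
  have hG := (isMetricOn_metricIn (E := E) x₀).differentiableAt (chart_mem hx)
  have hd := (hG.hasFDerivAt.clm_apply_const u).clm_apply_const v
  have h1 : (fun y => (inner ℝ (frame x₀ u y) (frame x₀ v y) : ℝ)) =ᶠ[𝓝 x]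
      fun y => metricIn x₀ (extChartAt 𝓘(ℝ, E) x₀ y) u v := by
    filter_upwards [(chartAt E x₀).open_source.mem_nhds hx] with y hy
      using (metricIn_chart hy u v).symm
  have h2 := mvfderiv_comp_chart hx (h := fun y => metricIn x₀ y u v) hd.differentiableAt w
  rw [hd.fderiv] at h2
  rw [mvfderiv, h1.mfderiv_eq]
  exact h2

/-- For coordinate fields the brackets in the Koszul formula vanish, and what remains is the formula
characterizing the Christoffel symbols. -/
theorem coord_leviCivita_frame (hx : x ∈ (chartAt E x₀).source) (u v : E) :
    coord x₀ x (leviCivita 𝓘(ℝ, E) M (frame x₀ v) x (frame x₀ u x))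
      = christoffel (metricIn x₀) (extChartAt 𝓘(ℝ, E) x₀ x) u v := by
  have hM := isMetricOn_metricIn (E := E) x₀
  refine hM.ext_of_apply (chart_mem hx) fun w => ?_
  rw [hM.apply_christoffel (chart_mem hx), metricIn_chart hx, frame_coord hx,
    inner_leviCivita (mdifferentiableAt_frame hx v) (mdifferentiableAt_frame hx u)
      (mdifferentiableAt_frame hx w), koszul, mlieBracket_frame hx, mlieBracket_frame hx,
    mlieBracket_frame hx, mvfderiv_inner_frame hx, mvfderiv_inner_frame hx,
    mvfderiv_inner_frame hx, coord_frame hx, coord_frame hx, coord_frame hx,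
    hM.fderiv_symm (chart_mem hx) w u v]
  simp only [inner_zero_left]
  rw [hM.fderiv_symm (chart_mem hx) w v u]
  ring

/-- Taken with the coordinate fields of a basis as σ, this computes ∇ of any field.
Differentiability is carried through the induction because additivity of ∇ requires it. -/
theorem leviCivita_sum_smul {ι : Type*} (t : Finset ι) {f : ι → M → ℝ}
    {σ : ι → Π x : M, TangentSpace 𝓘(ℝ, E) x} (hf : ∀ i, MDiffAt (f i) x)
    (hσ : ∀ i, MDiffAt (T% (σ i)) x) (v : TangentSpace 𝓘(ℝ, E) x) :
    MDiffAt (T% (∑ i ∈ t, f i • σ i)) x ∧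
    leviCivita 𝓘(ℝ, E) M (∑ i ∈ t, f i • σ i) x v
      = ∑ i ∈ t, (f i x • leviCivita 𝓘(ℝ, E) M (σ i) x v + d% (f i) x v • σ i x) := by
  classical
  have hcov := (leviCivita 𝓘(ℝ, E) M).isCovariantDerivativeOnUniv
  induction t using Finset.induction_on with
  | empty =>
    refine ⟨?_, ?_⟩
    · simp only [Finset.sum_empty]
      exact mdifferentiableAt_zeroSection ..
    · simp
  | insert a t ha ih =>
    simp only [Finset.sum_insert ha]
    have h1 : MDiffAt (T% (f a • σ a)) x := (hf a).smul_section (hσ a)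
    refine ⟨mdifferentiableAt_add_section h1 ih.1, ?_⟩
    rw [hcov.add h1 ih.1, hcov.leibniz (hσ a) (hf a), ← ih.2]
    simp

/-- The Levi-Civita connection in coordinates. -/
theorem coord_leviCivita (hx : x ∈ (chartAt E x₀).source) {Y : Π x : M, TangentSpace 𝓘(ℝ, E) x}
    {η : E → E} (hη : DifferentiableAt ℝ η (extChartAt 𝓘(ℝ, E) x₀ x))
    (hY : ∀ᶠ z in 𝓝 x, coord x₀ z (Y z) = η (extChartAt 𝓘(ℝ, E) x₀ z))
    (v : TangentSpace 𝓘(ℝ, E) x) :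
    coord x₀ x (leviCivita 𝓘(ℝ, E) M Y x v)
      = fderiv ℝ η (extChartAt 𝓘(ℝ, E) x₀ x) (coord x₀ x v)
        + christoffel (metricIn x₀) (extChartAt 𝓘(ℝ, E) x₀ x) (coord x₀ x v)
          (η (extChartAt 𝓘(ℝ, E) x₀ x)) := by
  -- Near x the field is a combination of the coordinate fields of a basis, with the components of η
  -- as coefficients, and ∇ depends only on this germ.
  set b := Module.finBasis ℝ E
  set bc : Fin (Module.finrank ℝ E) → E →L[ℝ] ℝ := fun i => (b.coord i).toContinuousLinearMap
  set f : Fin (Module.finrank ℝ E) → M → ℝ := fun i z => bc i (η (extChartAt 𝓘(ℝ, E) x₀ z))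
  have hbc : ∀ i, DifferentiableAt ℝ (fun z => bc i (η z)) (extChartAt 𝓘(ℝ, E) x₀ x) := fun i =>
    (bc i).differentiableAt.comp _ hη
  have hdf : ∀ i, d% (f i) x v = bc i (fderiv ℝ η (extChartAt 𝓘(ℝ, E) x₀ x) (coord x₀ x v)) := by
    intro i
    rw [mvfderiv_comp_chart hx (hbc i) v, HasFDerivAt.fderiv
      (f := fun z => bc i (η z)) ((bc i).hasFDerivAt.comp _ hη.hasFDerivAt)]
    rfl
  have hf : ∀ i, MDiffAt (f i) x := fun i =>
    (hbc i).mdifferentiableAt.comp x ((contMDiffAt_chart hx).mdifferentiableAt (by simp))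
  have hsum : ∀ u : E, ∑ i, bc i u • b i = u := fun u => b.sum_repr u
  obtain ⟨hd, hl⟩ := leviCivita_sum_smul Finset.univ (σ := fun i => frame x₀ (b i)) hf
    (fun i => mdifferentiableAt_frame hx (b i)) v
  have hsm : ∀ z ∈ (chartAt E x₀).source,
      coord x₀ z ((∑ i, f i • (fun i => frame x₀ (b i)) i : Π x : M, TangentSpace 𝓘(ℝ, E) x) z)
        = η (extChartAt 𝓘(ℝ, E) x₀ z) := by
    intro z hz
    rw [Finset.sum_apply, coord_sum hz]
    simp only [Pi.smul_apply', coord_smul hz, coord_frame hz]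
    exact hsum _
  have hYe : ∀ᶠ z in 𝓝 x, Y z
      = (∑ i, f i • (fun i => frame x₀ (b i)) i : Π x : M, TangentSpace 𝓘(ℝ, E) x) z := by
    filter_upwards [hY, (chartAt E x₀).open_source.mem_nhds hx] with z hz hzs
    exact coord_injective hzs (hz.trans (hsm z hzs).symm)
  have hYd : MDiffAt (T% Y) x := by
    refine hd.congr_of_eventuallyEq ?_
    filter_upwards [hYe] with z hz
    rw [hz]
  rw [((leviCivita 𝓘(ℝ, E) M).isCovariantDerivativeOnUniv).congr_of_eventuallyEq hYd hd
    Filter.univ_mem hYe, hl, coord_sum hx]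
  simp only [coord_add hx, coord_smul hx, coord_frame hx]
  rw [Finset.sum_add_distrib, add_comm]
  congr 1
  · simp only [hdf]
    exact hsum _
  · conv_rhs => rw [← hsum (η _), map_sum]
    refine Finset.sum_congr rfl fun i _ => ?_
    rw [map_smul, ← frame_coord hx v, coord_leviCivita_frame hx, coord_frame hx]

end LocalMetric

end

noncomputable section

namespace LocalMetric

variable {E : Type*} [NormedAddCommGroup E] [NormedSpace ℝ E] [FiniteDimensional ℝ E]
  {M : Type*} [TopologicalSpace M] [ChartedSpace E M] [IsManifold 𝓘(ℝ, E) ∞ M]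
  {x₀ x₁ x : M}

/-! ### Change of coordinates -/

/-- The differential of the change of charts from `x₀` to `x₁`, at the coordinates `y`. -/
def transition (x₀ x₁ : M) (y : E) : E →L[ℝ] E :=
  let x := (extChartAt 𝓘(ℝ, E) x₀).symm y
  (trivializationAt E (TangentSpace 𝓘(ℝ, E) : M → Type _) x₁).continuousLinearMapAt ℝ x ∘L
    (trivializationAt E (TangentSpace 𝓘(ℝ, E) : M → Type _) x₀).symmL ℝ x

theorem transition_chart (h₀ : x ∈ (chartAt E x₀).source) (h₁ : x ∈ (chartAt E x₁).source) (u : E) :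
    transition x₀ x₁ (extChartAt 𝓘(ℝ, E) x₀ x) u = coord x₁ x (frame x₀ u x) := by
  rw [transition, chart_left_inv h₀, coord_eq h₁, frame, ← Trivialization.symmL_apply (R := ℝ) _ h₀]
  rfl

theorem coord_eq_transition (h₀ : x ∈ (chartAt E x₀).source) (h₁ : x ∈ (chartAt E x₁).source)
    (v : TangentSpace 𝓘(ℝ, E) x) :
    coord x₁ x v = transition x₀ x₁ (extChartAt 𝓘(ℝ, E) x₀ x) (coord x₀ x v) := by
  rw [transition_chart h₀ h₁, frame_coord h₀]

/-- The frame is a smooth section, so its components in any chart are smooth. Three centres are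
allowed because the frame belongs now to the chart of the base coordinates, now to another one. -/
theorem contDiffAt_coord_frame {x₂ : M} (h₀ : x ∈ (chartAt E x₀).source)
    (h₁ : x ∈ (chartAt E x₁).source) (h₂ : x ∈ (chartAt E x₂).source) (u : E) :
    ContDiffAt ℝ ∞ (fun y => coord x₁ ((extChartAt 𝓘(ℝ, E) x₀).symm y)
      (frame x₂ u ((extChartAt 𝓘(ℝ, E) x₀).symm y))) (extChartAt 𝓘(ℝ, E) x₀ x) := by
  have h3 : CMDiffAt ∞ (fun z => coord x₁ z (frame x₂ u z)) x :=
    (contMDiffAt_section_iff_coord h₁ le_rfl).1 (contMDiffAt_frame h₂ u)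
  have h4 := ContMDiffAt.comp (extChartAt 𝓘(ℝ, E) x₀ x)
    (g := fun z => coord x₁ z (frame x₂ u z)) (f := (extChartAt 𝓘(ℝ, E) x₀).symm)
    (by rw [chart_left_inv h₀]; exact h3) (contMDiffAt_chart_symm (chart_mem h₀))
  exact h4.contDiffAt

theorem contDiffAt_transition (h₀ : x ∈ (chartAt E x₀).source) (h₁ : x ∈ (chartAt E x₁).source) :
    ContDiffAt ℝ ∞ (transition x₀ x₁) (extChartAt 𝓘(ℝ, E) x₀ x) := by
  set U := (extChartAt 𝓘(ℝ, E) x₀).target ∩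
    (extChartAt 𝓘(ℝ, E) x₀).symm ⁻¹' (chartAt E x₁).source
  have hU : IsOpen U := (continuousOn_extChartAt_symm x₀).isOpen_inter_preimage
    (isOpen_extChartAt_target x₀) (chartAt E x₁).open_source
  have hxU : extChartAt 𝓘(ℝ, E) x₀ x ∈ U :=
    ⟨chart_mem h₀, by rw [mem_preimage, chart_left_inv h₀]; exact h₁⟩
  refine ContDiffOn.contDiffAt (s := U) ?_ (hU.mem_nhds hxU)
  refine contDiffOn_clm_apply.2 fun u y hy => ?_
  have hz := chart_symm_mem hy.1
  have h2 := contDiffAt_coord_frame hz hy.2 hz u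
  rw [(extChartAt 𝓘(ℝ, E) x₀).right_inv hy.1] at h2
  refine (h2.congr_of_eventuallyEq ?_).contDiffWithinAt
  filter_upwards [hU.mem_nhds hy] with w hw
  rw [← transition_chart (chart_symm_mem hw.1) hw.2, (extChartAt 𝓘(ℝ, E) x₀).right_inv hw.1]

/-! ### Curves in coordinates -/

variable {γ : ℝ → M} {V : Π s : ℝ, TangentSpace 𝓘(ℝ, E) (γ s)} {s : ℝ}

theorem eventually_mem_source (hγ : ContinuousAt γ s) (hx : γ s ∈ (chartAt E x₀).source) :
    ∀ᶠ s' in 𝓝 s, γ s' ∈ (chartAt E x₀).source :=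
  hγ.preimage_mem_nhds ((chartAt E x₀).open_source.mem_nhds hx)

theorem coord_along_eventuallyEq (hγ : ContinuousAt γ s) (h₀ : γ s ∈ (chartAt E x₀).source)
    (h₁ : γ s ∈ (chartAt E x₁).source) :
    (fun s => coord x₁ (γ s) (V s)) =ᶠ[𝓝 s]
      fun s => transition x₀ x₁ (extChartAt 𝓘(ℝ, E) x₀ (γ s)) (coord x₀ (γ s) (V s)) := by
  filter_upwards [eventually_mem_source hγ h₀, eventually_mem_source hγ h₁] with s' h h'
    using coord_eq_transition h h' _

theorem contDiffAt_chart_comp (hγ : ContMDiffAt 𝓘(ℝ, ℝ) 𝓘(ℝ, E) ∞ γ s)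
    (hx : γ s ∈ (chartAt E x₀).source) :
    ContDiffAt ℝ ∞ (fun s => extChartAt 𝓘(ℝ, E) x₀ (γ s)) s :=
  ((contMDiffAt_chart hx).comp s hγ).contDiffAt

theorem contDiffAt_transition_comp (hγ : ContMDiffAt 𝓘(ℝ, ℝ) 𝓘(ℝ, E) ∞ γ s)
    (h₀ : γ s ∈ (chartAt E x₀).source) (h₁ : γ s ∈ (chartAt E x₁).source) :
    ContDiffAt ℝ ∞ (fun s => transition x₀ x₁ (extChartAt 𝓘(ℝ, E) x₀ (γ s))) s :=
  ContDiffAt.comp (g := transition x₀ x₁) (f := fun s => extChartAt 𝓘(ℝ, E) x₀ (γ s)) s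
    (contDiffAt_transition h₀ h₁) (contDiffAt_chart_comp hγ h₀)

theorem contDiffAt_coord_change (hγ : ContMDiffAt 𝓘(ℝ, ℝ) 𝓘(ℝ, E) ∞ γ s)
    (h₀ : γ s ∈ (chartAt E x₀).source) (h₁ : γ s ∈ (chartAt E x₁).source)
    (hV : ContDiffAt ℝ ∞ (fun s => coord x₀ (γ s) (V s)) s) :
    ContDiffAt ℝ ∞ (fun s => coord x₁ (γ s) (V s)) s := by
  refine ContDiffAt.congr_of_eventuallyEq ?_ (coord_along_eventuallyEq hγ.continuousAt h₀ h₁)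
  exact (contDiffAt_transition_comp hγ h₀ h₁).clm_apply hV

variable [RiemannianBundle (fun x : M => TangentSpace 𝓘(ℝ, E) x)]
  [IsContMDiffRiemannianBundle 𝓘(ℝ, E) ∞ E (fun x : M => TangentSpace 𝓘(ℝ, E) x)]

/-- The covariant derivative of a coordinate field of one chart, in another chart. -/
theorem coord_leviCivita_frame_velocity (hγ : ContMDiffAt 𝓘(ℝ, ℝ) 𝓘(ℝ, E) ∞ γ s)
    (h₀ : γ s ∈ (chartAt E x₀).source) (h₁ : γ s ∈ (chartAt E x₁).source) (u : E) :
    coord x₀ (γ s) (leviCivita 𝓘(ℝ, E) M (frame x₁ u) (γ s) (velocity 𝓘(ℝ, E) γ s))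
      = deriv (fun t => coord x₀ (γ t) (frame x₁ u (γ t))) s
        + christoffel (metricIn x₀) (extChartAt 𝓘(ℝ, E) x₀ (γ s))
          (deriv (fun s => extChartAt 𝓘(ℝ, E) x₀ (γ s)) s) (coord x₀ (γ s) (frame x₁ u (γ s))) := by
  have hγd : MDifferentiableAt 𝓘(ℝ, ℝ) 𝓘(ℝ, E) γ s := hγ.mdifferentiableAt (by simp)
  have hη := (contDiffAt_coord_frame h₀ h₀ h₁ u).differentiableAt (by simp)
  have h6 := (hη.hasFDerivAt.comp_hasDerivAt s (coord_velocity hγd h₀)).deriv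
  have h7 := coord_leviCivita h₀ (Y := frame x₁ u) hη (by
      filter_upwards [(chartAt E x₀).open_source.mem_nhds h₀] with z hz
      rw [chart_left_inv hz]) (velocity 𝓘(ℝ, E) γ s)
  have h8 : deriv (fun t => coord x₀ (γ t) (frame x₁ u (γ t))) s = _ :=
    (Filter.EventuallyEq.deriv_eq (by
      filter_upwards [eventually_mem_source hγ.continuousAt h₀] with t ht
      simp only [Function.comp_apply]
      rw [chart_left_inv ht])).trans h6
  rw [h7, h8, (coord_velocity hγd h₀).deriv, chart_left_inv h₀]

/-- The covariant derivative along a curve may be computed in any chart. -/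
theorem coord_covDerivAlong (hγ : ContMDiffAt 𝓘(ℝ, ℝ) 𝓘(ℝ, E) ∞ γ s)
    (hx : γ s ∈ (chartAt E x₀).source)
    (hV : ContDiffAt ℝ ∞ (fun s => coord x₀ (γ s) (V s)) s) :
    coord x₀ (γ s) (covDerivAlong 𝓘(ℝ, E) γ V s)
      = covD (metricIn x₀) (fun s => extChartAt 𝓘(ℝ, E) x₀ (γ s))
          (fun s => coord x₀ (γ s) (V s)) s := by
  -- `covDerivAlong` uses the chart centred at γ s; a separate name for that centre keeps the chart
  -- fixed while the point on the curve moves.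
  obtain ⟨x₁, hx₁⟩ : ∃ x₁, x₁ = γ s := ⟨_, rfl⟩
  have h₁ : γ s ∈ (chartAt E x₁).source := by rw [hx₁]; exact mem_chart_source E (γ s)
  have hcov : covDerivAlong 𝓘(ℝ, E) γ V s
      = frame x₁ (deriv (fun s => coord x₁ (γ s) (V s)) s) (γ s)
        + leviCivita 𝓘(ℝ, E) M (frame x₁ (coord x₁ (γ s) (V s))) (γ s)
          (velocity 𝓘(ℝ, E) γ s) := by
    rw [hx₁]; rfl
  have hda := ((contDiffAt_coord_change hγ hx h₁ hV).differentiableAt (by simp)).hasDerivAt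
  have hL := ((contDiffAt_transition_comp hγ h₁ hx).differentiableAt (by simp)).hasDerivAt
  -- With L the transition map along γ and a the coordinates in the chart x₁, the coordinates in x₀
  -- are La, with derivative L'a + La'. The term La' is the first summand of `covDerivAlong`; the
  -- term L'a comes from the covariant derivative of the x₁-frame.
  have h4 := (coord_along_eventuallyEq (V := V) hγ.continuousAt h₁ hx).deriv_eq.trans
    (hL.clm_apply hda).deriv
  have h5 := (coord_along_eventuallyEq (V := fun t => frame x₁ (coord x₁ (γ s) (V s)) (γ t))
    hγ.continuousAt h₁ hx).deriv_eq
  have h6 : (fun t => transition x₁ x₀ (extChartAt 𝓘(ℝ, E) x₁ (γ t)) (coord x₁ (γ t)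
      (frame x₁ (coord x₁ (γ s) (V s)) (γ t)))) =ᶠ[𝓝 s]
      fun t => transition x₁ x₀ (extChartAt 𝓘(ℝ, E) x₁ (γ t)) (coord x₁ (γ s) (V s)) := by
    filter_upwards [eventually_mem_source hγ.continuousAt h₁] with t ht
    rw [coord_frame ht]
  have h7 := (h5.trans h6.deriv_eq).trans
    (hL.clm_apply (hasDerivAt_const s (coord x₁ (γ s) (V s)))).deriv
  rw [hcov, coord_add hx, coord_leviCivita_frame_velocity hγ hx h₁, h7, covD, h4,
    ← transition_chart h₁ hx, frame_coord h₁]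
  simp only [map_zero, add_zero]
  abel

theorem coord_riemannCurvature (hx : x ∈ (chartAt E x₀).source) (u v w : E) :
    coord x₀ x (riemannCurvature (frame x₀ u) (frame x₀ v) (frame x₀ w) x)
      = curv (metricIn x₀) (extChartAt 𝓘(ℝ, E) x₀ x) u v w := by
  have hΓ := (isMetricOn_metricIn (E := E) x₀).differentiableAt_christoffel (chart_mem hx)
  have key : ∀ a b : E, coord x₀ x (leviCivita 𝓘(ℝ, E) M
      (fun y => leviCivita 𝓘(ℝ, E) M (frame x₀ w) y (frame x₀ b y)) x (frame x₀ a x))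
      = fderiv ℝ (christoffel (metricIn x₀)) (extChartAt 𝓘(ℝ, E) x₀ x) a b w
        + christoffel (metricIn x₀) (extChartAt 𝓘(ℝ, E) x₀ x) a
          (christoffel (metricIn x₀) (extChartAt 𝓘(ℝ, E) x₀ x) b w) := by
    intro a b
    have hd := (hΓ.hasFDerivAt.clm_apply_const b).clm_apply_const w
    rw [coord_leviCivita hx hd.differentiableAt (by
      filter_upwards [(chartAt E x₀).open_source.mem_nhds hx] with z hz
        using coord_leviCivita_frame hz b w), hd.fderiv, coord_frame hx]
    rfl
  have hsub : ∀ p q : TangentSpace 𝓘(ℝ, E) x, coord x₀ x (p - q) = coord x₀ x p - coord x₀ x q := by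
    intro p q
    simp only [coord_eq hx, map_sub]
  rw [riemannCurvature, mlieBracket_frame hx, map_zero, sub_zero, hsub, key, key, curv]
  abel

/-- The Jacobi operator of a manifold of constant sectional curvature, in coordinates. -/
theorem metricIn_curv {C : ℝ} (hC : HasConstantSectionalCurvature 𝓘(ℝ, E) M C)
    (hx : x ∈ (chartAt E x₀).source) (u v w : E) :
    metricIn x₀ (extChartAt 𝓘(ℝ, E) x₀ x) (curv (metricIn x₀) (extChartAt 𝓘(ℝ, E) x₀ x) u v v) w
      = C * (metricIn x₀ (extChartAt 𝓘(ℝ, E) x₀ x) u w * metricIn x₀ (extChartAt 𝓘(ℝ, E) x₀ x) v v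
        - metricIn x₀ (extChartAt 𝓘(ℝ, E) x₀ x) u v
          * metricIn x₀ (extChartAt 𝓘(ℝ, E) x₀ x) v w) := by
  refine (isMetricOn_metricIn (E := E) x₀).curv_apply_of_const (chart_mem hx) (fun u v => ?_) u v w
  have h := hC x (frame x₀ u) (frame x₀ v) (contMDiffAt_frame hx u) (contMDiffAt_frame hx v)
  simp only [inner_eq_metricIn hx, coord_riemannCurvature hx, coord_frame hx] at h
  exact h

end LocalMetric

end

noncomputable section

open LocalMetric

variable {E : Type*} [NormedAddCommGroup E] [NormedSpace ℝ E] [FiniteDimensional ℝ E]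
  {M : Type*} [TopologicalSpace M] [ChartedSpace E M] [IsManifold 𝓘(ℝ, E) ∞ M]
  {J : Set ℝ} {γ : ℝ → M} {V W : Π s : ℝ, TangentSpace 𝓘(ℝ, E) (γ s)} {s : ℝ} {x₀ : M}

theorem contDiffAt_deriv {F : Type*} [NormedAddCommGroup F] [NormedSpace ℝ F] {f : ℝ → F} {s : ℝ}
    (hf : ContDiffAt ℝ ∞ f s) : ContDiffAt ℝ ∞ (deriv f) s := by
  have : ContDiffAt ℝ ∞ (fun t => fderiv ℝ f t 1) s :=
    (hf.fderiv_right (by simp)).clm_apply contDiffAt_const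
  simpa using this

/-! ### Smooth vector fields along a curve -/

/-- `V` is a smooth vector field along `γ` on `J`. -/
def SmoothAlong (J : Set ℝ) (γ : ℝ → M) (V : Π s : ℝ, TangentSpace 𝓘(ℝ, E) (γ s)) : Prop :=
  ∀ s ∈ J, ContDiffAt ℝ ∞ (fun t => coord (γ s) (γ t) (V t)) s

variable (E) in
/-- `γ` is a smooth curve on the open set `J`. -/
structure SmoothCurve (J : Set ℝ) (γ : ℝ → M) : Prop where
  isOpen : IsOpen J
  contMDiffAt : ∀ s ∈ J, ContMDiffAt 𝓘(ℝ, ℝ) 𝓘(ℝ, E) ∞ γ s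

theorem SmoothCurve.eventually_source (hγ : SmoothCurve E J γ) (hs : s ∈ J)
    (hx : γ s ∈ (chartAt E x₀).source) :
    ∀ᶠ t in 𝓝 s, t ∈ J ∧ γ t ∈ (chartAt E x₀).source := by
  filter_upwards [hγ.isOpen.mem_nhds hs,
    eventually_mem_source (hγ.contMDiffAt s hs).continuousAt hx] with t h h' using ⟨h, h'⟩

theorem SmoothCurve.mdifferentiableAt (hγ : SmoothCurve E J γ) (hs : s ∈ J) :
    MDifferentiableAt 𝓘(ℝ, ℝ) 𝓘(ℝ, E) γ s :=
  (hγ.contMDiffAt s hs).mdifferentiableAt (by simp)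

namespace SmoothAlong

theorem coord (hV : SmoothAlong J γ V) (hγ : SmoothCurve E J γ) (hs : s ∈ J)
    (hx : γ s ∈ (chartAt E x₀).source) :
    ContDiffAt ℝ ∞ (fun t => coord x₀ (γ t) (V t)) s :=
  contDiffAt_coord_change (hγ.contMDiffAt s hs) (mem_chart_source E (γ s)) hx (hV s hs)

theorem of_coord (hγ : SmoothCurve E J γ)
    (h : ∀ s ∈ J, ∃ x₀, γ s ∈ (chartAt E x₀).source ∧
      ContDiffAt ℝ ∞ (fun t => LocalMetric.coord x₀ (γ t) (V t)) s) : SmoothAlong J γ V := by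
  intro s hs
  obtain ⟨x₀, hx, h⟩ := h s hs
  exact contDiffAt_coord_change (hγ.contMDiffAt s hs) hx (mem_chart_source E (γ s)) h

theorem differentiableAt (hV : SmoothAlong J γ V) (hγ : SmoothCurve E J γ) (hs : s ∈ J)
    (hx : γ s ∈ (chartAt E x₀).source) :
    DifferentiableAt ℝ (fun t => LocalMetric.coord x₀ (γ t) (V t)) s :=
  (hV.coord hγ hs hx).differentiableAt (by simp)

theorem congr (hV : SmoothAlong J γ V) (hγ : SmoothCurve E J γ) (h : ∀ s ∈ J, W s = V s) :
    SmoothAlong J γ W := fun s hs => (hV s hs).congr_of_eventuallyEq (by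
  filter_upwards [hγ.isOpen.mem_nhds hs] with t ht
  rw [h t ht])

theorem add (hV : SmoothAlong J γ V) (hW : SmoothAlong J γ W) (hγ : SmoothCurve E J γ) :
    SmoothAlong J γ (fun s => V s + W s) := by
  intro s hs
  refine ((hV s hs).add (hW s hs)).congr_of_eventuallyEq ?_
  filter_upwards [hγ.eventually_source hs (mem_chart_source E (γ s))] with t ht
  exact coord_add ht.2 _ _

theorem smul (hV : SmoothAlong J γ V) (hγ : SmoothCurve E J γ) {f : ℝ → ℝ}
    (hf : ContDiffOn ℝ ∞ f J) : SmoothAlong J γ (fun s => f s • V s) := by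
  intro s hs
  refine ((hf.contDiffAt (hγ.isOpen.mem_nhds hs)).smul (hV s hs)).congr_of_eventuallyEq ?_
  filter_upwards [hγ.eventually_source hs (mem_chart_source E (γ s))] with t ht
  exact coord_smul ht.2 _ _

end SmoothAlong

theorem coord_velocity_eventuallyEq (hγ : SmoothCurve E J γ) (hs : s ∈ J)
    (hx : γ s ∈ (chartAt E x₀).source) :
    (fun t => coord x₀ (γ t) (velocity 𝓘(ℝ, E) γ t)) =ᶠ[𝓝 s]
      deriv (fun t => extChartAt 𝓘(ℝ, E) x₀ (γ t)) := by
  filter_upwards [hγ.eventually_source hs hx] with t ht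
  exact (coord_velocity (hγ.mdifferentiableAt ht.1) ht.2).deriv.symm

theorem smoothAlong_velocity (hγ : SmoothCurve E J γ) :
    SmoothAlong J γ (velocity 𝓘(ℝ, E) γ) := fun s hs =>
  (contDiffAt_deriv (contDiffAt_chart_comp (hγ.contMDiffAt s hs)
    (mem_chart_source E (γ s)))).congr_of_eventuallyEq
      (coord_velocity_eventuallyEq hγ hs (mem_chart_source E (γ s)))

variable [RiemannianBundle (fun x : M => TangentSpace 𝓘(ℝ, E) x)]
  [IsContMDiffRiemannianBundle 𝓘(ℝ, E) ∞ E (fun x : M => TangentSpace 𝓘(ℝ, E) x)]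

/-! ### The covariant derivative of smooth fields along a curve -/

namespace SmoothAlong

theorem coord_covDeriv (hV : SmoothAlong J γ V) (hγ : SmoothCurve E J γ) (hs : s ∈ J)
    (hx : γ s ∈ (chartAt E x₀).source) :
    LocalMetric.coord x₀ (γ s) (covDerivAlong 𝓘(ℝ, E) γ V s)
      = covD (metricIn x₀) (fun t => extChartAt 𝓘(ℝ, E) x₀ (γ t))
          (fun t => LocalMetric.coord x₀ (γ t) (V t)) s :=
  coord_covDerivAlong (hγ.contMDiffAt s hs) hx (hV.coord hγ hs hx)

theorem coord_covDeriv_eventuallyEq (hV : SmoothAlong J γ V) (hγ : SmoothCurve E J γ)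
    (hs : s ∈ J) (hx : γ s ∈ (chartAt E x₀).source) :
    (fun t => LocalMetric.coord x₀ (γ t) (covDerivAlong 𝓘(ℝ, E) γ V t)) =ᶠ[𝓝 s]
      covD (metricIn x₀) (fun t => extChartAt 𝓘(ℝ, E) x₀ (γ t))
          (fun t => LocalMetric.coord x₀ (γ t) (V t)) := by
  filter_upwards [hγ.eventually_source hs hx] with t ht using hV.coord_covDeriv hγ ht.1 ht.2

/-- Each parameter value brings its own chart into `covDerivAlong`. Near s all of them can be
replaced by the chart at γ s, where `covD` is visibly smooth. -/
theorem covDeriv (hV : SmoothAlong J γ V) (hγ : SmoothCurve E J γ) :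
    SmoothAlong J γ (covDerivAlong 𝓘(ℝ, E) γ V) := by
  intro s hs
  have hx := mem_chart_source E (γ s)
  have hc := contDiffAt_chart_comp (hγ.contMDiffAt s hs) hx
  have hM := isMetricOn_metricIn (E := E) (γ s)
  have hΓ : ContDiffAt ℝ ∞ (fun t => christoffel (metricIn (γ s))
      (extChartAt 𝓘(ℝ, E) (γ s) (γ t))) s :=
    ContDiffAt.comp (g := christoffel (metricIn (γ s)))
      (f := fun t => extChartAt 𝓘(ℝ, E) (γ s) (γ t)) s
      (hM.contDiffOn_christoffel.contDiffAt (hM.isOpen.mem_nhds (chart_mem hx))) hc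
  refine ContDiffAt.congr_of_eventuallyEq ?_ (hV.coord_covDeriv_eventuallyEq hγ hs hx)
  exact (contDiffAt_deriv (hV s hs)).add
    ((hΓ.clm_apply (contDiffAt_deriv hc)).clm_apply (hV s hs))

theorem covDeriv_congr (hV : SmoothAlong J γ V) (hγ : SmoothCurve E J γ)
    (h : ∀ s ∈ J, W s = V s) (hs : s ∈ J) :
    covDerivAlong 𝓘(ℝ, E) γ W s = covDerivAlong 𝓘(ℝ, E) γ V s := by
  have hx := mem_chart_source E (γ s)
  refine coord_injective hx ?_
  rw [hV.coord_covDeriv hγ hs hx, (hV.congr hγ h).coord_covDeriv hγ hs hx]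
  refine covD_congr Filter.EventuallyEq.rfl ?_
  filter_upwards [hγ.isOpen.mem_nhds hs] with t ht
  rw [h t ht]

theorem covDeriv_add (hV : SmoothAlong J γ V) (hW : SmoothAlong J γ W) (hγ : SmoothCurve E J γ)
    (hs : s ∈ J) : covDerivAlong 𝓘(ℝ, E) γ (fun t => V t + W t) s
      = covDerivAlong 𝓘(ℝ, E) γ V s + covDerivAlong 𝓘(ℝ, E) γ W s := by
  have hx := mem_chart_source E (γ s)
  have he : (fun t => LocalMetric.coord (γ s) (γ t) (V t + W t)) =ᶠ[𝓝 s]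
      fun t => LocalMetric.coord (γ s) (γ t) (V t) + LocalMetric.coord (γ s) (γ t) (W t) := by
    filter_upwards [hγ.eventually_source hs hx] with t ht using coord_add ht.2 _ _
  refine coord_injective hx ?_
  rw [coord_add hx, (hV.add hW hγ).coord_covDeriv hγ hs hx, hV.coord_covDeriv hγ hs hx,
    hW.coord_covDeriv hγ hs hx, covD_congr Filter.EventuallyEq.rfl he, covD, covD, covD,
    deriv_fun_add (hV.differentiableAt hγ hs hx)
      (hW.differentiableAt hγ hs hx), map_add]
  abel

theorem covDeriv_smul (hV : SmoothAlong J γ V) (hγ : SmoothCurve E J γ) {f : ℝ → ℝ}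
    (hf : ContDiffOn ℝ ∞ f J) (hs : s ∈ J) : covDerivAlong 𝓘(ℝ, E) γ (fun t => f t • V t) s
      = deriv f s • V s + f s • covDerivAlong 𝓘(ℝ, E) γ V s := by
  have hx := mem_chart_source E (γ s)
  have he : (fun t => LocalMetric.coord (γ s) (γ t) (f t • V t)) =ᶠ[𝓝 s]
      fun t => f t • LocalMetric.coord (γ s) (γ t) (V t) := by
    filter_upwards [hγ.eventually_source hs hx] with t ht using coord_smul ht.2 _ _
  have hfd : DifferentiableAt ℝ f s :=
    (hf.contDiffAt (hγ.isOpen.mem_nhds hs)).differentiableAt (by simp)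
  refine coord_injective hx ?_
  rw [coord_add hx, coord_smul hx, coord_smul hx, (hV.smul hγ hf).coord_covDeriv hγ hs hx,
    hV.coord_covDeriv hγ hs hx, covD_congr Filter.EventuallyEq.rfl he, covD, covD,
    deriv_fun_smul hfd (hV.differentiableAt hγ hs hx), map_smul, smul_add]
  abel

theorem contDiffOn_inner (hV : SmoothAlong J γ V) (hW : SmoothAlong J γ W)
    (hγ : SmoothCurve E J γ) : ContDiffOn ℝ ∞ (fun s => (inner ℝ (V s) (W s) : ℝ)) J := by
  intro s hs
  have hx := mem_chart_source E (γ s)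
  have hc := contDiffAt_chart_comp (hγ.contMDiffAt s hs) hx
  have hM := isMetricOn_metricIn (E := E) (γ s)
  have hG : ContDiffAt ℝ ∞ (fun t => metricIn (γ s) (extChartAt 𝓘(ℝ, E) (γ s) (γ t))) s :=
    ContDiffAt.comp (g := metricIn (γ s))
      (f := fun t => extChartAt 𝓘(ℝ, E) (γ s) (γ t)) s
      (hM.smooth.contDiffAt (hM.isOpen.mem_nhds (chart_mem hx))) hc
  refine (((hG.clm_apply (hV s hs)).clm_apply (hW s hs)).congr_of_eventuallyEq
    ?_).contDiffWithinAt
  filter_upwards [hγ.eventually_source hs hx] with t ht using inner_eq_metricIn ht.2 _ _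

theorem hasDerivAt_inner (hV : SmoothAlong J γ V) (hW : SmoothAlong J γ W)
    (hγ : SmoothCurve E J γ) (hs : s ∈ J) :
    HasDerivAt (fun t => (inner ℝ (V t) (W t) : ℝ))
      (inner ℝ (covDerivAlong 𝓘(ℝ, E) γ V s) (W s) + inner ℝ (V s) (covDerivAlong 𝓘(ℝ, E) γ W s))
      s := by
  have hx := mem_chart_source E (γ s)
  have hM := isMetricOn_metricIn (E := E) (γ s)
  have hc := (contDiffAt_chart_comp (hγ.contMDiffAt s hs) hx).differentiableAt (by simp)
  rw [inner_eq_metricIn hx, inner_eq_metricIn hx, hV.coord_covDeriv hγ hs hx,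
    hW.coord_covDeriv hγ hs hx]
  refine (hM.hasDerivAt_apply (chart_mem hx) hc (hV.differentiableAt hγ hs hx)
    (hW.differentiableAt hγ hs hx)).congr_of_eventuallyEq ?_
  filter_upwards [hγ.eventually_source hs hx] with t ht using inner_eq_metricIn ht.2 _ _

end SmoothAlong

theorem smoothAlong_tension (hγ : SmoothCurve E J γ) : SmoothAlong J γ (tension 𝓘(ℝ, E) γ) :=
  (smoothAlong_velocity hγ).covDeriv hγ

end

/-! ### First variation of the bienergy and its Euler-Lagrange equation. -/

noncomputable section

open LocalMetric

variable {E : Type*} [NormedAddCommGroup E] [NormedSpace ℝ E] [FiniteDimensional ℝ E]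
  {M : Type*} [TopologicalSpace M] [ChartedSpace E M] [IsManifold 𝓘(ℝ, E) ∞ M]
  {J : Set ℝ} {γ : ℝ → M} {c d ε : ℝ} {F : ℝ → ℝ → M} {s t : ℝ} {x₀ : M}

/-! ### The first variation of the bienergy density -/

variable (E) in
/-- The variation field `∂F/∂t` at `t = 0`. -/
def variationField (γ : ℝ → M) (F : ℝ → ℝ → M) (s : ℝ) : TangentSpace 𝓘(ℝ, E) (γ s) :=
  mfderiv 𝓘(ℝ, ℝ) 𝓘(ℝ, E) (fun t => F t s) 0 (1 : ℝ)

/-- The derivative of t ↦ F t s at 0 lies over F 0 s, while `variationField` is typed over γ s; the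
two points are equal only propositionally. -/
theorem coord_cast (x₀ : M) {x y : M} (h : x = y) (v : E) :
    coord x₀ x (v : TangentSpace 𝓘(ℝ, E) x) = coord x₀ y (v : TangentSpace 𝓘(ℝ, E) y) := by
  rw [h]

variable (E) in
/-- The part of the domain of the variation which is mapped to the chart around `x₀`. -/
def chartDomain (J : Set ℝ) (ε : ℝ) (F : ℝ → ℝ → M) (x₀ : M) : Set (ℝ × ℝ) :=
  (Ioo (-ε) ε ×ˢ J) ∩ (fun p : ℝ × ℝ => F p.1 p.2) ⁻¹' (chartAt E x₀).source

variable (E) in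
/-- The variation in the chart around `x₀`. -/
def chartVariation (F : ℝ → ℝ → M) (x₀ : M) (p : ℝ × ℝ) : E :=
  extChartAt 𝓘(ℝ, E) x₀ (F p.1 p.2)

namespace IsVariation

theorem contMDiffAt (hF : IsVariation 𝓘(ℝ, E) γ J c d ε F) (hJ : IsOpen J) {p : ℝ × ℝ}
    (hp : p ∈ Ioo (-ε) ε ×ˢ J) :
    ContMDiffAt 𝓘(ℝ, ℝ × ℝ) 𝓘(ℝ, E) ∞ (fun p : ℝ × ℝ => F p.1 p.2) p :=
  hF.smooth.contMDiffAt ((isOpen_Ioo.prod hJ).mem_nhds hp)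

theorem isOpen_chartDomain (hF : IsVariation 𝓘(ℝ, E) γ J c d ε F) (hJ : IsOpen J) (x₀ : M) :
    IsOpen (chartDomain E J ε F x₀) :=
  hF.smooth.continuousOn.isOpen_inter_preimage (isOpen_Ioo.prod hJ) (chartAt E x₀).open_source

theorem contDiffOn_chartVariation (hF : IsVariation 𝓘(ℝ, E) γ J c d ε F) (hJ : IsOpen J)
    (x₀ : M) : ContDiffOn ℝ ∞ (chartVariation E F x₀) (chartDomain E J ε F x₀) := fun p hp =>
  (ContMDiffAt.comp p (g := extChartAt 𝓘(ℝ, E) x₀) (f := fun p : ℝ × ℝ => F p.1 p.2)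
    (contMDiffAt_chart hp.2) (hF.contMDiffAt hJ hp.1)).contDiffAt.contDiffWithinAt

theorem chartVariation_mem {p : ℝ × ℝ} (hp : p ∈ chartDomain E J ε F x₀) :
    chartVariation E F x₀ p ∈ (extChartAt 𝓘(ℝ, E) x₀).target := chart_mem hp.2

theorem smoothCurve (hF : IsVariation 𝓘(ℝ, E) γ J c d ε F) (hJ : IsOpen J)
    (ht : t ∈ Ioo (-ε) ε) : SmoothCurve E J (F t) where
  isOpen := hJ
  contMDiffAt s hs := ContMDiffAt.comp s (g := fun p : ℝ × ℝ => F p.1 p.2) (f := fun s => (t, s))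
    (hF.contMDiffAt hJ ⟨ht, hs⟩) (contDiffAt_const.prodMk contDiffAt_id).contMDiffAt

theorem zero_mem_chartDomain (hF : IsVariation 𝓘(ℝ, E) γ J c d ε F) (hε : 0 < ε) (hs : s ∈ J)
    (hx : γ s ∈ (chartAt E x₀).source) : ((0 : ℝ), s) ∈ chartDomain E J ε F x₀ :=
  ⟨⟨⟨by simpa using hε, hε⟩, hs⟩, by
    change F 0 s ∈ (chartAt E x₀).source
    rw [hF.zero s hs]; exact hx⟩

theorem coord_variationField (hF : IsVariation 𝓘(ℝ, E) γ J c d ε F) (hJ : IsOpen J) (hε : 0 < ε)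
    (hs : s ∈ J) (hx : γ s ∈ (chartAt E x₀).source) :
    coord x₀ (γ s) (variationField E γ F s) = partialFst (chartVariation E F x₀) (0, s) := by
  have hp := hF.zero_mem_chartDomain hε hs hx
  have h1 := hasDerivAt_partialFst (hF.isOpen_chartDomain hJ x₀)
    (hF.contDiffOn_chartVariation hJ x₀) hp
  have hd : MDifferentiableAt 𝓘(ℝ, ℝ) 𝓘(ℝ, E) (fun t => F t s) 0 :=
    (ContMDiffAt.comp (0 : ℝ) (g := fun p : ℝ × ℝ => F p.1 p.2) (f := fun t : ℝ => (t, s))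
      (hF.contMDiffAt hJ hp.1) (contDiffAt_id.prodMk contDiffAt_const).contMDiffAt).mdifferentiableAt
      (by simp)
  have h2 := coord_velocity hd hp.2
  rw [h1.unique h2]
  exact coord_cast x₀ (hF.zero s hs).symm _

theorem smoothAlong_variationField (hF : IsVariation 𝓘(ℝ, E) γ J c d ε F)
    (hγ : SmoothCurve E J γ) (hε : 0 < ε) : SmoothAlong J γ (variationField E γ F) := by
  intro s hs
  have hx := mem_chart_source E (γ s)
  have hp := hF.zero_mem_chartDomain hε hs hx
  have hΩ := hF.isOpen_chartDomain hγ.isOpen (γ s)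
  have h1 : ContDiffAt ℝ ∞ (fun t => partialFst (chartVariation E F (γ s)) (0, t)) s :=
    ContDiffAt.comp (g := partialFst (chartVariation E F (γ s))) (f := fun t : ℝ => ((0 : ℝ), t)) s
      ((contDiffOn_partialFst hΩ (hF.contDiffOn_chartVariation hγ.isOpen (γ s))).contDiffAt
        (hΩ.mem_nhds hp)) (contDiffAt_const.prodMk contDiffAt_id)
  refine h1.congr_of_eventuallyEq ?_
  filter_upwards [hγ.eventually_source hs hx] with t ht
    using hF.coord_variationField hγ.isOpen hε ht.1 ht.2

end IsVariation

variable [RiemannianBundle (fun x : M => TangentSpace 𝓘(ℝ, E) x)]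
  [IsContMDiffRiemannianBundle 𝓘(ℝ, E) ∞ E (fun x : M => TangentSpace 𝓘(ℝ, E) x)]

theorem inner_velocity_tension (hγ : SmoothCurve E J γ)
    (hunit : ∀ s ∈ J, ‖velocity 𝓘(ℝ, E) γ s‖ = 1) (hs : s ∈ J) :
    inner ℝ (velocity 𝓘(ℝ, E) γ s) (tension 𝓘(ℝ, E) γ s) = 0 := by
  have hT := smoothAlong_velocity hγ
  have h1 := hT.hasDerivAt_inner hT hγ hs
  have h2 : HasDerivAt (fun t => (inner ℝ (velocity 𝓘(ℝ, E) γ t) (velocity 𝓘(ℝ, E) γ t) : ℝ)) 0 s :=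
    (hasDerivAt_const s (1 : ℝ)).congr_of_eventuallyEq (by
      filter_upwards [hγ.isOpen.mem_nhds hs] with t ht
      rw [real_inner_self_eq_norm_sq, hunit t ht, one_pow])
  have h3 := h1.unique h2
  rw [real_inner_comm] at h3
  change inner ℝ _ (covDerivAlong 𝓘(ℝ, E) γ (velocity 𝓘(ℝ, E) γ) s) = 0
  linarith

namespace IsVariation

theorem eventually_chartDomain (hF : IsVariation 𝓘(ℝ, E) γ J c d ε F) (hJ : IsOpen J)
    (hp : (t, s) ∈ chartDomain E J ε F x₀) : ∀ᶠ s' in 𝓝 s, (t, s') ∈ chartDomain E J ε F x₀ :=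
  (Continuous.prodMk_right t).continuousAt.preimage_mem_nhds
    ((hF.isOpen_chartDomain hJ x₀).mem_nhds hp)

/-- The tension field of a curve in the family, in coordinates. -/
theorem coord_tension (hF : IsVariation 𝓘(ℝ, E) γ J c d ε F) {β : ℝ → M}
    (hβ : SmoothCurve E J β) (hp : (t, s) ∈ chartDomain E J ε F x₀) (h : ∀ s ∈ J, F t s = β s) :
    coord x₀ (β s) (tension 𝓘(ℝ, E) β s)
      = IsMetricOn.accel (metricIn x₀) (chartVariation E F x₀) (t, s) := by
  have hs : s ∈ J := hp.1.2
  have hx : β s ∈ (chartAt E x₀).source := by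
    rw [← h s hs]; exact hp.2
  have hΩ := hF.isOpen_chartDomain hβ.isOpen x₀
  have hc := hF.contDiffOn_chartVariation hβ.isOpen x₀
  have e1 : (fun s => extChartAt 𝓘(ℝ, E) x₀ (β s)) =ᶠ[𝓝 s]
      fun s => chartVariation E F x₀ (t, s) := by
    filter_upwards [hβ.isOpen.mem_nhds hs] with s' hs'
    rw [chartVariation, h s' hs']
  have e2 : (fun s => coord x₀ (β s) (velocity 𝓘(ℝ, E) β s)) =ᶠ[𝓝 s]
      fun s => partialSnd (chartVariation E F x₀) (t, s) := by
    filter_upwards [coord_velocity_eventuallyEq hβ hs hx, e1.eventuallyEq_nhds,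
      hF.eventually_chartDomain hβ.isOpen hp] with s' h1 h2 h3
    rw [h1, h2.deriv_eq, (hasDerivAt_partialSnd hΩ hc h3).deriv]
  rw [tension, (smoothAlong_velocity hβ).coord_covDeriv hβ hs hx, covD_congr e1 e2, covD,
    (hasDerivAt_partialSnd hΩ hc hp).deriv,
    (hasDerivAt_partialSnd hΩ (contDiffOn_partialSnd hΩ hc) hp).deriv]
  rfl

theorem norm_tension_sq (hF : IsVariation 𝓘(ℝ, E) γ J c d ε F) (hJ : IsOpen J)
    (hp : (t, s) ∈ chartDomain E J ε F x₀) :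
    ‖tension 𝓘(ℝ, E) (F t) s‖ ^ 2
      = metricIn x₀ (chartVariation E F x₀ (t, s))
          (IsMetricOn.accel (metricIn x₀) (chartVariation E F x₀) (t, s))
          (IsMetricOn.accel (metricIn x₀) (chartVariation E F x₀) (t, s)) := by
  rw [← real_inner_self_eq_norm_sq, inner_eq_metricIn (x₀ := x₀) hp.2,
    hF.coord_tension (hF.smoothCurve hJ hp.1.1) hp (fun _ _ => rfl)]
  rfl

/-- Joint smoothness in (t, s) is what allows differentiation under the integral. -/
theorem contDiffOn_density (hF : IsVariation 𝓘(ℝ, E) γ J c d ε F) (hJ : IsOpen J) :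
    ContDiffOn ℝ ∞ (fun p : ℝ × ℝ => ‖tension 𝓘(ℝ, E) (F p.1) p.2‖ ^ 2) (Ioo (-ε) ε ×ˢ J) := by
  rintro ⟨t, s⟩ hp
  have hpΩ : (t, s) ∈ chartDomain E J ε F (F t s) := ⟨hp, mem_chart_source E (F t s)⟩
  have hΩ := hF.isOpen_chartDomain hJ (F t s)
  refine ((((isMetricOn_metricIn (E := E) (F t s)).contDiffOn_energy hΩ
    (hF.contDiffOn_chartVariation hJ (F t s)) (fun p hp => chartVariation_mem hp)).contDiffAt
    (hΩ.mem_nhds hpΩ)).congr_of_eventuallyEq ?_).contDiffWithinAt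
  filter_upwards [hΩ.mem_nhds hpΩ] with p hp using hF.norm_tension_sq hJ hp

/-- The first variation of the bienergy density in a space of constant curvature. -/
theorem hasDerivAt_density {C : ℝ} (hC : HasConstantSectionalCurvature 𝓘(ℝ, E) M C)
    (hF : IsVariation 𝓘(ℝ, E) γ J c d ε F) (hγ : SmoothCurve E J γ) (hε : 0 < ε)
    (hunit : ∀ s ∈ J, ‖velocity 𝓘(ℝ, E) γ s‖ = 1) (hs : s ∈ J) :
    HasDerivAt (fun t => ‖tension 𝓘(ℝ, E) (F t) s‖ ^ 2)
      (2 * (inner ℝ (covDerivAlong 𝓘(ℝ, E) γ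
          (covDerivAlong 𝓘(ℝ, E) γ (variationField E γ F)) s) (tension 𝓘(ℝ, E) γ s)
        + C * inner ℝ (variationField E γ F s) (tension 𝓘(ℝ, E) γ s))) 0 := by
  have hx := mem_chart_source E (γ s)
  have hM := isMetricOn_metricIn (E := E) (γ s)
  have hp := hF.zero_mem_chartDomain hε hs hx
  have hΩ := hF.isOpen_chartDomain hγ.isOpen (γ s)
  have hc := hF.contDiffOn_chartVariation hγ.isOpen (γ s)
  have hV := hF.smoothAlong_variationField hγ hε
  have hT := smoothAlong_velocity hγ
  have e1 : (fun s' => extChartAt 𝓘(ℝ, E) (γ s) (γ s')) =ᶠ[𝓝 s]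
      fun s' => chartVariation E F (γ s) (0, s') := by
    filter_upwards [hγ.isOpen.mem_nhds hs] with s' hs'
    rw [chartVariation, hF.zero s' hs']
  have e2 : (fun s' => coord (γ s) (γ s') (variationField E γ F s')) =ᶠ[𝓝 s]
      fun s' => partialFst (chartVariation E F (γ s)) (0, s') := by
    filter_upwards [hγ.eventually_source hs hx] with t ht
      using hF.coord_variationField hγ.isOpen hε ht.1 ht.2
  have e3 : (fun s' => coord (γ s) (γ s')
      (covDerivAlong 𝓘(ℝ, E) γ (variationField E γ F) s')) =ᶠ[𝓝 s]
      fun s' => covD (metricIn (γ s)) (fun s' => chartVariation E F (γ s) (0, s'))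
        (fun s' => partialFst (chartVariation E F (γ s)) (0, s')) s' := by
    filter_upwards [hV.coord_covDeriv_eventuallyEq hγ hs hx, e1.eventuallyEq_nhds,
      e2.eventuallyEq_nhds] with s' h1 h2 h3
    rw [h1, covD_congr h2 h3]
  have hDDV := (hV.covDeriv hγ).coord_covDeriv hγ hs hx
  rw [covD_congr e1 e3] at hDDV
  have hτ := hF.coord_tension hγ hp hF.zero
  have hvel : coord (γ s) (γ s) (velocity 𝓘(ℝ, E) γ s)
      = partialSnd (chartVariation E F (γ s)) (0, s) := by
    rw [← (coord_velocity (hγ.mdifferentiableAt hs) hx).deriv, e1.deriv_eq,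
      (hasDerivAt_partialSnd hΩ hc hp).deriv]
  -- These two values reduce the curvature term C(⟨V,τ⟩|T|² - ⟨V,T⟩⟨T,τ⟩) to C⟨V,τ⟩. They are needed
  -- only at t = 0: the other curves of the family need not have unit speed.
  have hTT : metricIn (γ s) (extChartAt 𝓘(ℝ, E) (γ s) (γ s))
      (coord (γ s) (γ s) (velocity 𝓘(ℝ, E) γ s)) (coord (γ s) (γ s) (velocity 𝓘(ℝ, E) γ s)) = 1 := by
    rw [← inner_eq_metricIn hx, real_inner_self_eq_norm_sq, hunit s hs, one_pow]
  have hTτ : metricIn (γ s) (extChartAt 𝓘(ℝ, E) (γ s) (γ s))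
      (coord (γ s) (γ s) (velocity 𝓘(ℝ, E) γ s)) (coord (γ s) (γ s) (tension 𝓘(ℝ, E) γ s)) = 0 := by
    rw [← inner_eq_metricIn hx, inner_velocity_tension hγ hunit hs]
  refine ((hM.hasDerivAt_energy hΩ hc (fun p hp => chartVariation_mem hp)
    hp).congr_of_eventuallyEq ?_).congr_deriv ?_
  · have hcont : ContinuousAt (fun t : ℝ => (t, s)) 0 := by fun_prop
    filter_upwards [hcont.preimage_mem_nhds (hΩ.mem_nhds hp)] with t ht
      using hF.norm_tension_sq hγ.isOpen ht
  · rw [inner_eq_metricIn hx, inner_eq_metricIn hx, hDDV, ← hτ, ← hvel,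
      ← hF.coord_variationField hγ.isOpen hε hs hx, ← e1.eq_of_nhds, map_add, _root_.add_apply,
      metricIn_curv hC hx, hTT, hTτ]
    ring

end IsVariation

end

noncomputable section

open LocalMetric MeasureTheory

/-! ### The first variation of the bienergy -/

namespace LocalMetric

/-- The t-derivative of the integrand is continuous on the compact rectangle [-ε/2, ε/2] × [c, d],
so a constant dominates it. -/
theorem hasDerivAt_integral_mul {J : Set ℝ} {ε c d : ℝ} {w : ℝ → ℝ} {e : ℝ × ℝ → ℝ}
    (hJ : IsOpen J) (hε : 0 < ε) (hcd : c ≤ d) (hsub : Icc c d ⊆ J) (hw : ContinuousOn w J)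
    (he : ContDiffOn ℝ ∞ e (Ioo (-ε) ε ×ˢ J)) :
    HasDerivAt (fun t => ∫ s in c..d, w s * e (t, s))
      (∫ s in c..d, w s * partialFst e (0, s)) 0 := by
  have hΩ : IsOpen (Ioo (-ε) ε ×ˢ J) := isOpen_Ioo.prod hJ
  have hK : Icc (-(ε / 2)) (ε / 2) ×ˢ Icc c d ⊆ Ioo (-ε) ε ×ˢ J :=
    prod_mono (Icc_subset_Ioo (by linarith) (by linarith)) hsub
  have h0 : Icc (-(ε / 2)) (ε / 2) ∈ 𝓝 (0 : ℝ) := Icc_mem_nhds (by linarith) (by linarith)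
  have hcont : ∀ g : ℝ × ℝ → ℝ, ContinuousOn g (Ioo (-ε) ε ×ˢ J) → ∀ t ∈ Icc (-(ε / 2)) (ε / 2),
      ContinuousOn (fun s => w s * g (t, s)) (Icc c d) := fun g hg t ht =>
    (hw.mono hsub).mul (hg.comp (by fun_prop) fun s hs => hK ⟨ht, hs⟩)
  have hP := (contDiffOn_partialFst hΩ he).continuousOn
  have hbd : ContinuousOn (fun p : ℝ × ℝ => w p.2 * partialFst e p)
      (Icc (-(ε / 2)) (ε / 2) ×ˢ Icc c d) :=
    ((hw.mono hsub).comp continuousOn_snd fun p hp => hp.2).mul (hP.mono hK)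
  obtain ⟨B, hB⟩ := (isCompact_Icc.prod isCompact_Icc).exists_bound_of_continuousOn hbd
  have hIoc : ∀ s ∈ uIoc c d, s ∈ Icc c d := fun s hs => by
    rw [uIoc_of_le hcd] at hs; exact Ioc_subset_Icc_self hs
  have hmeas : ∀ g : ℝ → ℝ, ContinuousOn g (Icc c d) →
      AEStronglyMeasurable g (volume.restrict (uIoc c d)) := fun g hg => by
    rw [uIoc_of_le hcd]
    exact (hg.mono Ioc_subset_Icc_self).aestronglyMeasurable measurableSet_Ioc
  have hz : (0 : ℝ) ∈ Icc (-(ε / 2)) (ε / 2) := mem_of_mem_nhds h0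
  refine (intervalIntegral.hasDerivAt_integral_of_dominated_loc_of_deriv_le (bound := fun _ => B)
    (F' := fun t s => w s * partialFst e (t, s)) h0 ?_ ?_ ?_ ?_ ?_ ?_).2
  · filter_upwards [h0] with t ht using hmeas _ (hcont e he.continuousOn t ht)
  · exact (hcont e he.continuousOn 0 hz).intervalIntegrable_of_Icc hcd
  · exact hmeas _ (hcont _ hP 0 hz)
  · exact Filter.Eventually.of_forall fun s hs t ht => hB (t, s) ⟨ht, hIoc s hs⟩
  · exact intervalIntegrable_const
  · exact Filter.Eventually.of_forall fun s hs t ht =>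
      (hasDerivAt_partialFst hΩ he (hK ⟨ht, hIoc s hs⟩)).const_mul (w s)

end LocalMetric

variable {E : Type*} [NormedAddCommGroup E] [NormedSpace ℝ E] [FiniteDimensional ℝ E]
  {M : Type*} [TopologicalSpace M] [ChartedSpace E M] [IsManifold 𝓘(ℝ, E) ∞ M]
  {J : Set ℝ} {γ : ℝ → M} {c d ε : ℝ} {F : ℝ → ℝ → M} {s t : ℝ} {x₀ : M}
  {V W : Π s : ℝ, TangentSpace 𝓘(ℝ, E) (γ s)} {w : ℝ → ℝ}

theorem SmoothCurve.mono {J' : Set ℝ} (hγ : SmoothCurve E J γ) (h : J' ⊆ J) (hJ' : IsOpen J') :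
    SmoothCurve E J' γ := ⟨hJ', fun s hs => hγ.contMDiffAt s (h hs)⟩

theorem SmoothAlong.mono {J' : Set ℝ} (hV : SmoothAlong J γ V) (h : J' ⊆ J) :
    SmoothAlong J' γ V := fun s hs => hV s (h hs)

theorem IsVariation.variationField_eq_zero (hF : IsVariation 𝓘(ℝ, E) γ J c d ε F) (hJ : IsOpen J)
    (hε : 0 < ε) (hs : s ∈ J \ Icc c d) : variationField E γ F s = 0 := by
  have hx := mem_chart_source E (γ s)
  refine coord_injective hx ?_
  have hp := hF.zero_mem_chartDomain hε hs.1 hx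
  have h1 := hasDerivAt_partialFst (hF.isOpen_chartDomain hJ (γ s))
    (hF.contDiffOn_chartVariation hJ (γ s)) hp
  have h2 : HasDerivAt (fun t => chartVariation E F (γ s) (t, s)) 0 0 :=
    (hasDerivAt_const (0 : ℝ) (extChartAt 𝓘(ℝ, E) (γ s) (γ s))).congr_of_eventuallyEq (by
      filter_upwards [Ioo_mem_nhds (neg_lt_zero.2 hε) hε] with t ht
      rw [chartVariation, hF.fixed t ht s hs])
  rw [hF.coord_variationField hJ hε hs.1 hx, h1.unique h2, coord_eq hx, map_zero]

variable [RiemannianBundle (fun x : M => TangentSpace 𝓘(ℝ, E) x)]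
  [IsContMDiffRiemannianBundle 𝓘(ℝ, E) ∞ E (fun x : M => TangentSpace 𝓘(ℝ, E) x)]

/-- On J the field coincides with 0 • V, and the Leibniz rule gives 0. -/
theorem SmoothAlong.covDeriv_eq_zero (hV : SmoothAlong J γ V) (hγ : SmoothCurve E J γ)
    (h : ∀ s ∈ J, V s = 0) (hs : s ∈ J) : covDerivAlong 𝓘(ℝ, E) γ V s = 0 := by
  have h0 : ContDiffOn ℝ ∞ (fun _ : ℝ => (0 : ℝ)) J := contDiffOn_const
  rw [(hV.smul hγ h0).covDeriv_congr hγ (fun t ht => by rw [h t ht, zero_smul]) hs,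
    hV.covDeriv_smul hγ h0 hs]
  simp

variable (E) in
/-- The Euler-Lagrange field of `½ ∫ w |τ|² ds` in a space of constant curvature `C`. -/
def eulerLagrange (C : ℝ) (γ : ℝ → M) (w : ℝ → ℝ) (s : ℝ) : TangentSpace 𝓘(ℝ, E) (γ s) :=
  covDerivAlong 𝓘(ℝ, E) γ (covDerivAlong 𝓘(ℝ, E) γ (fun s => w s • tension 𝓘(ℝ, E) γ s)) s
    + C • (w s • tension 𝓘(ℝ, E) γ s)

theorem smoothAlong_eulerLagrange (C : ℝ) (hγ : SmoothCurve E J γ) (hw : ContDiffOn ℝ ∞ w J) :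
    SmoothAlong J γ (eulerLagrange E C γ w) := by
  have h := (smoothAlong_tension hγ).smul hγ hw
  exact ((h.covDeriv hγ).covDeriv hγ).add (h.smul hγ (f := fun _ => C) contDiffOn_const) hγ

/-- Integration by parts for fields along a curve. -/
theorem SmoothAlong.integral_inner_covDeriv (hV : SmoothAlong J γ V) (hW : SmoothAlong J γ W)
    (hγ : SmoothCurve E J γ) (hcd : c ≤ d) (hsub : Icc c d ⊆ J)
    (h0 : ∀ s ∈ J \ Icc c d, V s = 0) :
    ∫ s in c..d, ((inner ℝ (covDerivAlong 𝓘(ℝ, E) γ (covDerivAlong 𝓘(ℝ, E) γ V) s) (W s) : ℝ)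
      - inner ℝ (V s) (covDerivAlong 𝓘(ℝ, E) γ (covDerivAlong 𝓘(ℝ, E) γ W) s)) = 0 := by
  have hDV := hV.covDeriv hγ
  have hDW := hW.covDeriv hγ
  have hJ' : IsOpen (J \ Icc c d) := hγ.isOpen.sdiff isClosed_Icc
  have hDV0 : ∀ s ∈ J \ Icc c d, covDerivAlong 𝓘(ℝ, E) γ V s = 0 := fun s hs =>
    (hV.mono sdiff_subset).covDeriv_eq_zero (hγ.mono sdiff_subset hJ') h0 hs
  set B : ℝ → ℝ := fun s => inner ℝ (covDerivAlong 𝓘(ℝ, E) γ V s) (W s)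
    - inner ℝ (V s) (covDerivAlong 𝓘(ℝ, E) γ W s) with hB
  have hBc : ContinuousOn B J :=
    (hDV.contDiffOn_inner hW hγ).continuousOn.sub (hV.contDiffOn_inner hDW hγ).continuousOn
  have hB0 : ∀ s ∈ J \ Icc c d, B s = 0 := fun s hs => by
    simp [hB, h0 s hs, hDV0 s hs]
  -- V is known to vanish only off [c, d]. As J is open, both endpoints are limits of points of J
  -- outside [c, d], so the boundary terms vanish there by continuity.
  have hzero : ∀ p ∈ Icc c d, ∀ l : Filter ℝ, l.NeBot → l ≤ 𝓝 p → (∀ᶠ s in l, s ∉ Icc c d) →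
      B p = 0 := fun p hp l _ hl hout =>
    tendsto_nhds_unique (((hBc.continuousAt (hγ.isOpen.mem_nhds (hsub hp))).tendsto).mono_left hl)
      (tendsto_const_nhds.congr' (by
        filter_upwards [hout, hl (hγ.isOpen.mem_nhds (hsub hp))] with s h1 h2
        exact (hB0 s ⟨h2, h1⟩).symm))
  have hBcz : B c = 0 := hzero c ⟨le_rfl, hcd⟩ (𝓝[<] c) inferInstance nhdsWithin_le_nhds
    (by filter_upwards [self_mem_nhdsWithin] with s hs using fun h => (not_le.2 hs) h.1)
  have hBdz : B d = 0 := hzero d ⟨hcd, le_rfl⟩ (𝓝[>] d) inferInstance nhdsWithin_le_nhds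
    (by filter_upwards [self_mem_nhdsWithin] with s hs using fun h => (not_le.2 hs) h.2)
  have hcont : ContinuousOn (fun s =>
      (inner ℝ (covDerivAlong 𝓘(ℝ, E) γ (covDerivAlong 𝓘(ℝ, E) γ V) s) (W s) : ℝ)
      - inner ℝ (V s) (covDerivAlong 𝓘(ℝ, E) γ (covDerivAlong 𝓘(ℝ, E) γ W) s)) J :=
    ((hDV.covDeriv hγ).contDiffOn_inner hW hγ).continuousOn.sub
      (hV.contDiffOn_inner (hDW.covDeriv hγ) hγ).continuousOn
  rw [intervalIntegral.integral_eq_sub_of_hasDerivAt (f := B) ?_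
    ((hcont.mono hsub).intervalIntegrable_of_Icc hcd), hBcz, hBdz, sub_zero]
  intro s hs
  rw [uIcc_of_le hcd] at hs
  refine ((hDV.hasDerivAt_inner hW hγ (hsub hs)).sub
    (hV.hasDerivAt_inner hDW hγ (hsub hs))).congr_deriv ?_
  ring

/-- The first variation of the bienergy. -/
theorem IsVariation.hasDerivAt_integral {C : ℝ}
    (hC : HasConstantSectionalCurvature 𝓘(ℝ, E) M C) (hF : IsVariation 𝓘(ℝ, E) γ J c d ε F)
    (hγ : SmoothCurve E J γ) (hε : 0 < ε) (hunit : ∀ s ∈ J, ‖velocity 𝓘(ℝ, E) γ s‖ = 1)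
    (hcd : c ≤ d) (hsub : Icc c d ⊆ J) (hw : ContDiffOn ℝ ∞ w J) :
    HasDerivAt (fun t => ∫ s in c..d, w s * ‖tension 𝓘(ℝ, E) (F t) s‖ ^ 2)
      (∫ s in c..d, 2 * inner ℝ (variationField E γ F s) (eulerLagrange E C γ w s)) 0 := by
  have hV := hF.smoothAlong_variationField hγ hε
  have hW := (smoothAlong_tension hγ).smul hγ hw
  have hΩ : IsOpen (Ioo (-ε) ε ×ˢ J) := isOpen_Ioo.prod hγ.isOpen
  refine (hasDerivAt_integral_mul hγ.isOpen hε hcd hsub hw.continuousOn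
    (hF.contDiffOn_density hγ.isOpen)).congr_deriv ?_
  have hparts := hV.integral_inner_covDeriv hW hγ hcd hsub
    (fun s hs => hF.variationField_eq_zero hγ.isOpen hε hs)
  have hi1 : IntervalIntegrable (fun s => (2 : ℝ) * inner ℝ (variationField E γ F s)
      (eulerLagrange E C γ w s)) volume c d :=
    (((hV.contDiffOn_inner (smoothAlong_eulerLagrange C hγ hw) hγ).continuousOn.mono
      hsub).intervalIntegrable_of_Icc hcd).const_mul 2
  have hi2 := (((((hV.covDeriv hγ).covDeriv hγ).contDiffOn_inner hW hγ).continuousOn.sub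
    (hV.contDiffOn_inner ((hW.covDeriv hγ).covDeriv hγ) hγ).continuousOn).mono
      hsub).intervalIntegrable_of_Icc (μ := volume) hcd
  -- The integral in `hparts` is zero; twice it is added in order to move both derivatives from V
  -- onto wτ.
  refine Eq.trans ?_ ((intervalIntegral.integral_add hi1 (hi2.const_mul 2)).trans
    ((congrArg (_ + ·) ((intervalIntegral.integral_const_mul 2 _).trans
      ((congrArg (2 * ·) hparts).trans (mul_zero 2)))).trans (add_zero _)))
  refine intervalIntegral.integral_congr fun s hs => ?_
  rw [uIcc_of_le hcd] at hs
  have h0 : ((0 : ℝ), s) ∈ Ioo (-ε) ε ×ˢ J := ⟨⟨by simpa using hε, hε⟩, hsub hs⟩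
  have h1 := hasDerivAt_partialFst hΩ (hF.contDiffOn_density hγ.isOpen) h0
  have h2 := hF.hasDerivAt_density hC hγ hε hunit (hsub hs)
  simp only [h1.unique h2, eulerLagrange, Pi.sub_apply, inner_add_right, real_inner_smul_right]
  ring

end

noncomputable section

open LocalMetric MeasureTheory

variable {E : Type*} [NormedAddCommGroup E] [NormedSpace ℝ E] [FiniteDimensional ℝ E]
  {M : Type*} [TopologicalSpace M] [ChartedSpace E M] [IsManifold 𝓘(ℝ, E) ∞ M]
  {J : Set ℝ} {γ : ℝ → M} {a b c d ε : ℝ} {s t : ℝ} {x₀ : M} {w : ℝ → ℝ} {η : ℝ → ℝ} {u : E}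

/-! ### Variations supported in a chart -/

open Classical in
/-- The variation of `γ` which moves `γ s`, `a < s < b`, with velocity `η s • u` in the chart around
`x₀`. -/
def bumpVariation (γ : ℝ → M) (x₀ : M) (a b : ℝ) (η : ℝ → ℝ) (u : E) (t s : ℝ) : M :=
  if s ∈ Ioo a b then
    (extChartAt 𝓘(ℝ, E) x₀).symm (extChartAt 𝓘(ℝ, E) x₀ (γ s) + (t * η s) • u)
  else γ s

theorem bumpVariation_of_mem (γ : ℝ → M) (x₀ : M) (η : ℝ → ℝ) (u : E) (t : ℝ)
    (hs : s ∈ Ioo a b) : bumpVariation γ x₀ a b η u t s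
      = (extChartAt 𝓘(ℝ, E) x₀).symm (extChartAt 𝓘(ℝ, E) x₀ (γ s) + (t * η s) • u) := if_pos hs

theorem bumpVariation_eq_self (hx : ∀ s ∈ Ioo a b, γ s ∈ (chartAt E x₀).source)
    (h : t * η s = 0) : bumpVariation γ x₀ a b η u t s = γ s := by
  by_cases hs : s ∈ Ioo a b
  · rw [bumpVariation_of_mem _ _ _ _ _ hs, h, zero_smul, add_zero, chart_left_inv (hx s hs)]
  · exact if_neg hs

theorem isVariation_bumpVariation (hγ : SmoothCurve E J γ)
    (hsub : Icc c d ⊆ Ioo a b) (hx : ∀ s ∈ Ioo a b, γ s ∈ (chartAt E x₀).source)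
    (hη : ContDiff ℝ ∞ η) (hη0 : ∀ s ∉ Icc c d, η s = 0)
    (hε : ∀ t ∈ Ioo (-ε) ε, ∀ s ∈ Icc c d,
      extChartAt 𝓘(ℝ, E) x₀ (γ s) + (t * η s) • u ∈ (extChartAt 𝓘(ℝ, E) x₀).target) :
    IsVariation 𝓘(ℝ, E) γ J c d ε (bumpVariation γ x₀ a b η u) where
  smooth := by
    rintro ⟨t, s⟩ ⟨ht, hs⟩
    refine ContMDiffAt.contMDiffWithinAt ?_
    -- Since [c, d] ⊆ (a, b), the interval (a, b) and the complement of [c, d] form an open cover.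
    -- On the first the chart formula is smooth, on the second the variation does not depend on t.
    by_cases hsab : s ∈ Ioo a b
    · have htar : extChartAt 𝓘(ℝ, E) x₀ (γ s) + (t * η s) • u ∈ (extChartAt 𝓘(ℝ, E) x₀).target := by
        by_cases h : s ∈ Icc c d
        · exact hε t ht s h
        · rw [hη0 s h, mul_zero, zero_smul, add_zero]
          exact chart_mem (hx s hsab)
      have h1 : ContDiffAt ℝ ∞ (fun p : ℝ × ℝ => extChartAt 𝓘(ℝ, E) x₀ (γ p.2)) (t, s) :=
        ContDiffAt.comp (g := fun s => extChartAt 𝓘(ℝ, E) x₀ (γ s)) (f := Prod.snd) (t, s)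
          (contDiffAt_chart_comp (hγ.contMDiffAt s hs) (hx s hsab)) contDiffAt_snd
      have h2 : ContDiffAt ℝ ∞ (fun p : ℝ × ℝ =>
          extChartAt 𝓘(ℝ, E) x₀ (γ p.2) + (p.1 * η p.2) • u) (t, s) :=
        h1.add ((contDiffAt_fst.mul (ContDiffAt.comp (g := η) (f := Prod.snd) (t, s)
          hη.contDiffAt contDiffAt_snd)).smul contDiffAt_const)
      refine (ContMDiffAt.comp (t, s) (g := (extChartAt 𝓘(ℝ, E) x₀).symm)
        (f := fun p : ℝ × ℝ => extChartAt 𝓘(ℝ, E) x₀ (γ p.2) + (p.1 * η p.2) • u)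
        (contMDiffAt_chart_symm htar) h2.contMDiffAt).congr_of_eventuallyEq ?_
      filter_upwards [continuousAt_snd.preimage_mem_nhds (isOpen_Ioo.mem_nhds hsab)] with p hp
      exact bumpVariation_of_mem _ _ _ _ _ hp
    · have hout : s ∉ Icc c d := fun h => hsab (hsub h)
      refine (ContMDiffAt.comp (t, s) (g := γ) (f := fun p : ℝ × ℝ => p.2)
        (hγ.contMDiffAt s hs) contDiffAt_snd.contMDiffAt).congr_of_eventuallyEq ?_
      filter_upwards [continuousAt_snd.preimage_mem_nhds (isClosed_Icc.isOpen_compl.mem_nhds hout)]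
        with p hp
      exact bumpVariation_eq_self hx (by rw [hη0 _ hp, mul_zero])
  zero s hs := bumpVariation_eq_self hx (zero_mul _)
  fixed t ht s hs := bumpVariation_eq_self hx (by rw [hη0 s hs.2, mul_zero])

theorem coord_variationField_bumpVariation (hγ : SmoothCurve E J γ)
    (hF : IsVariation 𝓘(ℝ, E) γ J c d ε (bumpVariation γ x₀ a b η u)) (hε0 : 0 < ε)
    (hsJ : s ∈ J) (hsub : Icc c d ⊆ Ioo a b) (hx : ∀ s ∈ Ioo a b, γ s ∈ (chartAt E x₀).source)
    (hε : ∀ t ∈ Ioo (-ε) ε, ∀ s ∈ Icc c d,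
      extChartAt 𝓘(ℝ, E) x₀ (γ s) + (t * η s) • u ∈ (extChartAt 𝓘(ℝ, E) x₀).target)
    (hs : s ∈ Icc c d) :
    variationField E γ (bumpVariation γ x₀ a b η u) s = η s • frame x₀ u (γ s) := by
  have hxs := hx s (hsub hs)
  refine coord_injective hxs ?_
  rw [hF.coord_variationField hγ.isOpen hε0 hsJ hxs, coord_smul hxs, coord_frame hxs]
  have h1 := hasDerivAt_partialFst (hF.isOpen_chartDomain hγ.isOpen x₀)
    (hF.contDiffOn_chartVariation hγ.isOpen x₀) (hF.zero_mem_chartDomain hε0 hsJ hxs)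
  have h2 : HasDerivAt (fun t : ℝ => extChartAt 𝓘(ℝ, E) x₀ (γ s) + (t * η s) • u)
      (η s • u) 0 := by
    refine ((((hasDerivAt_id (0 : ℝ)).mul_const (η s)).smul_const u).const_add _).congr_deriv ?_
    rw [one_mul]
  refine h1.unique (h2.congr_of_eventuallyEq ?_)
  filter_upwards [Ioo_mem_nhds (neg_lt_zero.2 hε0) hε0] with t ht
  rw [chartVariation, bumpVariation_of_mem _ _ _ _ _ (hsub hs),
    (extChartAt 𝓘(ℝ, E) x₀).right_inv (hε t ht s hs)]

/-- At t = 0 the compact arc lies in the open target of the chart; the tube lemma gives one ε for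
the whole arc. -/
theorem exists_pos_forall_mem_target (hγ : SmoothCurve E J γ) (hJ : Icc c d ⊆ J)
    (hx : ∀ s ∈ Icc c d, γ s ∈ (chartAt E x₀).source) (hη : Continuous η) (u : E) :
    ∃ ε > 0, ∀ t ∈ Ioo (-ε) ε, ∀ s ∈ Icc c d,
      extChartAt 𝓘(ℝ, E) x₀ (γ s) + (t * η s) • u ∈ (extChartAt 𝓘(ℝ, E) x₀).target := by
  have hcont : ContinuousOn (fun p : ℝ × ℝ => extChartAt 𝓘(ℝ, E) x₀ (γ p.2) + (p.1 * η p.2) • u)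
      (univ ×ˢ Icc c d) := by
    have h1 : ContinuousOn (fun s => extChartAt 𝓘(ℝ, E) x₀ (γ s)) (Icc c d) := fun s hs =>
      (contDiffAt_chart_comp (hγ.contMDiffAt s (hJ hs)) (hx s hs)).continuousAt.continuousWithinAt
    exact (h1.comp continuousOn_snd fun p hp => hp.2).add (by fun_prop)
  obtain ⟨O, hO, hOeq⟩ := (continuousOn_iff'.1 hcont) _ (isOpen_extChartAt_target (I := 𝓘(ℝ, E)) x₀)
  have hsub : ({0} : Set ℝ) ×ˢ Icc c d ⊆ O := by
    rintro ⟨t, s⟩ ⟨ht, hs⟩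
    have : ((t, s) : ℝ × ℝ) ∈ O ∩ univ ×ˢ Icc c d := by
      rw [← hOeq]
      refine ⟨?_, mem_univ _, hs⟩
      change extChartAt 𝓘(ℝ, E) x₀ (γ s) + (t * η s) • u ∈ (extChartAt 𝓘(ℝ, E) x₀).target
      rw [show t = 0 from ht, zero_mul, zero_smul, add_zero]
      exact chart_mem (hx s hs)
    exact this.1
  obtain ⟨U, V, hU, -, h0U, hV, hUV⟩ := generalized_tube_lemma isCompact_singleton isCompact_Icc hO hsub
  obtain ⟨ε, hε, hball⟩ := Metric.isOpen_iff.1 hU 0 (h0U rfl)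
  refine ⟨ε, hε, fun t ht s hs => ?_⟩
  have : ((t, s) : ℝ × ℝ) ∈ O ∩ univ ×ˢ Icc c d :=
    ⟨hUV ⟨hball (by simpa [abs_lt] using ht), hV hs⟩, mem_univ _, hs⟩
  rw [← hOeq] at this
  exact this.1

/-! ### The Euler-Lagrange equation -/

variable [RiemannianBundle (fun x : M => TangentSpace 𝓘(ℝ, E) x)]
  [IsContMDiffRiemannianBundle 𝓘(ℝ, E) ∞ E (fun x : M => TangentSpace 𝓘(ℝ, E) x)]

/-- The critical curves in a space of constant curvature are the solutions of the Euler-Lagrange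
equation. -/
theorem isCriticalCurve_iff {C : ℝ} (hC : HasConstantSectionalCurvature 𝓘(ℝ, E) M C)
    (hγ : SmoothCurve E J γ) (hunit : ∀ s ∈ J, ‖velocity 𝓘(ℝ, E) γ s‖ = 1)
    (hw : ContDiffOn ℝ ∞ w J) :
    IsCriticalCurve 𝓘(ℝ, E) w J γ ↔ ∀ s ∈ J, eulerLagrange E C γ w s = 0 := by
  have hL := smoothAlong_eulerLagrange C hγ hw
  constructor
  · intro hcrit s₀ hs₀
    by_contra hne
    have hx₀ := mem_chart_source E (γ s₀)
    -- The test direction has constant coordinates, equal to those of the Euler-Lagrange field at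
    -- s₀. Its pairing with that field is therefore positive at s₀, hence nearby.
    set u := coord (γ s₀) (γ s₀) (eulerLagrange E C γ w s₀) with hu
    have hJ' : IsOpen (J ∩ γ ⁻¹' (chartAt E (γ s₀)).source) :=
      ContinuousOn.isOpen_inter_preimage
        (fun s hs => (hγ.contMDiffAt s hs).continuousAt.continuousWithinAt) hγ.isOpen
        (chartAt E (γ s₀)).open_source
    have hγ' := hγ.mono inter_subset_left hJ'
    have hfr : SmoothAlong (J ∩ γ ⁻¹' (chartAt E (γ s₀)).source) γ
        (fun s => frame (γ s₀) u (γ s)) := SmoothAlong.of_coord hγ' fun s hs =>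
      ⟨γ s₀, hs.2, (contDiffAt_const (c := u)).congr_of_eventuallyEq (by
        filter_upwards [hJ'.mem_nhds hs] with t ht using coord_frame ht.2 u)⟩
    have hφ := (hfr.contDiffOn_inner (hL.mono inter_subset_left) hγ').continuousOn
    have hφ₀ : 0 < (inner ℝ (frame (γ s₀) u (γ s₀)) (eulerLagrange E C γ w s₀) : ℝ) := by
      rw [hu, frame_coord hx₀]
      exact real_inner_self_pos.2 hne
    have hev : ∀ᶠ s in 𝓝 s₀, s ∈ J ∩ γ ⁻¹' (chartAt E (γ s₀)).source ∧
        0 < (inner ℝ (frame (γ s₀) u (γ s)) (eulerLagrange E C γ w s) : ℝ) :=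
      (hJ'.eventually_mem ⟨hs₀, hx₀⟩).and
        ((hφ.continuousAt (hJ'.mem_nhds ⟨hs₀, hx₀⟩)).eventually (lt_mem_nhds hφ₀))
    obtain ⟨δ, hδ, hball⟩ := Metric.eventually_nhds_iff.1 hev
    -- The bump vanishes outside radius δ/2, well inside the interval of radius δ where the curve
    -- stays in the chart and the pairing is positive.
    let η : ContDiffBump s₀ := ⟨δ / 4, δ / 2, by linarith, by linarith⟩
    have hIcc : Icc (s₀ - δ / 2) (s₀ + δ / 2) ⊆ Ioo (s₀ - δ) (s₀ + δ) :=
      Icc_subset_Ioo (by linarith) (by linarith)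
    have hIoo : ∀ s ∈ Ioo (s₀ - δ) (s₀ + δ), s ∈ J ∩ γ ⁻¹' (chartAt E (γ s₀)).source ∧
        0 < (inner ℝ (frame (γ s₀) u (γ s)) (eulerLagrange E C γ w s) : ℝ) := fun s hs =>
      hball (by rw [Real.dist_eq, abs_lt]; constructor <;> linarith [hs.1, hs.2])
    have hη0 : ∀ s ∉ Icc (s₀ - δ / 2) (s₀ + δ / 2), η s = 0 := fun s hs =>
      η.zero_of_le_dist (by
        change δ / 2 ≤ dist s s₀
        by_contra h
        rw [not_le, Real.dist_eq, abs_lt] at h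
        exact hs ⟨by linarith, by linarith⟩)
    obtain ⟨ε, hε, htar⟩ := exists_pos_forall_mem_target hγ
      (fun s hs => (hIoo s (hIcc hs)).1.1) (fun s hs => (hIoo s (hIcc hs)).1.2) η.continuous u
    have hF := isVariation_bumpVariation hγ hIcc (fun s hs => (hIoo s hs).1.2) η.contDiff hη0 htar
    have hcd : s₀ - δ / 2 ≤ s₀ + δ / 2 := by linarith
    have hsub : Icc (s₀ - δ / 2) (s₀ + δ / 2) ⊆ J := fun s hs => (hIoo s (hIcc hs)).1.1
    have hz := (hF.hasDerivAt_integral hC hγ hε hunit hcd hsub hw).unique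
      (hcrit _ _ hcd hsub ε hε _ hF)
    have hVs : ∀ s ∈ Icc (s₀ - δ / 2) (s₀ + δ / 2),
        (2 : ℝ) * inner ℝ (variationField E γ
          (bumpVariation γ (γ s₀) (s₀ - δ) (s₀ + δ) η u) s) (eulerLagrange E C γ w s)
        = 2 * (η s * inner ℝ (frame (γ s₀) u (γ s)) (eulerLagrange E C γ w s)) := fun s hs => by
      rw [coord_variationField_bumpVariation hγ hF hε (hsub hs) hIcc (fun s hs => (hIoo s hs).1.2)
        htar hs, real_inner_smul_left]
    rw [intervalIntegral.integral_congr (g := fun s =>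
      2 * (η s * inner ℝ (frame (γ s₀) u (γ s)) (eulerLagrange E C γ w s)))
      (fun s hs => hVs s (by rwa [uIcc_of_le hcd] at hs))] at hz
    refine (intervalIntegral.integral_pos (by linarith) ?_ ?_ ⟨s₀, ⟨by linarith, by linarith⟩, ?_⟩).ne' hz
    · exact continuousOn_const.mul (η.continuous.continuousOn.mul
        (hφ.mono fun s hs => (hIoo s (hIcc hs)).1))
    · exact fun s hs => mul_nonneg zero_le_two
        (mul_nonneg η.nonneg (hIoo s (hIcc (Ioc_subset_Icc_self hs))).2.le)
    · exact mul_pos two_pos (mul_pos (η.pos_of_mem_ball (Metric.mem_ball_self (half_pos hδ))) hφ₀)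
  · intro h c d hcd hsub ε hε F hF
    refine (hF.hasDerivAt_integral hC hγ hε hunit hcd hsub hw).congr_deriv ?_
    rw [intervalIntegral.integral_congr (g := fun _ => (0 : ℝ))]
    · simp
    · intro s hs
      rw [uIcc_of_le hcd] at hs
      simp [h s (hsub hs)]

end

/-! ### Reduction of the Euler-Lagrange equation to scalar equations. -/

noncomputable section

open LocalMetric

variable {E : Type*} [NormedAddCommGroup E] [NormedSpace ℝ E] [FiniteDimensional ℝ E]
  {M : Type*} [TopologicalSpace M] [ChartedSpace E M] [IsManifold 𝓘(ℝ, E) ∞ M]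
  {J : Set ℝ} {γ : ℝ → M} {s : ℝ} {w : ℝ → ℝ}
  [RiemannianBundle (fun x : M => TangentSpace 𝓘(ℝ, E) x)]
  [IsContMDiffRiemannianBundle 𝓘(ℝ, E) ∞ E (fun x : M => TangentSpace 𝓘(ℝ, E) x)]

/-! ### The principal normal and the second Frenet equation -/

variable (E) in
/-- The principal normal `F₂`. -/
def principalNormal (γ : ℝ → M) (s : ℝ) : TangentSpace 𝓘(ℝ, E) (γ s) :=
  ‖tension 𝓘(ℝ, E) γ s‖⁻¹ • tension 𝓘(ℝ, E) γ s

variable (E) in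
/-- The field `∇_{γ'} F₂ + κ₁ F₁ = κ₂ F₃`. -/
def scaledBinormal (γ : ℝ → M) (s : ℝ) : TangentSpace 𝓘(ℝ, E) (γ s) :=
  covDerivAlong 𝓘(ℝ, E) γ (principalNormal E γ) s
    + ‖tension 𝓘(ℝ, E) γ s‖ • velocity 𝓘(ℝ, E) γ s

/-- The norm is smooth only away from zero, which is why the frame is used only where κ₁ > 0. -/
theorem contDiffOn_norm_tension (hγ : SmoothCurve E J γ)
    (hκ : ∀ s ∈ J, 0 < ‖tension 𝓘(ℝ, E) γ s‖) :
    ContDiffOn ℝ ∞ (fun s => ‖tension 𝓘(ℝ, E) γ s‖) J := by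
  have hτ := smoothAlong_tension hγ
  refine ((hτ.contDiffOn_inner hτ hγ).sqrt fun s hs => ?_).congr fun s _ => ?_
  · rw [real_inner_self_eq_norm_sq]
    exact pow_ne_zero 2 (hκ s hs).ne'
  · rw [real_inner_self_eq_norm_sq, Real.sqrt_sq (norm_nonneg _)]

theorem smoothAlong_principalNormal (hγ : SmoothCurve E J γ)
    (hκ : ∀ s ∈ J, 0 < ‖tension 𝓘(ℝ, E) γ s‖) : SmoothAlong J γ (principalNormal E γ) :=
  (smoothAlong_tension hγ).smul hγ ((contDiffOn_norm_tension hγ hκ).inv fun s hs => (hκ s hs).ne')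

/-- κ₂F₃ is smooth even across zeros of κ₂, unlike F₃. Working with it avoids assuming beforehand
that κ₂ has no zeros. -/
theorem smoothAlong_scaledBinormal (hγ : SmoothCurve E J γ)
    (hκ : ∀ s ∈ J, 0 < ‖tension 𝓘(ℝ, E) γ s‖) : SmoothAlong J γ (scaledBinormal E γ) :=
  ((smoothAlong_principalNormal hγ hκ).covDeriv hγ).add
    ((smoothAlong_velocity hγ).smul hγ (contDiffOn_norm_tension hγ hκ)) hγ

theorem tension_eq_smul_principalNormal (hκ : 0 < ‖tension 𝓘(ℝ, E) γ s‖) :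
    tension 𝓘(ℝ, E) γ s = ‖tension 𝓘(ℝ, E) γ s‖ • principalNormal E γ s := by
  rw [principalNormal, smul_smul, mul_inv_cancel₀ hκ.ne', one_smul]

theorem inner_principalNormal_self (hκ : 0 < ‖tension 𝓘(ℝ, E) γ s‖) :
    (inner ℝ (principalNormal E γ s) (principalNormal E γ s) : ℝ) = 1 := by
  rw [principalNormal, real_inner_smul_left, real_inner_smul_right, real_inner_self_eq_norm_sq]
  field_simp

theorem inner_velocity_principalNormal (hγ : SmoothCurve E J γ)
    (hunit : ∀ s ∈ J, ‖velocity 𝓘(ℝ, E) γ s‖ = 1) (hs : s ∈ J) :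
    (inner ℝ (velocity 𝓘(ℝ, E) γ s) (principalNormal E γ s) : ℝ) = 0 := by
  rw [principalNormal, real_inner_smul_right, inner_velocity_tension hγ hunit hs, mul_zero]

theorem covDeriv_principalNormal (γ : ℝ → M) (s : ℝ) :
    covDerivAlong 𝓘(ℝ, E) γ (principalNormal E γ) s
      = scaledBinormal E γ s - ‖tension 𝓘(ℝ, E) γ s‖ • velocity 𝓘(ℝ, E) γ s := by
  rw [scaledBinormal, add_sub_cancel_right]

theorem SmoothAlong.inner_covDeriv_of_inner_eq {V W : Π s : ℝ, TangentSpace 𝓘(ℝ, E) (γ s)}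
    (hV : SmoothAlong J γ V) (hW : SmoothAlong J γ W) (hγ : SmoothCurve E J γ) {a : ℝ}
    (h : ∀ s ∈ J, (inner ℝ (V s) (W s) : ℝ) = a) (hs : s ∈ J) :
    (inner ℝ (covDerivAlong 𝓘(ℝ, E) γ V s) (W s) : ℝ)
      = -inner ℝ (V s) (covDerivAlong 𝓘(ℝ, E) γ W s) := by
  have h1 := (hV.hasDerivAt_inner hW hγ hs).unique ((hasDerivAt_const s a).congr_of_eventuallyEq (by
    filter_upwards [hγ.isOpen.mem_nhds hs] with t ht using h t ht))
  linarith

/-- ⟨∇_T N, T⟩ = -⟨N, τ⟩ = -κ₁, and the added term κ₁T compensates exactly this. -/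
theorem inner_scaledBinormal_velocity (hγ : SmoothCurve E J γ)
    (hunit : ∀ s ∈ J, ‖velocity 𝓘(ℝ, E) γ s‖ = 1)
    (hκ : ∀ s ∈ J, 0 < ‖tension 𝓘(ℝ, E) γ s‖) (hs : s ∈ J) :
    (inner ℝ (scaledBinormal E γ s) (velocity 𝓘(ℝ, E) γ s) : ℝ) = 0 := by
  have h := (smoothAlong_principalNormal hγ hκ).inner_covDeriv_of_inner_eq
    (smoothAlong_velocity hγ) hγ (a := 0)
    (fun t ht => by rw [real_inner_comm, inner_velocity_principalNormal hγ hunit ht]) hs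
  change _ = -inner ℝ (principalNormal E γ s) (tension 𝓘(ℝ, E) γ s) at h
  rw [tension_eq_smul_principalNormal (hκ s hs), real_inner_smul_right,
    inner_principalNormal_self (hκ s hs)] at h
  rw [scaledBinormal, inner_add_left, h, real_inner_smul_left, real_inner_self_eq_norm_sq,
    hunit s hs]
  ring

theorem inner_scaledBinormal_principalNormal (hγ : SmoothCurve E J γ)
    (hunit : ∀ s ∈ J, ‖velocity 𝓘(ℝ, E) γ s‖ = 1)
    (hκ : ∀ s ∈ J, 0 < ‖tension 𝓘(ℝ, E) γ s‖) (hs : s ∈ J) :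
    (inner ℝ (scaledBinormal E γ s) (principalNormal E γ s) : ℝ) = 0 := by
  have hN := smoothAlong_principalNormal hγ hκ
  have h := hN.inner_covDeriv_of_inner_eq hN hγ
    (fun t ht => inner_principalNormal_self (hκ t ht)) hs
  rw [real_inner_comm] at h
  rw [scaledBinormal, inner_add_left, real_inner_smul_left,
    inner_velocity_principalNormal hγ hunit hs, real_inner_comm]
  linarith

theorem inner_covDeriv_scaledBinormal_principalNormal (hγ : SmoothCurve E J γ)
    (hunit : ∀ s ∈ J, ‖velocity 𝓘(ℝ, E) γ s‖ = 1)
    (hκ : ∀ s ∈ J, 0 < ‖tension 𝓘(ℝ, E) γ s‖) (hs : s ∈ J) :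
    (inner ℝ (covDerivAlong 𝓘(ℝ, E) γ (scaledBinormal E γ) s) (principalNormal E γ s) : ℝ)
      = -‖scaledBinormal E γ s‖ ^ 2 := by
  rw [(smoothAlong_scaledBinormal hγ hκ).inner_covDeriv_of_inner_eq
    (smoothAlong_principalNormal hγ hκ) hγ
    (fun t ht => inner_scaledBinormal_principalNormal hγ hunit hκ ht) hs,
    covDeriv_principalNormal, inner_sub_right, real_inner_smul_right,
    inner_scaledBinormal_velocity hγ hunit hκ hs, real_inner_self_eq_norm_sq]
  ring

/-- The Euler-Lagrange field in the Frenet frame, for `w = g / κ₁`. -/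
theorem eulerLagrange_eq (C : ℝ) (hγ : SmoothCurve E J γ)
    (hκ : ∀ s ∈ J, 0 < ‖tension 𝓘(ℝ, E) γ s‖) {g : ℝ → ℝ} (hg : ContDiffOn ℝ ∞ g J)
    (hgw : ∀ s ∈ J, g s = w s * ‖tension 𝓘(ℝ, E) γ s‖) (hs : s ∈ J) :
    eulerLagrange E C γ w s = g s • covDerivAlong 𝓘(ℝ, E) γ (scaledBinormal E γ) s
      + (2 * deriv g s) • scaledBinormal E γ s
      - (2 * deriv g s * ‖tension 𝓘(ℝ, E) γ s‖
        + g s * deriv (fun s => ‖tension 𝓘(ℝ, E) γ s‖) s) • velocity 𝓘(ℝ, E) γ s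
      + (deriv (deriv g) s - g s * ‖tension 𝓘(ℝ, E) γ s‖ ^ 2 + C * g s) • principalNormal E γ s := by
  have hN := smoothAlong_principalNormal hγ hκ
  have hB := smoothAlong_scaledBinormal hγ hκ
  have hT := smoothAlong_velocity hγ
  have hk := contDiffOn_norm_tension hγ hκ
  have hg' : ContDiffOn ℝ ∞ (deriv g) J := hg.deriv_of_isOpen hγ.isOpen (by simp)
  have hW : ∀ t ∈ J, w t • tension 𝓘(ℝ, E) γ t = g t • principalNormal E γ t := fun t ht => by
    conv_lhs => rw [tension_eq_smul_principalNormal (hκ t ht)]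
    rw [smul_smul, hgw t ht]
  have hgk := (hg.mul hk).neg
  have hD1 : ∀ t ∈ J, covDerivAlong 𝓘(ℝ, E) γ (fun s => w s • tension 𝓘(ℝ, E) γ s) t
      = (deriv g t • principalNormal E γ t + g t • scaledBinormal E γ t)
        + (-(g t * ‖tension 𝓘(ℝ, E) γ t‖)) • velocity 𝓘(ℝ, E) γ t := fun t ht => by
    rw [(hN.smul hγ hg).covDeriv_congr hγ hW ht, hN.covDeriv_smul hγ hg ht,
      covDeriv_principalNormal]
    module
  have h1 := (hN.smul hγ hg').add (hB.smul hγ hg) hγ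
  have h2 := hT.smul hγ hgk
  have hd : deriv (fun t => -(g t * ‖tension 𝓘(ℝ, E) γ t‖)) s
      = -(deriv g s * ‖tension 𝓘(ℝ, E) γ s‖
        + g s * deriv (fun s => ‖tension 𝓘(ℝ, E) γ s‖) s) := by
    have hn := hγ.isOpen.mem_nhds hs
    exact ((((hg.contDiffAt hn).differentiableAt (by simp)).hasDerivAt.mul
      ((hk.contDiffAt hn).differentiableAt (by simp)).hasDerivAt).neg).deriv
  rw [eulerLagrange, (h1.add h2 hγ).covDeriv_congr hγ hD1 hs, h1.covDeriv_add h2 hγ hs,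
    (hN.smul hγ hg').covDeriv_add (hB.smul hγ hg) hγ hs, hN.covDeriv_smul hγ hg' hs,
    hB.covDeriv_smul hγ hg hs, hT.covDeriv_smul hγ hgk hs, hW s hs, hd, covDeriv_principalNormal,
    show covDerivAlong 𝓘(ℝ, E) γ (velocity 𝓘(ℝ, E) γ) s
      = ‖tension 𝓘(ℝ, E) γ s‖ • principalNormal E γ s from
      tension_eq_smul_principalNormal (hκ s hs)]
  module

end

noncomputable section

open LocalMetric

/-! ### Scalar functions on an open interval -/

theorem hasDerivAt_deriv_of_contDiffOn {J : Set ℝ} {f : ℝ → ℝ} {s : ℝ} (hf : ContDiffOn ℝ ∞ f J)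
    (hJ : IsOpen J) (hs : s ∈ J) : HasDerivAt f (deriv f s) s :=
  ((hf.contDiffAt (hJ.mem_nhds hs)).differentiableAt (by simp)).hasDerivAt

theorem eq_of_hasDerivAt_zero {J : Set ℝ} {f : ℝ → ℝ} (hJ : IsOpen J) (hconn : J.OrdConnected)
    (h : ∀ s ∈ J, HasDerivAt f 0 s) {s t : ℝ} (hs : s ∈ J) (ht : t ∈ J) : f s = f t :=
  hJ.is_const_of_deriv_eq_zero hconn.isPreconnected
    (fun s hs => (h s hs).differentiableAt.differentiableWithinAt) (fun s hs => (h s hs).deriv) hs ht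

/-- The equation satisfied by the radius of curvature `1 / κ₁` of an `f`-biharmonic curve with
`κ₂ = c κ₁`, with a constant of integration `e`. -/
structure IsRadiusSolution (C c e : ℝ) (J : Set ℝ) (v : ℝ → ℝ) : Prop where
  pos : ∀ s ∈ J, 0 < v s
  smooth : ContDiffOn ℝ ∞ v J
  hasDerivAt_deriv : ∀ s ∈ J, HasDerivAt (deriv v) (4 * e - 4 * C * v s) s
  deriv_sq : ∀ s ∈ J, deriv v s ^ 2 = 4 * (2 * e * v s - (1 + c ^ 2) - C * v s ^ 2)

theorem hasDerivAt_of_sq {J : Set ℝ} {v g : ℝ → ℝ} {a : ℝ} (hJ : IsOpen J)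
    (hg : ContDiffOn ℝ ∞ g J) (hv : ∀ s ∈ J, v s = a * g s ^ 2) :
    (∀ s ∈ J, deriv v s = a * (2 * g s * deriv g s)) ∧
    ∀ s ∈ J, HasDerivAt (deriv v) (a * (2 * deriv g s ^ 2 + 2 * g s * deriv (deriv g) s)) s := by
  have hg' : ContDiffOn ℝ ∞ (deriv g) J := hg.deriv_of_isOpen hJ (by simp)
  have h1 : ∀ s ∈ J, deriv v s = a * (2 * g s * deriv g s) := fun s hs => by
    have h := ((hasDerivAt_deriv_of_contDiffOn hg hJ hs).pow 2).const_mul a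
    have h' := h.congr_of_eventuallyEq (f₁ := v) (by
      filter_upwards [hJ.mem_nhds hs] with t ht using hv t ht)
    rw [h'.deriv]
    norm_num
  refine ⟨h1, fun s hs => ?_⟩
  have h := (((hasDerivAt_deriv_of_contDiffOn hg hJ hs).const_mul 2).mul
    (hasDerivAt_deriv_of_contDiffOn hg' hJ hs)).const_mul a
  refine (h.congr_of_eventuallyEq (f₁ := deriv v) (by
      filter_upwards [hJ.mem_nhds hs] with t ht using h1 t ht)).congr_deriv ?_
  ring

/-- The equation `g'' = g (κ² (1 + c²) - C)` with `g² κ = a`, in terms of `1 / κ`. -/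
theorem exists_isRadiusSolution {J : Set ℝ} {κ g : ℝ → ℝ} {a c C : ℝ} (hJ : IsOpen J)
    (hconn : J.OrdConnected) (hne : J.Nonempty) (ha : 0 < a) (hg : ContDiffOn ℝ ∞ g J)
    (hg0 : ∀ s ∈ J, 0 < g s) (hκ0 : ∀ s ∈ J, 0 < κ s) (hgκ : ∀ s ∈ J, g s ^ 2 * κ s = a)
    (h : ∀ s ∈ J, deriv (deriv g) s = g s * (κ s ^ 2 * (1 + c ^ 2) - C)) :
    ∃ e, IsRadiusSolution C c e J (fun s => (κ s)⁻¹) := by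
  obtain ⟨s₀, hs₀⟩ := hne
  have hg' : ContDiffOn ℝ ∞ (deriv g) J := hg.deriv_of_isOpen hJ (by simp)
  have hv : ∀ s ∈ J, (κ s)⁻¹ = a⁻¹ * g s ^ 2 := fun s hs => by
    have := (hκ0 s hs).ne'
    rw [← hgκ s hs]
    have := (hg0 s hs).ne'
    field_simp
  have hκ : ∀ s ∈ J, κ s = a * (g s ^ 2)⁻¹ := fun s hs => by
    have := (hg0 s hs).ne'
    rw [← hgκ s hs]
    field_simp
  obtain ⟨hv1, hv2⟩ := hasDerivAt_of_sq hJ hg hv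
  -- The energy of g'' = a²(1+c²)g⁻³ - Cg. Its constant value determines e = N/(2a) in both
  -- equations for v; both are recorded because the first integral yields v'' only where v' ≠ 0.
  set N : ℝ → ℝ := fun s => deriv g s ^ 2 + (1 + c ^ 2) * a ^ 2 * (g s ^ 2)⁻¹ + C * g s ^ 2 with hN
  have hconst : ∀ s ∈ J, N s = N s₀ := fun s hs => by
    refine eq_of_hasDerivAt_zero hJ hconn (fun t ht => ?_) hs hs₀
    have d1 := hasDerivAt_deriv_of_contDiffOn hg hJ ht
    have d2 := hasDerivAt_deriv_of_contDiffOn hg' hJ ht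
    have hgt := (hg0 t ht).ne'
    refine (((d2.pow 2).add (((d1.pow 2).inv (pow_ne_zero 2 hgt)).const_mul
      ((1 + c ^ 2) * a ^ 2))).add ((d1.pow 2).const_mul C)).congr_deriv ?_
    rw [h t ht, hκ t ht]
    simp only [Pi.pow_apply]
    field_simp
    norm_num
    ring
  refine ⟨N s₀ / (2 * a), fun s hs => inv_pos.2 (hκ0 s hs), ?_, fun s hs => ?_, fun s hs => ?_⟩
  · exact (contDiffOn_const.mul (hg.pow 2)).congr hv
  · refine (hv2 s hs).congr_deriv ?_
    have hgs := (hg0 s hs).ne'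
    rw [h s hs, hv s hs, ← hconst s hs, hN, hκ s hs]
    field_simp
    ring
  · have hgs := (hg0 s hs).ne'
    rw [hv1 s hs, hv s hs, ← hconst s hs, hN]
    field_simp
    ring

/-- Converse to `exists_isRadiusSolution`. -/
theorem IsRadiusSolution.deriv_deriv {J : Set ℝ} {κ g : ℝ → ℝ} {a c C e : ℝ}
    (hv : IsRadiusSolution C c e J (fun s => (κ s)⁻¹)) (hJ : IsOpen J) (ha : 0 < a)
    (hg : ContDiffOn ℝ ∞ g J) (hg0 : ∀ s ∈ J, 0 < g s) (hκ0 : ∀ s ∈ J, 0 < κ s)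
    (hgκ : ∀ s ∈ J, g s ^ 2 * κ s = a) {s : ℝ} (hs : s ∈ J) :
    deriv (deriv g) s = g s * (κ s ^ 2 * (1 + c ^ 2) - C) := by
  have hgs := (hg0 s hs).ne'
  have hv' : ∀ s ∈ J, (κ s)⁻¹ = a⁻¹ * g s ^ 2 := fun s hs => by
    have := (hκ0 s hs).ne'
    rw [← hgκ s hs]
    have := (hg0 s hs).ne'
    field_simp
  have hκ : κ s = a * (g s ^ 2)⁻¹ := by
    rw [← hgκ s hs]
    field_simp
  obtain ⟨hv1, hv2⟩ := hasDerivAt_of_sq hJ hg hv'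
  have e1 := hv.deriv_sq s hs
  have e2 := (hv2 s hs).unique (hv.hasDerivAt_deriv s hs)
  rw [hv1 s hs] at e1
  rw [hv' s hs] at e1 e2
  rw [hκ]
  field_simp at e1 e2 ⊢
  -- The constant e enters both equations linearly and is eliminated between them.
  linear_combination (g s ^ 2 / 2) * e2 - (1 / 4) * e1

end

noncomputable section

open LocalMetric

variable {E : Type*} [NormedAddCommGroup E] [NormedSpace ℝ E] [FiniteDimensional ℝ E]
  {M : Type*} [TopologicalSpace M] [ChartedSpace E M] [IsManifold 𝓘(ℝ, E) ∞ M]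
  {J : Set ℝ} {γ : ℝ → M} {s t : ℝ} {w : ℝ → ℝ} {C : ℝ}
  [RiemannianBundle (fun x : M => TangentSpace 𝓘(ℝ, E) x)]
  [IsContMDiffRiemannianBundle 𝓘(ℝ, E) ∞ E (fun x : M => TangentSpace 𝓘(ℝ, E) x)]

/-! ### Solutions of the Euler-Lagrange equation -/

/-- The tangential part of the Euler-Lagrange equation. -/
theorem deriv_norm_sq_of_eulerLagrange (hγ : SmoothCurve E J γ)
    (hunit : ∀ s ∈ J, ‖velocity 𝓘(ℝ, E) γ s‖ = 1) (hw : ContDiffOn ℝ ∞ w J)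
    (hEL : ∀ s ∈ J, eulerLagrange E C γ w s = 0) (hs : s ∈ J) :
    ∃ p : ℝ, HasDerivAt (fun t => (w t * ‖tension 𝓘(ℝ, E) γ t‖) ^ 2) (2 * p) s ∧
      deriv w s * (w s * ‖tension 𝓘(ℝ, E) γ s‖) ^ 2 = 3 * w s * p := by
  have hT := smoothAlong_velocity hγ
  have hW := (smoothAlong_tension hγ).smul hγ hw
  have hDW := hW.covDeriv hγ
  have hnorm : ∀ t, (w t * ‖tension 𝓘(ℝ, E) γ t‖) ^ 2
      = inner ℝ (w t • tension 𝓘(ℝ, E) γ t) (w t • tension 𝓘(ℝ, E) γ t) := fun t => by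
    rw [real_inner_smul_left, real_inner_smul_right, real_inner_self_eq_norm_sq]
    ring
  have hWT : ∀ t ∈ J, (inner ℝ (w t • tension 𝓘(ℝ, E) γ t) (velocity 𝓘(ℝ, E) γ t) : ℝ) = 0 :=
    fun t ht => by
      rw [real_inner_smul_left, real_inner_comm, inner_velocity_tension hγ hunit ht, mul_zero]
  -- With W = wτ ⊥ T one has ⟨∇W, T⟩ = -⟨W, τ⟩. Multiplied by w this is -|W|², which is smooth even
  -- where τ vanishes, so no Frenet frame is involved.
  have hl : ∀ t ∈ J, w t * (inner ℝ (covDerivAlong 𝓘(ℝ, E) γ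
      (fun s => w s • tension 𝓘(ℝ, E) γ s) t) (velocity 𝓘(ℝ, E) γ t) : ℝ)
        = -(w t * ‖tension 𝓘(ℝ, E) γ t‖) ^ 2 := fun t ht => by
    rw [hW.inner_covDeriv_of_inner_eq hT hγ hWT ht]
    change w t * -inner ℝ _ (tension 𝓘(ℝ, E) γ t) = _
    rw [real_inner_smul_left, real_inner_self_eq_norm_sq]
    ring
  set p : ℝ := inner ℝ (covDerivAlong 𝓘(ℝ, E) γ (fun s => w s • tension 𝓘(ℝ, E) γ s) s)
    (w s • tension 𝓘(ℝ, E) γ s) with hp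
  have hq : HasDerivAt (fun t => (w t * ‖tension 𝓘(ℝ, E) γ t‖) ^ 2) (2 * p) s := by
    simp only [hnorm]
    refine (hW.hasDerivAt_inner hW hγ hs).congr_deriv ?_
    rw [hp, two_mul]
    exact congrArg (_ + ·) (real_inner_comm _ _)
  refine ⟨p, hq, ?_⟩
  have hw' := hasDerivAt_deriv_of_contDiffOn hw hγ.isOpen hs
  -- Differentiating `hl` gives w'⟨∇W,T⟩ + w⟨∇∇W,T⟩ + w⟨∇W,τ⟩ = -2p. The second term is zero by the
  -- equation, as W ⊥ T, and the third equals p.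
  have h1 := hw'.mul (hDW.hasDerivAt_inner hT hγ hs)
  have h2 := h1.unique (hq.neg.congr_of_eventuallyEq (by
    filter_upwards [hγ.isOpen.mem_nhds hs] with t ht using hl t ht))
  have hDD : (inner ℝ (covDerivAlong 𝓘(ℝ, E) γ (covDerivAlong 𝓘(ℝ, E) γ
      (fun s => w s • tension 𝓘(ℝ, E) γ s)) s) (velocity 𝓘(ℝ, E) γ s) : ℝ) = 0 := by
    have h := hEL s hs
    rw [eulerLagrange, add_eq_zero_iff_eq_neg] at h
    rw [h, inner_neg_left, real_inner_smul_left, hWT s hs, mul_zero, neg_zero]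
  have hDτ : w s * (inner ℝ (covDerivAlong 𝓘(ℝ, E) γ (fun s => w s • tension 𝓘(ℝ, E) γ s) s)
      (covDerivAlong 𝓘(ℝ, E) γ (velocity 𝓘(ℝ, E) γ) s) : ℝ) = p := by
    rw [hp, real_inner_smul_right]
    rfl
  rw [hDD, zero_add, hDτ] at h2
  have h3 := hl s hs
  have h4 : deriv w s * -(w s * ‖tension 𝓘(ℝ, E) γ s‖) ^ 2 = w s * (-(2 * p) - p) := by
    rw [← h3]
    linear_combination (w s) * h2
  linarith

/-- For a constant weight the relation w'|W|² = 3wp forces p = 0, so |W| is constant. This is the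
biharmonic case. -/
theorem norm_tension_eq_of_eulerLagrange_const {a : ℝ} (ha : 0 < a) (hγ : SmoothCurve E J γ)
    (hconn : J.OrdConnected) (hunit : ∀ s ∈ J, ‖velocity 𝓘(ℝ, E) γ s‖ = 1)
    (hEL : ∀ s ∈ J, eulerLagrange E C γ (fun _ => a) s = 0) (hs : s ∈ J) (ht : t ∈ J) :
    ‖tension 𝓘(ℝ, E) γ s‖ = ‖tension 𝓘(ℝ, E) γ t‖ := by
  have h : ∀ s ∈ J, HasDerivAt (fun t => (a * ‖tension 𝓘(ℝ, E) γ t‖) ^ 2) 0 s := fun s hs => by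
    obtain ⟨p, h1, h2⟩ := deriv_norm_sq_of_eulerLagrange hγ hunit contDiffOn_const
      hEL hs
    have : p = 0 := by simpa [ha.ne'] using h2
    simpa [this] using h1
  have := eq_of_hasDerivAt_zero hγ.isOpen hconn h hs ht
  have := (pow_left_inj₀ (mul_nonneg ha.le (norm_nonneg _)) (mul_nonneg ha.le (norm_nonneg _))
    two_ne_zero).1 this
  exact mul_left_cancel₀ ha.ne' this

/-- With q = |W|², the relations q' = 2p and w'q = 3wp make q³/w² constant, and q³/w² = (w²κ₁³)².
The square is used because q is differentiable also at zeros of τ. -/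
theorem exists_const_of_eulerLagrange (hγ : SmoothCurve E J γ)
    (hconn : J.OrdConnected) (hne : J.Nonempty) (hunit : ∀ s ∈ J, ‖velocity 𝓘(ℝ, E) γ s‖ = 1)
    (hw : ContDiffOn ℝ ∞ w J) (hw0 : ∀ s ∈ J, 0 < w s)
    (hEL : ∀ s ∈ J, eulerLagrange E C γ w s = 0) :
    ∃ a ≥ 0, ∀ s ∈ J, w s ^ 2 * ‖tension 𝓘(ℝ, E) γ s‖ ^ 3 = a := by
  obtain ⟨s₀, hs₀⟩ := hne
  have hpos : ∀ s ∈ J, 0 ≤ w s ^ 2 * ‖tension 𝓘(ℝ, E) γ s‖ ^ 3 := fun s _ => by positivity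
  refine ⟨_, hpos s₀ hs₀, fun s hs => ?_⟩
  refine (pow_left_inj₀ (hpos s hs) (hpos s₀ hs₀) two_ne_zero).1 ?_
  have h : ∀ s ∈ J, HasDerivAt (fun t => ((w t * ‖tension 𝓘(ℝ, E) γ t‖) ^ 2) ^ 3
      * (w t ^ 2)⁻¹) 0 s := fun s hs => by
    obtain ⟨p, h1, h2⟩ := deriv_norm_sq_of_eulerLagrange hγ hunit hw hEL hs
    have hws := (hw0 s hs).ne'
    refine ((h1.pow 3).mul (((hasDerivAt_deriv_of_contDiffOn hw hγ.isOpen hs).pow 2).inv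
      (pow_ne_zero 2 hws))).congr_deriv ?_
    simp only [Pi.pow_apply, Pi.inv_apply]
    field_simp
    norm_num
    linear_combination (-2 : ℝ) * w s ^ 3 * ‖tension 𝓘(ℝ, E) γ s‖ ^ 4 * h2
  have := eq_of_hasDerivAt_zero hγ.isOpen hconn h hs hs₀
  have e : ∀ t ∈ J, ((w t * ‖tension 𝓘(ℝ, E) γ t‖) ^ 2) ^ 3 * (w t ^ 2)⁻¹
      = (w t ^ 2 * ‖tension 𝓘(ℝ, E) γ t‖ ^ 3) ^ 2 := fun t ht => by
    have := (hw0 t ht).ne'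
    field_simp
  rwa [e s hs, e s₀ hs₀] at this

end

noncomputable section

open LocalMetric

/-- The real power is traded for the polynomial relation that the tangential equation produces. -/
theorem eq_mul_rpow_iff {w κ a : ℝ} (hw : 0 < w) (hκ : 0 < κ) (ha : 0 < a) :
    w = a * κ ^ (-3 / 2 : ℝ) ↔ w ^ 2 * κ ^ 3 = a ^ 2 := by
  have hy : 0 < κ ^ (-3 / 2 : ℝ) := Real.rpow_pos_of_pos hκ _
  have hy2 : (κ ^ (-3 / 2 : ℝ)) ^ 2 * κ ^ 3 = 1 := by
    rw [← Real.rpow_natCast, ← Real.rpow_mul hκ.le, ← Real.rpow_natCast κ 3, ← Real.rpow_add hκ]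
    norm_num
  constructor
  · rintro rfl
    linear_combination a ^ 2 * hy2
  · intro h
    refine (pow_left_inj₀ hw.le (mul_pos ha hy).le two_ne_zero).1 ?_
    refine mul_right_cancel₀ (pow_pos hκ 3).ne' ?_
    linear_combination h - a ^ 2 * hy2

variable {E : Type*} [NormedAddCommGroup E] [NormedSpace ℝ E] [FiniteDimensional ℝ E]
  {M : Type*} [TopologicalSpace M] [ChartedSpace E M] [IsManifold 𝓘(ℝ, E) ∞ M]
  {J : Set ℝ} {γ : ℝ → M} {s t : ℝ} {w : ℝ → ℝ} {C c₁ c e : ℝ}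
  [RiemannianBundle (fun x : M => TangentSpace 𝓘(ℝ, E) x)]
  [IsContMDiffRiemannianBundle 𝓘(ℝ, E) ∞ E (fun x : M => TangentSpace 𝓘(ℝ, E) x)]

variable (E) in
/-- The Frenet equations of the solutions of the Euler-Lagrange equation. -/
structure IsFrenetSolution (C c₁ c e : ℝ) (J : Set ℝ) (γ : ℝ → M) (w : ℝ → ℝ) : Prop where
  pos : ∀ s ∈ J, 0 < ‖tension 𝓘(ℝ, E) γ s‖
  weight : ∀ s ∈ J, w s = c₁ * ‖tension 𝓘(ℝ, E) γ s‖ ^ (-3 / 2 : ℝ)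
  norm_scaledBinormal : ∀ s ∈ J, ‖scaledBinormal E γ s‖ = c * ‖tension 𝓘(ℝ, E) γ s‖
  covDeriv_scaledBinormal : ∀ s ∈ J, covDerivAlong 𝓘(ℝ, E) γ (scaledBinormal E γ) s
    = (deriv (fun s => ‖tension 𝓘(ℝ, E) γ s‖) s / ‖tension 𝓘(ℝ, E) γ s‖) • scaledBinormal E γ s
      - (c * ‖tension 𝓘(ℝ, E) γ s‖) ^ 2 • principalNormal E γ s
  radius : IsRadiusSolution C c e J (fun s => ‖tension 𝓘(ℝ, E) γ s‖⁻¹)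

/-- Times g, the left side is the derivative of g²κ. It is the tangential coefficient in
`eulerLagrange_eq`. -/
theorem deriv_eq_of_sq_mul_eq {κ g : ℝ → ℝ} {a : ℝ} (hJ : IsOpen J) (hg : ContDiffOn ℝ ∞ g J)
    (hκ : ContDiffOn ℝ ∞ κ J) (hg0 : ∀ s ∈ J, 0 < g s) (h : ∀ s ∈ J, g s ^ 2 * κ s = a)
    (hs : s ∈ J) : 2 * deriv g s * κ s + g s * deriv κ s = 0 := by
  have h1 := ((hasDerivAt_deriv_of_contDiffOn hg hJ hs).pow 2).mul
    (hasDerivAt_deriv_of_contDiffOn hκ hJ hs)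
  have h2 := h1.unique ((hasDerivAt_const s a).congr_of_eventuallyEq (by
    filter_upwards [hJ.mem_nhds hs] with t ht using h t ht))
  refine mul_left_cancel₀ (hg0 s hs).ne' ?_
  simp only [Pi.pow_apply] at h2
  norm_num at h2
  linear_combination h2

/-- The constant a = w²κ₁³ decides. If a = 0 the curve is a geodesic; if a > 0 then κ₁ has no zero
on J, the frame exists globally, and the equation can be paired with N and with B. -/
theorem exists_isFrenetSolution (hγ : SmoothCurve E J γ)
    (hconn : J.OrdConnected) (hne : J.Nonempty) (hunit : ∀ s ∈ J, ‖velocity 𝓘(ℝ, E) γ s‖ = 1)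
    (hw : ContDiffOn ℝ ∞ w J) (hw0 : ∀ s ∈ J, 0 < w s)
    (hEL : ∀ s ∈ J, eulerLagrange E C γ w s = 0) :
    (∀ s ∈ J, tension 𝓘(ℝ, E) γ s = 0) ∨
      ∃ c₁ > 0, ∃ c ≥ 0, ∃ e, IsFrenetSolution E C c₁ c e J γ w := by
  obtain ⟨a, ha0, ha⟩ := exists_const_of_eulerLagrange hγ hconn hne hunit hw hw0 hEL
  rcases ha0.eq_or_lt with rfl | ha0
  · refine Or.inl fun s hs => ?_
    have := ha s hs
    rwa [mul_eq_zero, or_iff_right (pow_ne_zero 2 (hw0 s hs).ne'), pow_eq_zero_iff three_ne_zero,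
      norm_eq_zero] at this
  refine Or.inr ?_
  have hκ : ∀ s ∈ J, 0 < ‖tension 𝓘(ℝ, E) γ s‖ := fun s hs => by
    refine (norm_nonneg _).lt_of_ne' fun h => ha0.ne' ?_
    rw [← ha s hs, h]
    ring
  have hk := contDiffOn_norm_tension hγ hκ
  set g : ℝ → ℝ := fun s => w s * ‖tension 𝓘(ℝ, E) γ s‖ with hgdef
  have hg : ContDiffOn ℝ ∞ g J := hw.mul hk
  have hg0 : ∀ s ∈ J, 0 < g s := fun s hs => mul_pos (hw0 s hs) (hκ s hs)
  have hga : ∀ s ∈ J, g s ^ 2 * ‖tension 𝓘(ℝ, E) γ s‖ = a := fun s hs => by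
    rw [← ha s hs, hgdef]; ring
  have hB := smoothAlong_scaledBinormal hγ hκ
  have hEL' : ∀ s ∈ J, g s • covDerivAlong 𝓘(ℝ, E) γ (scaledBinormal E γ) s
      + (2 * deriv g s) • scaledBinormal E γ s
      + (deriv (deriv g) s - g s * ‖tension 𝓘(ℝ, E) γ s‖ ^ 2 + C * g s) • principalNormal E γ s
      = 0 := fun s hs => by
    rw [← hEL s hs, eulerLagrange_eq C hγ hκ hg (fun _ _ => rfl) hs,
      deriv_eq_of_sq_mul_eq hγ.isOpen hg hk hg0 hga hs, zero_smul, sub_zero]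
  have hgdd : ∀ s ∈ J, deriv (deriv g) s - g s * ‖tension 𝓘(ℝ, E) γ s‖ ^ 2 + C * g s
      = g s * ‖scaledBinormal E γ s‖ ^ 2 := fun s hs => by
    have h := congrArg (fun v => (inner ℝ v (principalNormal E γ s) : ℝ)) (hEL' s hs)
    simp only [inner_add_left, real_inner_smul_left, inner_zero_left,
      inner_covDeriv_scaledBinormal_principalNormal hγ hunit hκ hs,
      inner_scaledBinormal_principalNormal hγ hunit hκ hs,
      inner_principalNormal_self (hκ s hs)] at h
    linarith
  obtain ⟨s₀, hs₀⟩ := hne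
  -- Pairing with B, which is orthogonal to N, shows that g⁴|B|² keeps this value. As g² = a/κ₁, it
  -- follows that |B| = (√b/a)κ₁, which is the witness for c.
  set b : ℝ := g s₀ ^ 4 * ‖scaledBinormal E γ s₀‖ ^ 2 with hb
  have hb0 : 0 ≤ b := by positivity
  have hgB : ∀ s ∈ J, g s ^ 4 * ‖scaledBinormal E γ s‖ ^ 2 = b := fun s hs => by
    refine eq_of_hasDerivAt_zero hγ.isOpen hconn
      (f := fun s => g s ^ 4 * ‖scaledBinormal E γ s‖ ^ 2) (fun t ht => ?_) hs hs₀
    have h := congrArg (fun v => (inner ℝ v (scaledBinormal E γ t) : ℝ)) (hEL' t ht)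
    simp only [inner_add_left, real_inner_smul_left, inner_zero_left] at h
    rw [real_inner_comm (scaledBinormal E γ t) (principalNormal E γ t),
      inner_scaledBinormal_principalNormal hγ hunit hκ ht] at h
    have h1 := hB.hasDerivAt_inner hB hγ ht
    have h2 := ((hasDerivAt_deriv_of_contDiffOn hg hγ.isOpen ht).pow 4).mul h1
    simp only [real_inner_self_eq_norm_sq] at h2 h
    refine h2.congr_deriv ?_
    rw [real_inner_comm (covDerivAlong 𝓘(ℝ, E) γ (scaledBinormal E γ) t)]
    simp only [Pi.pow_apply]
    norm_num
    linear_combination 2 * g t ^ 3 * h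
  have hc : ∀ s ∈ J, ‖scaledBinormal E γ s‖ = √b / a * ‖tension 𝓘(ℝ, E) γ s‖ := fun s hs => by
    refine (pow_left_inj₀ (norm_nonneg _) (by positivity) two_ne_zero).1 ?_
    have hgs := (hg0 s hs).ne'
    rw [mul_pow, div_pow, Real.sq_sqrt hb0, ← hga s hs, ← hgB s hs]
    have := (hκ s hs).ne'
    field_simp
  refine ⟨√a, Real.sqrt_pos.2 ha0, √b / a, by positivity, ?_⟩
  obtain ⟨e, he⟩ := exists_isRadiusSolution (c := √b / a) (C := C) hγ.isOpen hconn ⟨s₀, hs₀⟩ ha0 hg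
    hg0 hκ hga (fun s hs => by
      have h := hgdd s hs
      rw [hc s hs] at h
      linear_combination h)
  refine ⟨e, hκ, fun s hs => ?_, hc, fun s hs => ?_, he⟩
  · rw [eq_mul_rpow_iff (hw0 s hs) (hκ s hs) (Real.sqrt_pos.2 ha0), Real.sq_sqrt ha0.le, ha s hs]
  · have hgs := (hg0 s hs).ne'
    have h1 := hEL' s hs
    rw [hgdd s hs, hc s hs] at h1
    have h2 := deriv_eq_of_sq_mul_eq hγ.isOpen hg hk hg0 hga hs
    have h3 : deriv (fun s => ‖tension 𝓘(ℝ, E) γ s‖) s / ‖tension 𝓘(ℝ, E) γ s‖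
        = -((g s)⁻¹ * (2 * deriv g s)) := by
      have := (hκ s hs).ne'
      field_simp
      linear_combination h2
    have h4 := congrArg (fun v => (g s)⁻¹ • v) h1
    simp only [smul_add, smul_smul, smul_zero, ← mul_assoc, inv_mul_cancel₀ hgs, one_smul,
      one_mul] at h4
    rw [h3, ← sub_eq_zero, ← h4]
    module

/-- In `eulerLagrange_eq` the tangential coefficient vanishes because g²κ₁ = c₁² is constant. The
B-terms cancel because 2g'/g = -κ₁'/κ₁, and the N-terms because g'' = g(κ₁²(1+c²) - C). -/
theorem IsFrenetSolution.eulerLagrange_eq_zero (h : IsFrenetSolution E C c₁ c e J γ w)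
    (hγ : SmoothCurve E J γ) (hw : ContDiffOn ℝ ∞ w J) (hw0 : ∀ s ∈ J, 0 < w s) (hc₁ : 0 < c₁)
    (hs : s ∈ J) : eulerLagrange E C γ w s = 0 := by
  have hκ := h.pos
  have hk := contDiffOn_norm_tension hγ hκ
  set g : ℝ → ℝ := fun s => w s * ‖tension 𝓘(ℝ, E) γ s‖ with hgdef
  have hg : ContDiffOn ℝ ∞ g J := hw.mul hk
  have hg0 : ∀ s ∈ J, 0 < g s := fun s hs => mul_pos (hw0 s hs) (hκ s hs)
  have hga : ∀ s ∈ J, g s ^ 2 * ‖tension 𝓘(ℝ, E) γ s‖ = c₁ ^ 2 := fun s hs => by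
    rw [← (eq_mul_rpow_iff (hw0 s hs) (hκ s hs) hc₁).1 (h.weight s hs), hgdef]; ring
  have h2 := deriv_eq_of_sq_mul_eq hγ.isOpen hg hk hg0 hga hs
  have hκs := (hκ s hs).ne'
  have h3 : 2 * deriv g s
      = -(g s * (deriv (fun s => ‖tension 𝓘(ℝ, E) γ s‖) s / ‖tension 𝓘(ℝ, E) γ s‖)) := by
    field_simp
    linear_combination h2
  rw [eulerLagrange_eq C hγ hκ hg (fun _ _ => rfl) hs, h2, h3, h.covDeriv_scaledBinormal s hs,
    h.radius.deriv_deriv hγ.isOpen (pow_pos hc₁ 2) hg hg0 hκ hga hs]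
  module

end

/-! ### Explicit integration of the radius equation. -/

noncomputable section

/-! ### The solutions of the radius equation -/

namespace IsRadiusSolution

variable {C c e : ℝ} {J : Set ℝ} {v y : ℝ → ℝ}

theorem of_hasDerivAt {v₁ : ℝ → ℝ} (hpos : ∀ s, 0 < v s) (hsmooth : ContDiff ℝ ∞ v)
    (h1 : ∀ s, HasDerivAt v (v₁ s) s) (h2 : ∀ s, HasDerivAt v₁ (4 * e - 4 * C * v s) s)
    (h3 : ∀ s, v₁ s ^ 2 = 4 * (2 * e * v s - (1 + c ^ 2) - C * v s ^ 2)) :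
    IsRadiusSolution C c e univ v := by
  have : deriv v = v₁ := funext fun s => (h1 s).deriv
  exact ⟨fun s _ => hpos s, hsmooth.contDiffOn, fun s _ => this ▸ h2 s, fun s _ => this ▸ h3 s⟩

theorem congr {K : Set ℝ} {u : ℝ → ℝ} (h : IsRadiusSolution C c e K v) (hJ : IsOpen J)
    (hJK : J ⊆ K) (hu : ∀ s ∈ J, u s = v s) : IsRadiusSolution C c e J u := by
  have he : ∀ s ∈ J, u =ᶠ[𝓝 s] v := fun s hs => by
    filter_upwards [hJ.mem_nhds hs] with t ht using hu t ht
  refine ⟨fun s hs => hu s hs ▸ h.pos s (hJK hs), (h.smooth.mono hJK).congr hu, fun s hs => ?_,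
    fun s hs => ?_⟩
  · rw [hu s hs]
    exact (h.hasDerivAt_deriv s (hJK hs)).congr_of_eventuallyEq (he s hs).deriv
  · rw [hu s hs, (he s hs).deriv_eq]
    exact h.deriv_sq s (hJK hs)

/-- By the first integral the quantity is v'²/4 + 1 + c². It fixes the sign of e when C ≥ 0. -/
theorem const_pos (h : IsRadiusSolution C c e J v) {s : ℝ} (hs : s ∈ J) :
    0 < 2 * e * v s - C * v s ^ 2 := by
  have h1 := h.deriv_sq s hs
  nlinarith [sq_nonneg (deriv v s), sq_nonneg c]

/-- Constant solutions exist only if `C > 0`. -/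
theorem of_const (h : IsRadiusSolution C c e J v) (hJ : IsOpen J) (hne : J.Nonempty)
    (hv : ∀ s ∈ J, ∀ t ∈ J, v s = v t) : 0 < C ∧ e ^ 2 = C * (1 + c ^ 2) := by
  obtain ⟨s, hs⟩ := hne
  have hd : ∀ t ∈ J, deriv v t = 0 := fun t ht =>
    ((hasDerivAt_const t (v t)).congr_of_eventuallyEq (by
      filter_upwards [hJ.mem_nhds ht] with r hr using hv r hr t ht)).deriv
  have h2 := (h.hasDerivAt_deriv s hs).unique
    ((hasDerivAt_const s (0 : ℝ)).congr_of_eventuallyEq (by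
      filter_upwards [hJ.mem_nhds hs] with r hr using hd r hr))
  have h1 := h.deriv_sq s hs
  rw [hd s hs] at h1
  have he : e = C * v s := by linarith
  have hC : C * v s ^ 2 = 1 + c ^ 2 := by
    rw [he] at h1
    linear_combination (-1 / 4) * h1
  refine ⟨pos_of_mul_pos_left (b := v s ^ 2) (by rw [hC]; positivity) (sq_nonneg _), ?_⟩
  rw [he, ← hC]
  ring

theorem hasDerivAt (h : IsRadiusSolution C c e J v) (hJ : IsOpen J) {s : ℝ} (hs : s ∈ J) :
    HasDerivAt v (deriv v s) s := hasDerivAt_deriv_of_contDiffOn h.smooth hJ hs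

/-- v'' = 4e makes v' affine, and the first integral then yields v without a second integration. The
leading coefficient 2e of v must be C₃/4, whence C₃ = 8e. -/
theorem exists_isChi_zero (h : IsRadiusSolution 0 c e J v) (hJ : IsOpen J) (hconn : J.OrdConnected)
    (hne : J.Nonempty) : ∃ χ, IsChi c 0 χ ∧ ∀ s ∈ J, (v s)⁻¹ = χ s := by
  obtain ⟨s₀, hs₀⟩ := hne
  have he : 0 < e := by
    have h1 := h.const_pos hs₀
    have h2 := h.pos s₀ hs₀
    by_contra hn
    nlinarith
  have hlin : ∀ s ∈ J, deriv v s - 4 * e * s = deriv v s₀ - 4 * e * s₀ := fun s hs =>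
    eq_of_hasDerivAt_zero hJ hconn (f := fun s => deriv v s - 4 * e * s) (fun t ht =>
      ((h.hasDerivAt_deriv t ht).sub ((hasDerivAt_id t).const_mul (4 * e))).congr_deriv (by ring))
      hs hs₀
  refine ⟨_, Or.inr (Or.inl ⟨rfl, 8 * e, by positivity, (deriv v s₀ - 4 * e * s₀) / (4 * e), rfl⟩),
    fun s hs => ?_⟩
  have h1 := h.deriv_sq s hs
  have h2 : deriv v s = 4 * e * (s + (deriv v s₀ - 4 * e * s₀) / (4 * e)) := by
    field_simp
    linarith [hlin s hs]
  have h3 : v s = (16 * (1 + c ^ 2)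
      + (8 * e) ^ 2 * (s + (deriv v s₀ - 4 * e * s₀) / (4 * e)) ^ 2) / (4 * (8 * e)) := by
    rw [eq_div_iff (by positivity)]
    rw [h2] at h1
    linear_combination -4 * h1
  rw [h3, inv_div]

/-- u = v - e/C solves u'' = 4a²u with a = √(-C). P and Q are its coefficients on the two
exponentials, recovered from v and v', hence constant. The first integral becomes 4PQ + (1+c²)/C =
(e/C)², so the root in χ is |e/C| and σ is the sign of e/C. -/
theorem exists_isChi_neg (h : IsRadiusSolution C c e J v) (hJ : IsOpen J) (hconn : J.OrdConnected)
    (hne : J.Nonempty) (hC : C < 0) : ∃ χ, IsChi c C χ ∧ ∀ s ∈ J, (v s)⁻¹ = χ s := by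
  obtain ⟨s₀, hs₀⟩ := hne
  set a := √(-C) with ha
  have ha0 : 0 < a := Real.sqrt_pos.2 (by linarith)
  have haC : C = -a ^ 2 := by rw [ha, Real.sq_sqrt (by linarith)]; ring
  set P : ℝ → ℝ := fun s => (v s - e / C + deriv v s / (2 * a)) / 2 * Real.exp (-(2 * a * s)) with hP
  set Q : ℝ → ℝ := fun s => (v s - e / C - deriv v s / (2 * a)) / 2 * Real.exp (2 * a * s) with hQ
  have hexp : ∀ s, Real.exp (2 * a * s) * Real.exp (-(2 * a * s)) = 1 := fun s => by
    rw [← Real.exp_add, add_neg_cancel, Real.exp_zero]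
  have hlin : ∀ s, HasDerivAt (fun s : ℝ => 2 * a * s) (2 * a) s := fun s => by
    simpa using (hasDerivAt_id s).const_mul (2 * a)
  have hPc : ∀ s ∈ J, P s = P s₀ := fun s hs => by
    refine eq_of_hasDerivAt_zero hJ hconn (fun t ht => ?_) hs hs₀
    refine (((((h.hasDerivAt hJ ht).sub_const (e / C)).add
      ((h.hasDerivAt_deriv t ht).div_const (2 * a))).div_const 2).mul
        ((hlin t).neg.exp)).congr_deriv ?_
    simp only [Pi.add_apply]
    rw [haC]
    field_simp
    ring
  have hQc : ∀ s ∈ J, Q s = Q s₀ := fun s hs => by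
    refine eq_of_hasDerivAt_zero hJ hconn (fun t ht => ?_) hs hs₀
    refine (((((h.hasDerivAt hJ ht).sub_const (e / C)).sub
      ((h.hasDerivAt_deriv t ht).div_const (2 * a))).div_const 2).mul
        ((hlin t).exp)).congr_deriv ?_
    simp only [Pi.sub_apply]
    rw [haC]
    field_simp
    ring
  have hv : ∀ s ∈ J, v s = P s₀ * Real.exp (2 * a * s) + Q s₀ * Real.exp (-(2 * a * s)) + e / C :=
    fun s hs => by
      rw [← hPc s hs, ← hQc s hs, hP, hQ]
      linear_combination (-(v s - e / C)) * hexp s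
  have hPQ : 4 * P s₀ * Q s₀ + (1 + c ^ 2) / C = (e / C) ^ 2 := by
    have h1 := h.deriv_sq s₀ hs₀
    have h2 : 4 * P s₀ * Q s₀ = (v s₀ - e / C) ^ 2 - deriv v s₀ ^ 2 / (4 * a ^ 2) := by
      have h3 : 4 * P s₀ * Q s₀ = ((v s₀ - e / C) ^ 2 - deriv v s₀ ^ 2 / (4 * a ^ 2))
        * (Real.exp (2 * a * s₀) * Real.exp (-(2 * a * s₀))) := by
        rw [hP, hQ]; ring
      rw [h3, hexp, mul_one]
    rw [h2, h1, haC]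
    field_simp
    ring
  have hneg : (1 + c ^ 2) / C < 0 := div_neg_of_pos_of_neg (by positivity) hC
  have hprod : 0 < P s₀ * Q s₀ := by nlinarith [sq_nonneg (e / C)]
  -- If both were negative, the sum of the two exponential terms would be negative with square at
  -- least 4PQ > (e/C)², and v would be negative.
  have hpos : 0 < P s₀ ∧ 0 < Q s₀ := by
    rcases pos_and_pos_or_neg_and_neg_of_mul_pos hprod with h1 | ⟨h1, h2⟩
    · exact h1
    · exfalso
      have hv0 := hv s₀ hs₀
      have hvp := h.pos s₀ hs₀
      have hX : P s₀ * Real.exp (2 * a * s₀) < 0 := mul_neg_of_neg_of_pos h1 (Real.exp_pos _)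
      have hY : Q s₀ * Real.exp (-(2 * a * s₀)) < 0 := mul_neg_of_neg_of_pos h2 (Real.exp_pos _)
      have hXY : P s₀ * Real.exp (2 * a * s₀) * (Q s₀ * Real.exp (-(2 * a * s₀)))
          = P s₀ * Q s₀ := by linear_combination P s₀ * Q s₀ * hexp s₀
      have : (e / C) ^ 2 < (P s₀ * Real.exp (2 * a * s₀)
          + Q s₀ * Real.exp (-(2 * a * s₀))) ^ 2 := by
        nlinarith [sq_nonneg (P s₀ * Real.exp (2 * a * s₀) - Q s₀ * Real.exp (-(2 * a * s₀)))]
      nlinarith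
  obtain ⟨σ, hσ, hσe⟩ : ∃ σ : ℝ, (σ = 1 ∨ σ = -1) ∧ σ * |e / C| = e / C := by
    rcases le_total 0 (e / C) with h0 | h0
    · exact ⟨1, Or.inl rfl, by rw [abs_of_nonneg h0, one_mul]⟩
    · exact ⟨-1, Or.inr rfl, by rw [abs_of_nonpos h0]; ring⟩
  refine ⟨_, Or.inl ⟨hC, P s₀, hpos.1, Q s₀, hpos.2, σ, hσ, by rw [hPQ]; positivity, rfl⟩,
    fun s hs => ?_⟩
  rw [hPQ, Real.sqrt_sq_eq_abs, hσe, hv s hs, one_div]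

/-- Here P and Q are the coefficients of v - e/C on cosine and sine. Positivity of v forces e > 0,
so e/C is the positive root and no sign choice occurs. Nonconstancy excludes P = Q = 0. -/
theorem exists_isChi_pos (h : IsRadiusSolution C c e J v) (hJ : IsOpen J) (hconn : J.OrdConnected)
    (hne : J.Nonempty) (hC : 0 < C) (hv : ∃ s ∈ J, ∃ t ∈ J, v s ≠ v t) :
    ∃ χ, IsChi c C χ ∧ ∀ s ∈ J, (v s)⁻¹ = χ s := by
  obtain ⟨s₀, hs₀⟩ := hne
  set a := √C with ha
  have ha0 : 0 < a := Real.sqrt_pos.2 hC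
  have haC : C = a ^ 2 := by rw [ha, Real.sq_sqrt hC.le]
  have he : 0 < e := by
    have h1 := h.const_pos hs₀
    have h2 := h.pos s₀ hs₀
    by_contra hn
    nlinarith [mul_pos hC (pow_pos h2 2)]
  set P : ℝ → ℝ := fun s => (v s - e / C) * Real.cos (2 * a * s)
    - deriv v s / (2 * a) * Real.sin (2 * a * s) with hP
  set Q : ℝ → ℝ := fun s => (v s - e / C) * Real.sin (2 * a * s)
    + deriv v s / (2 * a) * Real.cos (2 * a * s) with hQ
  have hlin : ∀ s, HasDerivAt (fun s : ℝ => 2 * a * s) (2 * a) s := fun s => by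
    simpa using (hasDerivAt_id s).const_mul (2 * a)
  have hPc : ∀ s ∈ J, P s = P s₀ := fun s hs => by
    refine eq_of_hasDerivAt_zero hJ hconn (fun t ht => ?_) hs hs₀
    refine ((((h.hasDerivAt hJ ht).sub_const (e / C)).mul (hlin t).cos).sub
      (((h.hasDerivAt_deriv t ht).div_const (2 * a)).mul (hlin t).sin)).congr_deriv ?_
    rw [haC]
    field_simp
    ring
  have hQc : ∀ s ∈ J, Q s = Q s₀ := fun s hs => by
    refine eq_of_hasDerivAt_zero hJ hconn (fun t ht => ?_) hs hs₀
    refine ((((h.hasDerivAt hJ ht).sub_const (e / C)).mul (hlin t).sin).add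
      (((h.hasDerivAt_deriv t ht).div_const (2 * a)).mul (hlin t).cos)).congr_deriv ?_
    rw [haC]
    field_simp
    ring
  have hvs : ∀ s ∈ J, v s = P s₀ * Real.cos (2 * a * s) + Q s₀ * Real.sin (2 * a * s) + e / C :=
    fun s hs => by
      rw [← hPc s hs, ← hQc s hs, hP, hQ]
      linear_combination (-(v s - e / C)) * Real.sin_sq_add_cos_sq (2 * a * s)
  have hPQ : (1 + c ^ 2) / C + (P s₀ ^ 2 + Q s₀ ^ 2) = (e / C) ^ 2 := by
    have h1 := h.deriv_sq s₀ hs₀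
    have h2 : P s₀ ^ 2 + Q s₀ ^ 2 = (v s₀ - e / C) ^ 2 + deriv v s₀ ^ 2 / (4 * a ^ 2) := by
      rw [hP, hQ]
      linear_combination ((v s₀ - e / C) ^ 2 + deriv v s₀ ^ 2 / (4 * a ^ 2))
        * Real.sin_sq_add_cos_sq (2 * a * s₀)
    rw [h2, h1, haC]
    field_simp
    ring
  refine ⟨_, Or.inr (Or.inr ⟨hC, P s₀, Q s₀, fun h0 => ?_, rfl⟩), fun s hs => ?_⟩
  · obtain ⟨s, hs, t, ht, hst⟩ := hv
    have hP0 : P s₀ = 0 := by nlinarith [sq_nonneg (P s₀), sq_nonneg (Q s₀)]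
    have hQ0 : Q s₀ = 0 := by nlinarith [sq_nonneg (P s₀), sq_nonneg (Q s₀)]
    exact hst (by rw [hvs s hs, hvs t ht, hP0, hQ0]; ring)
  · rw [hPQ, Real.sqrt_sq (by positivity), hvs s hs, one_div]

theorem exists_isChi (h : IsRadiusSolution C c e J v) (hJ : IsOpen J) (hconn : J.OrdConnected)
    (hne : J.Nonempty) (hv : ∃ s ∈ J, ∃ t ∈ J, v s ≠ v t) :
    ∃ χ, IsChi c C χ ∧ ∀ s ∈ J, (v s)⁻¹ = χ s := by
  rcases lt_trichotomy C 0 with hC | rfl | hC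
  · exact h.exists_isChi_neg hJ hconn hne hC
  · exact h.exists_isChi_zero hJ hconn hne
  · exact h.exists_isChi_pos hJ hconn hne hC hv

end IsRadiusSolution

/-- The functions `χ` are the inverses of the solutions of the radius equation. -/
theorem IsChi.exists_isRadiusSolution {c C : ℝ} {χ : ℝ → ℝ} (h : IsChi c C χ) :
    ∃ e, IsRadiusSolution C c e univ (fun s => (χ s)⁻¹) ∧ (0 < C → e ^ 2 ≠ C * (1 + c ^ 2)) := by
  have hlin : ∀ a s : ℝ, HasDerivAt (fun s : ℝ => 2 * a * s) (2 * a) s := fun a s => by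
    simpa using (hasDerivAt_id s).const_mul (2 * a)
  rcases h with ⟨hC, C₁, h1, C₂, h2, σ, hσ, hr, rfl⟩ | ⟨rfl, C₃, h3, C₄, rfl⟩ |
    ⟨hC, C₄, C₅, h45, rfl⟩
  · set a := √(-C) with ha
    have ha0 : 0 < a := Real.sqrt_pos.2 (by linarith)
    have haC : C = -a ^ 2 := by rw [ha, Real.sq_sqrt (by linarith)]; ring
    set R := √(4 * C₁ * C₂ + (1 + c ^ 2) / C) with hR
    have hR2 : (σ * R) ^ 2 = 4 * C₁ * C₂ + (1 + c ^ 2) / C := by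
      rw [mul_pow, hR, Real.sq_sqrt hr]
      rcases hσ with rfl | rfl <;> ring
    have hneg : (1 + c ^ 2) / C < 0 := div_neg_of_pos_of_neg (by positivity) hC
    have hexp : ∀ s, Real.exp (2 * a * s) * Real.exp (-(2 * a * s)) = 1 := fun s => by
      rw [← Real.exp_add, add_neg_cancel, Real.exp_zero]
    -- The constant term σR of 1/χ must be the rest point e/C of v'' = 4e - 4Cv.
    refine ⟨C * (σ * R), ?_, fun h => absurd h hC.not_gt⟩
    simp only [one_div, inv_inv]
    refine IsRadiusSolution.of_hasDerivAt (v₁ := fun s => 2 * a * (C₁ * Real.exp (2 * a * s)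
      - C₂ * Real.exp (-(2 * a * s)))) (fun s => ?_) (by fun_prop) (fun s => ?_) (fun s => ?_)
      (fun s => ?_)
    · have hX : 0 < C₁ * Real.exp (2 * a * s) := by positivity
      have hY : 0 < C₂ * Real.exp (-(2 * a * s)) := by positivity
      have hXY : C₁ * Real.exp (2 * a * s) * (C₂ * Real.exp (-(2 * a * s))) = C₁ * C₂ := by
        linear_combination C₁ * C₂ * hexp s
      -- With X, Y the exponential terms, (σR)² < 4XY ≤ (X+Y)², so the denominator stays positive
      -- for either sign.
      have : (σ * R) ^ 2 < (C₁ * Real.exp (2 * a * s) + C₂ * Real.exp (-(2 * a * s))) ^ 2 := by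
        nlinarith [sq_nonneg (C₁ * Real.exp (2 * a * s) - C₂ * Real.exp (-(2 * a * s)))]
      linarith [neg_abs_le (σ * R), (sq_lt_sq.1 this).trans_eq (abs_of_pos (add_pos hX hY))]
    · refine ((((hlin a s).exp.const_mul C₁).add ((hlin a s).neg.exp.const_mul C₂)).add_const
        (σ * R)).congr_deriv ?_
      simp only [Pi.neg_apply]
      ring
    · refine ((((hlin a s).exp.const_mul C₁).sub ((hlin a s).neg.exp.const_mul C₂)).const_mul
        (2 * a)).congr_deriv ?_
      simp only [Pi.neg_apply]
      rw [haC]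
      ring
    · have hc : 1 + c ^ 2 = C * ((σ * R) ^ 2 - 4 * C₁ * C₂) := by
        rw [hR2]; field_simp [hC.ne]; ring
      rw [hc, haC]
      linear_combination (-16 * a ^ 2 * C₁ * C₂) * hexp s
  -- Here (1/χ)'' = C₃/2, which has to be 4e.
  · refine ⟨C₃ / 8, ?_, fun h => absurd h (lt_irrefl _)⟩
    simp only [inv_div]
    refine IsRadiusSolution.of_hasDerivAt (v₁ := fun s => C₃ * (s + C₄) / 2) (fun s => ?_)
      (by fun_prop) (fun s => ?_) (fun s => ?_) (fun s => ?_)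
    · positivity
    · refine ((((((hasDerivAt_id s).add_const C₄).pow 2).const_mul (C₃ ^ 2)).const_add
        (16 * (1 + c ^ 2))).div_const (4 * C₃)).congr_deriv ?_
      simp only [id]
      field_simp
      norm_num
      ring
    · refine ((((hasDerivAt_id s).add_const C₄).const_mul C₃).div_const 2).congr_deriv ?_
      ring
    · field_simp
      ring
  · set a := √C with ha
    have ha0 : 0 < a := Real.sqrt_pos.2 hC
    have haC : C = a ^ 2 := by rw [ha, Real.sq_sqrt hC.le]
    have hp : 0 < (1 + c ^ 2) / C := by positivity
    set R := √((1 + c ^ 2) / C + (C₄ ^ 2 + C₅ ^ 2)) with hR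
    have hR0 : 0 ≤ R := Real.sqrt_nonneg _
    have hR2 : R ^ 2 = (1 + c ^ 2) / C + (C₄ ^ 2 + C₅ ^ 2) := Real.sq_sqrt (by positivity)
    have hc : 1 + c ^ 2 = C * (R ^ 2 - (C₄ ^ 2 + C₅ ^ 2)) := by
      rw [hR2]; field_simp [hC.ne']; ring
    -- With e = CR one has e² - C(1+c²) = C²(C₄² + C₅²), which is nonzero since C₄² + C₅² ≠ 0.
    refine ⟨C * R, ?_, fun _ h0 => h45 ?_⟩
    · simp only [one_div, inv_inv]
      refine IsRadiusSolution.of_hasDerivAt (v₁ := fun s => 2 * a * (C₅ * Real.cos (2 * a * s)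
        - C₄ * Real.sin (2 * a * s))) (fun s => ?_) (by fun_prop) (fun s => ?_) (fun s => ?_)
        (fun s => ?_)
      · have : (C₄ * Real.cos (2 * a * s) + C₅ * Real.sin (2 * a * s)) ^ 2 < R ^ 2 := by
          have h1 := Real.sin_sq_add_cos_sq (2 * a * s)
          have h2 : (C₄ * Real.cos (2 * a * s) + C₅ * Real.sin (2 * a * s)) ^ 2
              = C₄ ^ 2 + C₅ ^ 2 - (C₅ * Real.cos (2 * a * s) - C₄ * Real.sin (2 * a * s)) ^ 2 := by
            linear_combination (C₄ ^ 2 + C₅ ^ 2) * h1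
          rw [h2, hR2]
          nlinarith [sq_nonneg (C₅ * Real.cos (2 * a * s) - C₄ * Real.sin (2 * a * s))]
        linarith [neg_abs_le (C₄ * Real.cos (2 * a * s) + C₅ * Real.sin (2 * a * s)),
          abs_lt_of_sq_lt_sq this hR0]
      · refine ((((hlin a s).cos.const_mul C₄).add ((hlin a s).sin.const_mul C₅)).add_const
          R).congr_deriv ?_
        ring
      · refine ((((hlin a s).cos.const_mul C₅).sub ((hlin a s).sin.const_mul C₄)).const_mul
          (2 * a)).congr_deriv ?_
        rw [haC]
        ring
      · rw [hc, haC]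
        linear_combination 4 * a ^ 2 * (C₄ ^ 2 + C₅ ^ 2) * Real.sin_sq_add_cos_sq (2 * a * s)
    · rw [hc] at h0
      have : C ^ 2 * (C₄ ^ 2 + C₅ ^ 2) = 0 := by linear_combination h0
      exact (mul_eq_zero.1 this).resolve_left (by positivity)

end

/-! ### Frenet curvatures and the final equivalence. -/

noncomputable section

open LocalMetric

variable {E : Type*} [NormedAddCommGroup E] [NormedSpace ℝ E] [FiniteDimensional ℝ E]
  {M : Type*} [TopologicalSpace M] [ChartedSpace E M] [IsManifold 𝓘(ℝ, E) ∞ M]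
  {J : Set ℝ} {γ : ℝ → M} {s : ℝ} {f : ℝ → ℝ} {C c : ℝ}
  [RiemannianBundle (fun x : M => TangentSpace 𝓘(ℝ, E) x)]
  [IsContMDiffRiemannianBundle 𝓘(ℝ, E) ∞ E (fun x : M => TangentSpace 𝓘(ℝ, E) x)]

/-! ### The Frenet curvatures -/

theorem frenetData_one (γ : ℝ → M) : frenetData 𝓘(ℝ, E) γ 1
    = (fun s => ‖tension 𝓘(ℝ, E) γ s‖, velocity 𝓘(ℝ, E) γ, principalNormal E γ) := by
  simp only [frenetData, zero_smul, add_zero]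
  rfl

theorem frenetData_two (γ : ℝ → M) : frenetData 𝓘(ℝ, E) γ 2
    = (fun s => ‖scaledBinormal E γ s‖, principalNormal E γ,
      fun s => ‖scaledBinormal E γ s‖⁻¹ • scaledBinormal E γ s) := by
  rw [frenetData, frenetData_one]
  rfl

theorem frenetCurvature_one (γ : ℝ → M) (s : ℝ) :
    frenetCurvature 𝓘(ℝ, E) γ 1 s = ‖tension 𝓘(ℝ, E) γ s‖ := by
  rw [frenetCurvature, frenetData_one]

theorem frenetCurvature_two (γ : ℝ → M) (s : ℝ) :
    frenetCurvature 𝓘(ℝ, E) γ 2 s = ‖scaledBinormal E γ s‖ := by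
  rw [frenetCurvature, frenetData_two]

theorem frenetCurvature_three (γ : ℝ → M) (s : ℝ) : frenetCurvature 𝓘(ℝ, E) γ 3 s
    = ‖covDerivAlong 𝓘(ℝ, E) γ (fun s => ‖scaledBinormal E γ s‖⁻¹ • scaledBinormal E γ s) s
      + ‖scaledBinormal E γ s‖ • principalNormal E γ s‖ := by
  rw [frenetCurvature, frenetData, frenetData_two]

/-- F₃ = B/(cκ₁), so ∇_T F₃ + κ₂F₂ is (cκ₁)⁻¹ times the difference of the two sides of the equation
for ∇_T B. The factor κ₁'/κ₁ comes from differentiating (cκ₁)⁻¹. -/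
theorem frenetCurvature_three_eq_zero_iff (hγ : SmoothCurve E J γ)
    (hκ : ∀ s ∈ J, 0 < ‖tension 𝓘(ℝ, E) γ s‖) (hc : 0 < c)
    (hB : ∀ s ∈ J, ‖scaledBinormal E γ s‖ = c * ‖tension 𝓘(ℝ, E) γ s‖) (hs : s ∈ J) :
    frenetCurvature 𝓘(ℝ, E) γ 3 s = 0 ↔ covDerivAlong 𝓘(ℝ, E) γ (scaledBinormal E γ) s
      = (deriv (fun s => ‖tension 𝓘(ℝ, E) γ s‖) s / ‖tension 𝓘(ℝ, E) γ s‖) • scaledBinormal E γ s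
        - (c * ‖tension 𝓘(ℝ, E) γ s‖) ^ 2 • principalNormal E γ s := by
  have hk := contDiffOn_norm_tension hγ hκ
  have hBs := smoothAlong_scaledBinormal hγ hκ
  have h0 : ∀ s ∈ J, c * ‖tension 𝓘(ℝ, E) γ s‖ ≠ 0 := fun s hs => (mul_pos hc (hκ s hs)).ne'
  set h : ℝ → ℝ := fun s => (c * ‖tension 𝓘(ℝ, E) γ s‖)⁻¹ with hh
  have hsm : ContDiffOn ℝ ∞ h J := (contDiffOn_const.mul hk).inv h0
  have hd : deriv h s
      = -(h s * (deriv (fun s => ‖tension 𝓘(ℝ, E) γ s‖) s / ‖tension 𝓘(ℝ, E) γ s‖)) := by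
    have h1 := ((hasDerivAt_deriv_of_contDiffOn hk hγ.isOpen hs).const_mul c).inv (h0 s hs)
    refine (HasDerivAt.deriv h1).trans ?_
    have := (hκ s hs).ne'
    simp only [hh]
    field_simp
  have hX : covDerivAlong 𝓘(ℝ, E) γ (fun s => ‖scaledBinormal E γ s‖⁻¹ • scaledBinormal E γ s) s
      + ‖scaledBinormal E γ s‖ • principalNormal E γ s
      = h s • (covDerivAlong 𝓘(ℝ, E) γ (scaledBinormal E γ) s
        - ((deriv (fun s => ‖tension 𝓘(ℝ, E) γ s‖) s / ‖tension 𝓘(ℝ, E) γ s‖) • scaledBinormal E γ s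
        - (c * ‖tension 𝓘(ℝ, E) γ s‖) ^ 2 • principalNormal E γ s)) := by
    have e : c * ‖tension 𝓘(ℝ, E) γ s‖ = h s * (c * ‖tension 𝓘(ℝ, E) γ s‖) ^ 2 := by
      have := h0 s hs
      simp only [hh]
      field_simp
    rw [(hBs.smul hγ hsm).covDeriv_congr hγ (fun t ht => by rw [hB t ht]) hs,
      hBs.covDeriv_smul hγ hsm hs, hB s hs, hd]
    conv_lhs => rw [e]
    module
  rw [frenetCurvature_three, norm_eq_zero, hX, smul_eq_zero,
    or_iff_right (inv_ne_zero (h0 s hs)), sub_eq_zero]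

/-! ### Proper `f`-biharmonic curves -/

/-- Geodesics are biharmonic, so they drop out. On the other solutions constancy of κ₁ is equivalent
to biharmonicity: a constant weight forces constant κ₁, and for constant κ₁ the Frenet equations
hold with a constant weight as well. -/
theorem isProperFBiharmonicCurve_iff (hC : HasConstantSectionalCurvature 𝓘(ℝ, E) M C)
    (hγ : SmoothCurve E J γ) (hconn : J.OrdConnected) (hne : J.Nonempty)
    (hunit : ∀ s ∈ J, ‖velocity 𝓘(ℝ, E) γ s‖ = 1) (hf : ContDiffOn ℝ ∞ f J)
    (hf0 : ∀ s ∈ J, 0 < f s) :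
    IsProperFBiharmonicCurve 𝓘(ℝ, E) f J γ ↔
      ∃ c₁ > 0, ∃ c ≥ 0, ∃ e, IsFrenetSolution E C c₁ c e J γ f ∧
        ∃ s ∈ J, ∃ t ∈ J, ‖tension 𝓘(ℝ, E) γ s‖⁻¹ ≠ ‖tension 𝓘(ℝ, E) γ t‖⁻¹ := by
  have hhalf : ContDiffOn ℝ ∞ (fun _ : ℝ => (1 / 2 : ℝ)) J := contDiffOn_const
  rw [IsProperFBiharmonicCurve, IsFBiharmonicCurve, IsBiharmonicCurve,
    isCriticalCurve_iff hC hγ hunit hf, isCriticalCurve_iff hC hγ hunit hhalf]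
  constructor
  · rintro ⟨hEL, hnot⟩
    rcases exists_isFrenetSolution hγ hconn hne hunit hf hf0 hEL with h0 | ⟨c₁, hc₁, c, hc, e, h⟩
    · refine absurd (fun s hs => ?_) hnot
      have hz : ∀ t ∈ J, (1 / 2 : ℝ) • tension 𝓘(ℝ, E) γ t = 0 := fun t ht => by
        rw [h0 t ht, smul_zero]
      have hW := (smoothAlong_tension hγ).smul hγ hhalf
      rw [eulerLagrange, hz s hs, smul_zero, add_zero]
      exact (hW.covDeriv hγ).covDeriv_eq_zero hγ (fun t ht => hW.covDeriv_eq_zero hγ hz ht) hs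
    · refine ⟨c₁, hc₁, c, hc, e, h, ?_⟩
      by_contra! hconst
      obtain ⟨s₀, hs₀⟩ := hne
      have hp := Real.rpow_pos_of_pos (h.pos s₀ hs₀) (-3 / 2 : ℝ)
      -- With κ₁ constant, this value of c₁ turns the weight c₁κ₁^(-3/2) into the constant 1/2; the
      -- other Frenet data do not involve the weight.
      refine hnot fun s hs => IsFrenetSolution.eulerLagrange_eq_zero
        (c₁ := 1 / 2 / ‖tension 𝓘(ℝ, E) γ s₀‖ ^ (-3 / 2 : ℝ)) (c := c) (e := e)
        ⟨h.pos, fun t ht => ?_, h.norm_scaledBinormal, h.covDeriv_scaledBinormal, h.radius⟩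
        hγ hhalf (fun _ _ => by norm_num) (by positivity) hs
      rw [inv_injective (hconst t ht s₀ hs₀), div_mul_cancel₀ _ hp.ne']
  · rintro ⟨c₁, hc₁, c, hc, e, h, s, hs, t, ht, hst⟩
    exact ⟨fun s hs => h.eulerLagrange_eq_zero hγ hf hf0 hc₁ hs, fun hEL => hst (by
      rw [norm_tension_eq_of_eulerLagrange_const (by norm_num) hγ hconn hunit hEL hs ht])⟩

/-- A constant κ would force C > 0 and e² = C(1+c²) by `IsRadiusSolution.of_const`, which the second
part of `IsChi.exists_isRadiusSolution` excludes. Hence χ is not constant on any nonempty open J. -/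
theorem IsChi.radius_of_eq {χ κ : ℝ → ℝ} (h : IsChi c C χ) (hJ : IsOpen J) (hne : J.Nonempty)
    (hκ : ∀ s ∈ J, κ s = χ s) : (∀ s ∈ J, 0 < κ s) ∧
      ∃ e, IsRadiusSolution C c e J (fun s => (κ s)⁻¹) ∧ ∃ s ∈ J, ∃ t ∈ J, (κ s)⁻¹ ≠ (κ t)⁻¹ := by
  obtain ⟨e, he, hCe⟩ := h.exists_isRadiusSolution
  have hr := he.congr hJ (subset_univ J) (u := fun s => (κ s)⁻¹) (fun s hs => by rw [hκ s hs])
  refine ⟨fun s hs => inv_pos.1 (hr.pos s hs), e, hr, ?_⟩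
  by_contra! hconst
  have := hr.of_const hJ hne hconst
  exact hCe this.1 this.2

theorem isProperFBiharmonicCurve_iff_frenetCurvature
    (hC : HasConstantSectionalCurvature 𝓘(ℝ, E) M C)
    (hγ : SmoothCurve E J γ) (hconn : J.OrdConnected) (hne : J.Nonempty)
    (hunit : ∀ s ∈ J, ‖velocity 𝓘(ℝ, E) γ s‖ = 1) (hf : ContDiffOn ℝ ∞ f J)
    (hf0 : ∀ s ∈ J, 0 < f s) :
    IsProperFBiharmonicCurve 𝓘(ℝ, E) f J γ ↔
      (∃ c₁ > 0, ∃ χ : ℝ → ℝ, IsChi 0 C χ ∧ ∀ s ∈ J,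
        frenetCurvature 𝓘(ℝ, E) γ 2 s = 0 ∧
        frenetCurvature 𝓘(ℝ, E) γ 1 s = χ s ∧
        f s = c₁ * frenetCurvature 𝓘(ℝ, E) γ 1 s ^ (-3 / 2 : ℝ)) ∨
      (∃ c₁ > 0, ∃ c₃ : ℝ, c₃ ≠ 0 ∧ ∃ χ : ℝ → ℝ, IsChi c₃ C χ ∧ ∀ s ∈ J,
        frenetCurvature 𝓘(ℝ, E) γ 3 s = 0 ∧
        frenetCurvature 𝓘(ℝ, E) γ 2 s / frenetCurvature 𝓘(ℝ, E) γ 1 s = c₃ ∧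
        frenetCurvature 𝓘(ℝ, E) γ 1 s = χ s ∧
        f s = c₁ * frenetCurvature 𝓘(ℝ, E) γ 1 s ^ (-3 / 2 : ℝ)) := by
  rw [isProperFBiharmonicCurve_iff hC hγ hconn hne hunit hf hf0]
  simp only [frenetCurvature_one, frenetCurvature_two]
  constructor
  · rintro ⟨c₁, hc₁, c, hc, e, h, hnc⟩
    obtain ⟨χ, hχ, hχκ⟩ := h.radius.exists_isChi hγ.isOpen hconn hne hnc
    simp only [inv_inv] at hχκ
    rcases hc.eq_or_lt with rfl | hc
    · exact Or.inl ⟨c₁, hc₁, χ, hχ, fun s hs =>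
        ⟨by rw [h.norm_scaledBinormal s hs, zero_mul], hχκ s hs, h.weight s hs⟩⟩
    · exact Or.inr ⟨c₁, hc₁, c, hc.ne', χ, hχ, fun s hs =>
        ⟨(frenetCurvature_three_eq_zero_iff hγ h.pos hc h.norm_scaledBinormal hs).2
          (h.covDeriv_scaledBinormal s hs),
        by rw [h.norm_scaledBinormal s hs, mul_div_cancel_right₀ _ (h.pos s hs).ne'],
        hχκ s hs, h.weight s hs⟩⟩
  · rintro (⟨c₁, hc₁, χ, hχ, h⟩ | ⟨c₁, hc₁, c, hc0, χ, hχ, h⟩)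
    · obtain ⟨hpos, e, hr, hnc⟩ := hχ.radius_of_eq hγ.isOpen hne fun s hs => (h s hs).2.1
      -- κ₂ = 0 is the case c = 0: B vanishes identically and the equation for ∇_T B is trivial.
      have hB : ∀ s ∈ J, scaledBinormal E γ s = 0 := fun s hs => norm_eq_zero.1 (h s hs).1
      refine ⟨c₁, hc₁, 0, le_rfl, e, ⟨hpos, fun s hs => (h s hs).2.2, fun s hs => ?_, fun s hs => ?_,
        hr⟩, hnc⟩
      · rw [hB s hs, norm_zero, zero_mul]
      · rw [(smoothAlong_scaledBinormal hγ hpos).covDeriv_eq_zero hγ hB hs, hB s hs]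
        simp
    · obtain ⟨hpos, e, hr, hnc⟩ := hχ.radius_of_eq hγ.isOpen hne fun s hs => (h s hs).2.2.1
      -- The constant is a quotient of norms, hence nonnegative, and it is nonzero by assumption.
      have hc : 0 < c := by
        obtain ⟨s, hs⟩ := hne
        refine lt_of_le_of_ne ?_ hc0.symm
        rw [← (h s hs).2.1]
        positivity
      have hB : ∀ s ∈ J, ‖scaledBinormal E γ s‖ = c * ‖tension 𝓘(ℝ, E) γ s‖ := fun s hs => by
        rw [← (h s hs).2.1, div_mul_cancel₀ _ (hpos s hs).ne']
      exact ⟨c₁, hc₁, c, hc.le, e, ⟨hpos, fun s hs => (h s hs).2.2.2, hB, fun s hs =>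
        (frenetCurvature_three_eq_zero_iff hγ hpos hc hB hs).1 (h s hs).1, hr⟩, hnc⟩

end

end

theorem theorem2p1 {n : ℕ} {M : Type*} [TopologicalSpace M] [T2Space M]
    [ChartedSpace (EuclideanSpace ℝ (Fin n)) M] [IsManifold (𝓡 n) ∞ M]
    [RiemannianBundle (fun x : M => TangentSpace (𝓡 n) x)]
    [IsContMDiffRiemannianBundle (𝓡 n) ∞ (EuclideanSpace ℝ (Fin n))
      (fun x : M => TangentSpace (𝓡 n) x)]
    (C : ℝ) (hC : HasConstantSectionalCurvature (𝓡 n) M C)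
    (J : Set ℝ) (hJ_open : IsOpen J) (hJ_conn : J.OrdConnected) (hJ_ne : J.Nonempty)
    (γ : ℝ → M) (hγ : ContMDiffOn 𝓘(ℝ, ℝ) (𝓡 n) ∞ γ J)
    (hγ_unit : ∀ s ∈ J, ‖velocity (𝓡 n) γ s‖ = 1)
    (f : ℝ → ℝ) (hf : ContDiffOn ℝ ∞ f J) (hf_pos : ∀ s ∈ J, 0 < f s) :
    IsProperFBiharmonicCurve (𝓡 n) f J γ ↔
      (∃ c₁ > 0, ∃ χ : ℝ → ℝ, IsChi 0 C χ ∧ ∀ s ∈ J,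
        frenetCurvature (𝓡 n) γ 2 s = 0 ∧
        frenetCurvature (𝓡 n) γ 1 s = χ s ∧
        f s = c₁ * frenetCurvature (𝓡 n) γ 1 s ^ (-3 / 2 : ℝ)) ∨
      (∃ c₁ > 0, ∃ c₃ : ℝ, c₃ ≠ 0 ∧ ∃ χ : ℝ → ℝ, IsChi c₃ C χ ∧ ∀ s ∈ J,
        frenetCurvature (𝓡 n) γ 3 s = 0 ∧
        frenetCurvature (𝓡 n) γ 2 s / frenetCurvature (𝓡 n) γ 1 s = c₃ ∧
        frenetCurvature (𝓡 n) γ 1 s = χ s ∧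
        f s = c₁ * frenetCurvature (𝓡 n) γ 1 s ^ (-3 / 2 : ℝ)) :=
  isProperFBiharmonicCurve_iff_frenetCurvature hC
    ⟨hJ_open, fun _ hs => hγ.contMDiffAt (hJ_open.mem_nhds hs)⟩ hJ_conn hJ_ne hγ_unit hf hf_pos
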